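/- Setting. Let $n$ be a positive integer, let $\mathcal X_0,\mathcal X,\mathcal Y$ be finite non-empty sets, and let $\oplus$ be an abelian group operation on $\mathcal Y$ (for instance bitwise XOR on bit strings). For $H:(\mathcal X_0\cup\mathcal Y)\times\mathcal X\to\mathcal Y$ and $\mathbf x=(x_0,x_1,\dots,x_n)\in\mathcal X_0\times\mathcal X^n$ define the hash chain $\mathbf h^{H,\mathbf x}=(h_1,\dots,h_n)$ by $h_1=H(x_0,x_1)$ and $h_i=H(h_{i-1},x_i)$ for $2\le i\le n$. A $q$-query oracle quantum algorithm $\mathcal A$ consists of a finite-dimensional initial unit state $|\phi_0\rangle$ and operators $A_1,\dots,A_q$, each a unitary or a product of a projection and a unitary; with oracle $H$ its final state is $\mathcal A^H|\phi_0\rangle=A_q\mathcal O^H\cdots A_1\mathcal O^H|\phi_0\rangle$, where $\mathcal O^H|c\rangle|v\rangle|y\rangle=|c\rangle|v\rangle|y\oplus c\cdot H(v)\rangle$, $c\in\{0,1\}$, acts on designated query registers. The final state is viewed on an output register (holding $\mathbf x\in\mathcal X_0\times\mathcal X^n$), a quantum output register $\mathsf Z$, and a garbage register. A quantum predicate $V$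 is a family of orthogonal projections $\Pi_{\mathbf x,\mathbf\Theta}$ on $\mathsf Z$ ($\mathbf x\in\mathcal X_0\times\mathcal X^n$, $\mathbf\Theta\in\mathcal Y^n$), and $$\Pr_H[\mathbf x=\mathbf x^\circ\wedge V(\mathbf x,\mathbf h^{H,\mathbf x},z):(\mathbf x,z)\leftarrow\mathcal A^H]=\mathbb E_H\big\|(|\mathbf x^\circ\rangle\langle\mathbf x^\circ|\otimes\Pi_{\mathbf x^\circ,\mathbf h^{H,\mathbf x^\circ}})\mathcal A^H|\phi_0\rangle\big\|^2$$ with $H$ uniformly random. Theorem (measure-and-reprogram, enforced extraction order). There is a black-box polynomial-time $(n+1)$-stage quantum algorithm $\mathcal S$, depending only on $n,\mathcal X_0,\mathcal X,\mathcal Y$ (with $\oplus$ and a numbering of their elements), with the following property. $\mathcal S$ is a program for a classically controlled quantum machine (classical and quantum memory, random choices, measurements) which answers the queries of $\mathcal A$ itself, can read the query registers and the output register of $\mathcal A$, and can only call the operations $A_1,\dots,A_q$ on the registers of $\mathcal A$, which start in $|\phi_0\rangle$. In stage $1$ it outputs $(x_0,x_1)$ and then receives $\Theta_1$; in stage $i$,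 $2\le i\le n$, it outputs $x_i$ and then receives $\Theta_i$; in stage $n+1$ it outputs the register $\mathsf Z$ as $z$. Its program length is bounded by a fixed polynomial in $n,\log|\mathcal X_0|,\log|\mathcal X|,\log|\mathcal Y|$ and, for every $q$ and every $q$-query $\mathcal A$, its running time (one unit per call of an $A_i$, logarithmic cost for arithmetic and register operations, including $\oplus$) is bounded by a fixed polynomial in $q,n,\log|\mathcal X_0|,\log|\mathcal X|,\log|\mathcal Y|$. For every $q\ge 0$ and every $q$-query oracle quantum algorithm $\mathcal A$ there are numbers $\epsilon_{\mathbf x^\circ}\ge 0$, $\mathbf x^\circ\in\mathcal X_0\times\mathcal X^n$, with $\sum_{\mathbf x^\circ}\epsilon_{\mathbf x^\circ}=\frac{n!}{|\mathcal Y|}$, such that for every $\mathbf x^\circ=(x^\circ_0,\dots,x^\circ_n)$ with $x^\circ_1,\dots,x^\circ_n$ pairwise distinct and every quantum predicate $V$, with $\mathbf\Theta$ uniformly random in $\mathcal Y^n$, $$\Pr_{\mathbf\Theta}\big[\mathbf x=\mathbf x^\circ\wedge V(\mathbf x,\mathbf\Theta,z):(\mathbf x,z)\leftarrow\langle\mathcal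 S^{\mathcal A},\mathbf\Theta\rangle\big]\;\ge\;\frac{n!}{(2q+n+1)^{2n}}\Pr_H\big[\mathbf x=\mathbf x^\circ\wedge V(\mathbf x,\mathbf h^{H,\mathbf x},z):(\mathbf x,z)\leftarrow\mathcal A^H\big]-\epsilon_{\mathbf x^\circ}.$$ -/

import Mathlib

/-! ### Oracle quantum algorithms -/

/-- A `q`-query oracle quantum algorithm with query inputs in `D`, query answers in `Y`, classical
output in `O` and quantum output register `Z`.  `σ` labels the computational basis of its whole
space. `queryReg` splits the space into the three query registers (control bit, input, answer) and
a rest `R`; `outReg` splits the same space into output register, register `Z` and garbage `E`.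
`op i` is applied right after query number `i`; it is a projection followed by a unitary (`P = 1` is
a plain unitary, and a unitary followed by a projection is also of this form). -/
structure OracleAlg (D Y O σ R Z E : Type*) [Fintype σ] [DecidableEq σ] (q : ℕ) where
  start : σ → ℂ
  start_norm : ∑ s, ‖start s‖ ^ 2 = 1
  op : Fin q → Matrix σ σ ℂ
  op_spec : ∀ i, ∃ U ∈ Matrix.unitaryGroup σ ℂ, ∃ P : Matrix σ σ ℂ,
    IsStarProjection P ∧ op i = U * P
  queryReg : σ ≃ Bool × D × Y × R
  outReg : σ ≃ O × Z × E

namespace OracleAlg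

variable {D Y O σ R Z E : Type*} [Fintype σ] [DecidableEq σ] {q : ℕ}

/-- Add `y` to the answer register of a basis state. -/
def addAnswer [Add Y] (A : OracleAlg D Y O σ R Z E q) (y : Y) (s : σ) : σ :=
  let t := A.queryReg s
  A.queryReg.symm (t.1, t.2.1, t.2.2.1 + y, t.2.2.2)

/-- The controlled query `|c⟩|x⟩|y⟩ ↦ |c⟩|x⟩|y + c · H x⟩`. -/
def query [AddCommGroup Y] (A : OracleAlg D Y O σ R Z E q) (H : D → Y) : Matrix σ σ ℂ :=
  fun s' s => if s' = A.addAnswer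
    (if (A.queryReg s).1 then H (A.queryReg s).2.1 else 0) s then 1 else 0

/-- The final state `A_q 𝒪^H ⋯ A_1 𝒪^H |φ₀⟩`. -/
noncomputable def finalState [AddCommGroup Y] (A : OracleAlg D Y O σ R Z E q) (H : D → Y) : σ → ℂ :=
  (List.finRange q).foldl (fun φ i => (A.op i).mulVec ((A.query H).mulVec φ)) A.start

open Classical in
/-- An operator on register `Z`, extended by the identity to the whole space. -/
noncomputable def liftZ (A : OracleAlg D Y O σ R Z E q) (Q : Matrix Z Z ℂ) : Matrix σ σ ℂ :=
  fun s t => if (A.outReg s).1 = (A.outReg t).1 ∧ (A.outReg s).2.2 = (A.outReg t).2.2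
    then Q (A.outReg s).2.1 (A.outReg t).2.1 else 0

open Classical in
/-- `‖(|x⟩⟨x| ⊗ Q) A^H |φ₀⟩‖²`: the probability, for the fixed function `H`, that the output
register is measured as `x` and that register `Z` then passes the projective test `Q`. -/
noncomputable def probOutput [AddCommGroup Y] (A : OracleAlg D Y O σ R Z E q) (H : D → Y)
    (x : O) (Q : Matrix Z Z ℂ) : ℝ :=
  ∑ s, if (A.outReg s).1 = x then ‖(A.liftZ Q).mulVec (A.finalState H) s‖ ^ 2 else 0

end OracleAlg

/-! ### A quantum machine with black-box access to an oracle algorithm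

The machine has a classical random access memory `ℕ → ℕ`, a quantum memory whose cells hold
natural numbers (superpositions of functions `ℕ → ℕ`), classical control, and access to the
registers of the black box.  Costs are logarithmic: an operation on numbers costs their bit length.
-/

/-- Classical arithmetic operations (subtraction is truncated). -/
inductive ArithOp
  | add | sub | mul | div | mod | eq

/-- Value of an arithmetic operation. -/
def ArithOp.apply : ArithOp → ℕ → ℕ → ℕ
  | add, a, b => a + b
  | sub, a, b => a - b
  | mul, a, b => a * b
  | div, a, b => a / b
  | mod, a, b => a % b
  | eq, a, b => if a = b then 1 else 0

/-- Classical expressions: literals, memory access (possibly indirect), arithmetic. -/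
inductive CExpr
  | lit (k : ℕ)
  | mem (e : CExpr)
  | bin (o : ArithOp) (e f : CExpr)

namespace CExpr

/-- Value of an expression in a classical memory. -/
def eval (m : ℕ → ℕ) : CExpr → ℕ
  | lit k => k
  | mem e => m (eval m e)
  | bin o e f => o.apply (eval m e) (eval m f)

/-- Evaluation cost: at every node, one plus the bit length of its value. -/
def cost (m : ℕ → ℕ) : CExpr → ℕ
  | lit k => 1 + k.size
  | mem e => cost m e + 1 + (m (eval m e)).size
  | bin o e f => cost m e + cost m f + 1 + (o.apply (eval m e) (eval m f)).size

/-- Length of the expression as a text. -/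
def size : CExpr → ℕ
  | lit k => 1 + k.size
  | mem e => 1 + size e
  | bin _ e f => 1 + size e + size f

end CExpr

/-- Expressions in the contents of the quantum memory cells; the addresses of the cells and the
constants are classical. -/
inductive QExpr
  | lit (e : CExpr)
  | cell (e : CExpr)
  | bin (o : ArithOp) (e f : QExpr)

namespace QExpr

/-- Value on a basis state `w` of the quantum memory; each intermediate result is reduced
modulo `M`. -/
def eval (M : ℕ) (m w : ℕ → ℕ) : QExpr → ℕ
  | lit e => e.eval m % M
  | cell e => w (e.eval m) % M
  | bin o e f => o.apply (eval M m w e) (eval M m w f) % M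

/-- Evaluation cost of an expression computed modulo `M`. -/
def cost (M : ℕ) (m : ℕ → ℕ) : QExpr → ℕ
  | lit e => e.cost m + 1 + M.size
  | cell e => e.cost m + 1 + M.size
  | bin _ e f => cost M m e + cost M m f + 1 + M.size

/-- Length of the expression as a text. -/
def size : QExpr → ℕ
  | lit e => 1 + e.size
  | cell e => 1 + e.size
  | bin _ e f => 1 + size e + size f

end QExpr

/-- The registers of the black box that the machine can read: control bit of the query, left and
right component of the query input, query answer, and the components of the classical output. -/
inductive Reg
  | ctrl
  | left
  | right
  | answer
  | out (e : CExpr)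

/-- Evaluation cost of the register name. -/
def Reg.cost (m : ℕ → ℕ) : Reg → ℕ
  | out e => 1 + e.cost m
  | _ => 1

/-- Length of the register name as a text. -/
def Reg.size : Reg → ℕ
  | out e => 1 + e.size
  | _ => 1

/-- Programs. -/
inductive Prog
  | skip
  | seq (P Q : Prog)
  /-- run `P` if the value of `e` is nonzero, else `Q` -/
  | ite (e : CExpr) (P Q : Prog)
  /-- evaluate `e` once and run `P` that many times -/
  | loop (e : CExpr) (P : Prog)
  /-- classical assignment: the cell with address `a` receives the value of `e` -/
  | assign (a e : CExpr)
  /-- the classical cell with address `a` receives a uniformly random element of `{0, …, e}` -/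
  | sample (a e : CExpr)
  /-- measure the quantum cell with address `b` into the classical cell with address `a` -/
  | measure (a b : CExpr)
  /-- coherently add the value of `f` to the quantum cell with address `a`, modulo `M` -/
  | addTo (a M : CExpr) (f : QExpr)
  /-- Hadamard gate on the quantum cell with address `a`, as a qubit -/
  | had (a : CExpr)
  /-- `π / 4` phase gate on the quantum cell with address `a`, as a qubit -/
  | phase (a : CExpr)
  /-- coherently add a register of the black box to the quantum cell with address `a` -/
  | read (r : Reg) (a : CExpr)
  /-- if the quantum cell with address `b` is nonzero, coherently add the element with the number in
  the quantum cell with address `a` to the answer register of the black box -/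
  | respond (b a : CExpr)
  /-- let the black box apply its operation with the number given by `e` (counted from `0`) -/
  | call (e : CExpr)

/-- Length of the program as a text. -/
def Prog.size : Prog → ℕ
  | skip => 1
  | seq P Q => 1 + P.size + Q.size
  | ite e P Q => 1 + e.size + P.size + Q.size
  | loop e P => 1 + e.size + P.size
  | assign a e => 1 + a.size + e.size
  | sample a e => 1 + a.size + e.size
  | measure a b => 1 + a.size + b.size
  | addTo a M f => 1 + a.size + M.size + f.size
  | had a => 1 + a.size
  | phase a => 1 + a.size
  | read r a => 1 + r.size + a.size
  | respond b a => 1 + b.size + a.size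
  | call e => 1 + e.size

/-- What a program sees of a black box with basis states `σ`: for every readable register the number
of its values and the number of its content, the operation on the answer register, and the
operations it can call. -/
structure BlackBox (σ : Type*) where
  range : (ℕ → ℕ) → Reg → ℕ
  content : (ℕ → ℕ) → Reg → σ → ℕ
  addAnswer : ℕ → σ → σ
  op : ℕ → Matrix σ σ ℂ

/-- Joint (unnormalized) state of the quantum memory and the black box. -/
abbrev JointState (σ : Type*) := ((ℕ → ℕ) × σ) →₀ ℂ

namespace JointState

variable {σ : Type*}

/-- Squared norm. -/
noncomputable def normSq (ψ : JointState σ) : ℝ := ψ.sum fun _ z => ‖z‖ ^ 2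

/-- Apply an operator to the space of the black box. -/
noncomputable def applyBox [Fintype σ] (T : Matrix σ σ ℂ) (ψ : JointState σ) : JointState σ :=
  ψ.sum fun b z => ∑ s, Finsupp.single (b.1, s) (T s b.2 * z)

/-- Apply a `2 × 2` matrix to the values `0, 1` of the quantum cell `a`; the other values are
fixed. -/
noncomputable def applyQubit (T : Matrix (Fin 2) (Fin 2) ℂ) (a : ℕ) (ψ : JointState σ) :
    JointState σ :=
  ψ.sum fun b z =>
    if h : b.1 a < 2 then
      ∑ j : Fin 2, Finsupp.single (Function.update b.1 a (j : ℕ), b.2) (T j ⟨b.1 a, h⟩ * z)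
    else Finsupp.single b z

end JointState

/-- Addition of `v` modulo `M` on `{0, …, M - 1}`, extended by the identity. -/
def modAdd (M v x : ℕ) : ℕ := if x < M then (x + v) % M else x

/-- One branch of a computation: elapsed time, classical memory and joint quantum state.  The squared
norm of the state is the probability of the branch. -/
structure Branch (σ : Type*) where
  time : ℕ
  mem : ℕ → ℕ
  state : JointState σ

/-- Let time pass. -/
def Branch.tick {σ : Type*} (t : ℕ) (c : Branch σ) : Branch σ := { c with time := c.time + t }

namespace Prog

variable {σ : Type*}

open Classical in
/-- Run a program; the result is the list of all branches, over all random choices and measurement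
outcomes. -/
noncomputable def exec [Fintype σ] (B : BlackBox σ) : Prog → Branch σ → List (Branch σ)
  | skip, c => [c.tick 1]
  | seq P Q, c => (exec B P c).flatMap (exec B Q)
  | ite e P Q, c =>
      if e.eval c.mem ≠ 0 then exec B P (c.tick (1 + e.cost c.mem))
      else exec B Q (c.tick (1 + e.cost c.mem))
  | loop e P, c =>
      (fun l : List (Branch σ) => l.flatMap fun d => exec B P (d.tick 1))^[e.eval c.mem]
        [c.tick (1 + e.cost c.mem)]
  | assign a e, c =>
      [{ time := c.time + 1 + a.cost c.mem + e.cost c.mem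
         mem := Function.update c.mem (a.eval c.mem) (e.eval c.mem)
         state := c.state }]
  | sample a e, c =>
      (List.range (e.eval c.mem + 1)).map fun v =>
        { time := c.time + 1 + a.cost c.mem + e.cost c.mem
          mem := Function.update c.mem (a.eval c.mem) v
          state := ((1 / Real.sqrt (e.eval c.mem + 1) : ℝ) : ℂ) • c.state }
  | measure a b, c =>
      (c.state.support.image fun s => s.1 (b.eval c.mem)).toList.map fun v =>
        { time := c.time + 1 + a.cost c.mem + b.cost c.mem + v.size
          mem := Function.update c.mem (a.eval c.mem) v
          state := c.state.filter fun s => s.1 (b.eval c.mem) = v }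
  | addTo a M f, c =>
      -- the target cell itself counts as `0` in `f`, so that the operation is reversible
      [{ time := c.time + 1 + a.cost c.mem + M.cost c.mem + f.cost (M.eval c.mem) c.mem
         mem := c.mem
         state := c.state.mapDomain fun s =>
          (Function.update s.1 (a.eval c.mem) (modAdd (M.eval c.mem)
            (f.eval (M.eval c.mem) c.mem (Function.update s.1 (a.eval c.mem) 0))
            (s.1 (a.eval c.mem))), s.2) }]
  | had a, c =>
      [{ time := c.time + 1 + a.cost c.mem
         mem := c.mem
         state := c.state.applyQubit
          (((1 / Real.sqrt 2 : ℝ) : ℂ) • !![1, 1; 1, -1]) (a.eval c.mem) }]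
  | phase a, c =>
      [{ time := c.time + 1 + a.cost c.mem
         mem := c.mem
         state := c.state.applyQubit
          !![1, 0; 0, Complex.exp (Complex.I * Real.pi / 4)] (a.eval c.mem) }]
  | read r a, c =>
      [{ time := c.time + 1 + r.cost c.mem + a.cost c.mem + (B.range c.mem r).size
         mem := c.mem
         state := c.state.mapDomain fun s =>
          (Function.update s.1 (a.eval c.mem)
            (modAdd (B.range c.mem r) (B.content c.mem r s.2) (s.1 (a.eval c.mem))), s.2) }]
  | respond b a, c =>
      [{ time := c.time + 1 + b.cost c.mem + a.cost c.mem + (B.range c.mem .answer).size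
         mem := c.mem
         state := c.state.mapDomain fun s =>
          (s.1, if s.1 (b.eval c.mem) ≠ 0 then B.addAnswer (s.1 (a.eval c.mem)) s.2 else s.2) }]
  | call e, c =>
      [{ time := c.time + 1 + e.cost c.mem
         mem := c.mem
         state := c.state.applyBox (B.op (e.eval c.mem)) }]

end Prog

/-- Run a multi-stage machine: first the stages of the list, each paired with the message that the
machine receives after it, and then the last stage.  After each stage of the list, the contents of
the classical cells `1` and `2` are the output of the stage, and the message is put into cell `0`.
Every branch comes with the list of its outputs. -/
noncomputable def interact {σ : Type*} [Fintype σ] (B : BlackBox σ) (last : Prog) :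
    List (Prog × ℕ) → Branch σ → List (List (ℕ × ℕ) × Branch σ)
  | [], c => (last.exec B c).map fun d => ([], d)
  | p :: rest, c =>
      (p.1.exec B c).flatMap fun d =>
        (interact B last rest { d with mem := Function.update d.mem 0 p.2 }).map fun r =>
          ((d.mem 1, d.mem 2) :: r.1, r.2)

/-- A machine with `n + 1` stages. -/
abbrev Simulator (n : ℕ) := Fin (n + 1) → Prog

/-- Length of the machine as a text. -/
def Simulator.size {n : ℕ} (S : Simulator n) : ℕ := ∑ i, (S i).size

/-! ### Hash chains -/

section Chain

variable {U X : Type*} [DecidableEq U] {X₀ Y : Finset U} {n : ℕ}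

/-- An element of `X₀` as left component of a hash input. -/
def leftOfX (x : X₀) : ↥(X₀ ∪ Y) := ⟨x, Finset.mem_union_left _ x.2⟩

/-- An element of `Y` as left component of a hash input. -/
def leftOfY (y : Y) : ↥(X₀ ∪ Y) := ⟨y, Finset.mem_union_right _ y.2⟩

/-- The hash chain `H (x₀, x₁)`, `H (h₁, x₂)`, …; positions are counted from `0`. -/
def hashChainAux (H : ↥(X₀ ∪ Y) × X → Y) (x : X₀ × (Fin n → X)) : (i : ℕ) → i < n → Y
  | 0, h => H (leftOfX x.1, x.2 ⟨0, h⟩)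
  | i + 1, h => H (leftOfY (hashChainAux H x i (Nat.lt_of_succ_lt h)), x.2 ⟨i + 1, h⟩)

/-- The tuple of all hashes of the hash chain. -/
def hashChain (H : ↥(X₀ ∪ Y) × X → Y) (x : X₀ × (Fin n → X)) (i : Fin n) : Y :=
  hashChainAux H x i i.2

/-- The representation of the elements of `X₀ ∪ Y` and `X` by numbers: both sets are numbered
consecutively from `0`, and the elements of `Y` come first. -/
structure HashNumbering (X : Type*) [Fintype X] (X₀ Y : Finset U) where
  left : ↥(X₀ ∪ Y) ≃ Fin (X₀ ∪ Y).card
  left_lt : ∀ w, (left w : ℕ) < Y.card ↔ (w : U) ∈ Y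
  right : X ≃ Fin (Fintype.card X)

variable [Fintype X] (N : HashNumbering X X₀ Y)

/-- The number of an element of `Y`. -/
def HashNumbering.ofY (y : Y) : ℕ := N.left (leftOfY y)

open Classical in
/-- The element of `Y` with a given number (zero if there is none). -/
noncomputable def HashNumbering.toY [Zero Y] (k : ℕ) : Y :=
  if h : ∃ y, N.ofY y = k then h.choose else 0

variable {σ R Z E : Type*} [Fintype σ] [DecidableEq σ] {q : ℕ}

/-- The oracle algorithm `A` as a black box. -/
noncomputable def OracleAlg.blackBox [AddCommGroup Y]
    (A : OracleAlg (↥(X₀ ∪ Y) × X) Y (X₀ × (Fin n → X)) σ R Z E q) : BlackBox σ where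
  range m
    | .ctrl => 2
    | .left => (X₀ ∪ Y).card
    | .right => Fintype.card X
    | .answer => Y.card
    | .out e => if e.eval m = 0 then (X₀ ∪ Y).card else Fintype.card X
  content m r s := match r with
    | .ctrl => (A.queryReg s).1.toNat
    | .left => N.left (A.queryReg s).2.1.1
    | .right => N.right (A.queryReg s).2.1.2
    | .answer => N.ofY (A.queryReg s).2.2.1
    | .out e => match e.eval m with
      | 0 => N.left (leftOfX (A.outReg s).1.1)
      | j + 1 => if h : j < n then N.right ((A.outReg s).1.2 ⟨j, h⟩) else 0
  addAnswer k := A.addAnswer (N.toY k)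
  op i := if h : i < q then A.op ⟨i, h⟩ else 1

/-- All branches of the execution of `S` with black-box access to `A` when it receives the messages
`Θ`, with their outputs.  At the beginning `q` is in the classical cell `0`, the rest of the memory
is zero, and the black box is in the initial state of `A`. -/
noncomputable def Simulator.run [AddCommGroup Y] (S : Simulator n)
    (A : OracleAlg (↥(X₀ ∪ Y) × X) Y (X₀ × (Fin n → X)) σ R Z E q) (Θ : Fin n → Y) :
    List (List (ℕ × ℕ) × Branch σ) :=
  interact (A.blackBox N) (S (Fin.last n))
    (List.ofFn fun i : Fin n => (S i.castSucc, N.ofY (Θ i)))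
    { time := 0
      mem := Function.update 0 0 q
      state := ∑ s, Finsupp.single (0, s) (A.start s) }

/-- The outputs of the first `n` stages are `x`: stage `1` outputs `x₁` and `x₀`, and stage `i ≥ 2`
outputs `xᵢ` (what it leaves in cell `2` is ignored). -/
def HashNumbering.IsOutput (x : X₀ × (Fin n → X)) (o : List (ℕ × ℕ)) : Prop :=
  o.map Prod.fst = List.ofFn (fun i => (N.right (x.2 i) : ℕ)) ∧
    o.head?.map Prod.snd = some (N.left (leftOfX x.1) : ℕ)

open Classical in
/-- The probability, for uniformly random `Θ`, that `S` with black-box access to `A` outputs `x` in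
its first `n` stages, and that register `Z` of `A`, output in the last stage, then passes the
test `V Θ`. -/
noncomputable def Simulator.prob [AddCommGroup Y] (S : Simulator n)
    (A : OracleAlg (↥(X₀ ∪ Y) × X) Y (X₀ × (Fin n → X)) σ R Z E q)
    (x : X₀ × (Fin n → X)) (V : (Fin n → Y) → Matrix Z Z ℂ) : ℝ :=
  (∑ Θ : Fin n → Y, ((S.run N A Θ).map fun r =>
    if N.IsOutput x r.1 then (r.2.state.applyBox (A.liftZ (V Θ))).normSq else 0).sum)
    / (Y.card : ℝ) ^ n

/-- The probability, for uniformly random `H`, that `A` outputs `x` and that register `Z` passes the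
test `V`, applied to the hash chain of `x`. -/
noncomputable def OracleAlg.chainProb [DecidableEq X] [AddCommGroup Y]
    (A : OracleAlg (↥(X₀ ∪ Y) × X) Y (X₀ × (Fin n → X)) σ R Z E q)
    (x : X₀ × (Fin n → X)) (V : (Fin n → Y) → Matrix Z Z ℂ) : ℝ :=
  (∑ H : ↥(X₀ ∪ Y) × X → Y, A.probOutput H x (V (hashChain H x)))
    / (Fintype.card (↥(X₀ ∪ Y) × X → Y) : ℝ)

end Chain

/-! Fix an output x and answers Θ. The points `chainPt x Θ` of the chain are v_j = (Θ_{j-1}, x_j),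
with x₀ in place of Θ₀₋₁ at the beginning. Distinct x₁, …, xₙ make them distinct, and overwriting a
uniformly random H by Θ at these points yields a uniformly random function whose hash chain is Θ
(`hashChain_extend`, `sum_extend`). So the success probability of the algorithm can be computed with
a reprogrammed oracle and averaged over H and Θ.

A query to the reprogrammed oracle equals the query to H plus, for every j, a correction that lives
on the query input v_j: the query answered with the new value at v_j minus the query answered with
the old one (`adv_reprogram`). After a correction at v_j the function is updated there and j leaves
the set of missing points. Iterating over all queries writes the final state as a signed sum of
branches, each of which extracts some points by projecting the query input. A weighted
Cauchy-Schwarz inequality bounds the squared norm of the sum by (2q+1)^n times the sum of the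
squared norms (`leaf_runFrom_le`).

The branches fall into two classes (`allV_eq`). In `rightV` the points are extracted in the order of
the chain. In `wrongV` some v_j is found although v_{j-1} is still missing; then the query input
contains Θ_{j-1}, which is uniform and independent of the current state, and this costs a factor
1/|Y|. By orthogonality of the projections the bound holds for the sum over all x at once
(`sum_wrongV_le`, `sum_wrongAvg_le`). Divided by the binomial coefficient below, this sum is at most
n!/|Y| (`pow_le_factorial_mul_choose`), and the rest of that budget is spread evenly over all x.

The simulator plays a random branch in the right order. At each query it decides whether to measure
the input, and if so whether the query is answered before or after the update; points that are never
extracted are read from the output register. Its choices give every branch probability at least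
1/C(2q+n, n) (`div_choose_le_sum`, `lb_afterVal_search`).

A truly random H is too large for an efficient machine. The value of a fixed set of branches is a
combination of functions of at most 2q values of the oracle (`rightV_mem_degSpan`), so a random
polynomial with 2q coefficients over Z/p^(q+n+3) has exactly the same average as a random function
into that ring (`sum_polyHash`). Reducing the values modulo |Y| costs at most the factor 1 -
1/(2q+n+1) (`card_mul_sum_le_sum_mod`, `one_sub_le_pow`), which the slack in the constant absorbs
(`factorial_div_pow_le`).

The program itself is analysed with two calculi. `Step` and `All` follow memory and time through
every branch. `LB` bounds expected values from below, working backwards and keeping only the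
measurement outcomes that lead to x; all other outcomes contribute nonnegative terms. -/

/-! ### Norms and reprogramming -/

/-- Squared norm of a vector. -/
noncomputable def nsq {σ : Type*} [Fintype σ] (φ : σ → ℂ) : ℝ := ∑ s, ‖φ s‖ ^ 2

section Nsq

variable {σ : Type*} [Fintype σ]

theorem nsq_eq_norm (φ : σ → ℂ) : nsq φ = ‖WithLp.toLp 2 φ‖ ^ 2 := by
  rw [EuclideanSpace.norm_sq_eq]; rfl

theorem nsq_nonneg (φ : σ → ℂ) : 0 ≤ nsq φ := Finset.sum_nonneg fun _ _ => by positivity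

theorem nsq_zero : nsq (0 : σ → ℂ) = 0 := by simp [nsq]

theorem nsq_smul (a : ℂ) (φ : σ → ℂ) : nsq (a • φ) = ‖a‖ ^ 2 * nsq φ := by
  simp [nsq, mul_pow, Finset.mul_sum]

theorem nsq_eq_re (φ : σ → ℂ) : (nsq φ : ℂ) = star φ ⬝ᵥ φ := by
  simp only [nsq, dotProduct, Pi.star_apply, RCLike.star_def, Complex.ofReal_sum]
  refine Finset.sum_congr rfl fun s _ => ?_
  rw [Complex.conj_mul']; push_cast; rfl

theorem nsq_unitary [DecidableEq σ] {U : Matrix σ σ ℂ} (hU : U ∈ Matrix.unitaryGroup σ ℂ)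
    (φ : σ → ℂ) : nsq (U.mulVec φ) = nsq φ := by
  have : (nsq (U.mulVec φ) : ℂ) = nsq φ := by
    rw [nsq_eq_re, nsq_eq_re, Matrix.star_mulVec, ← Matrix.dotProduct_mulVec,
      Matrix.mulVec_mulVec, ← Matrix.star_eq_conjTranspose, (Matrix.mem_unitaryGroup_iff').1 hU,
      Matrix.one_mulVec]
  exact_mod_cast this

theorem nsq_projection {P : Matrix σ σ ℂ} (hP : IsStarProjection P) (φ : σ → ℂ) :
    nsq (P.mulVec φ) ≤ nsq φ := by
  have h1 : P * P = P := hP.isIdempotentElem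
  have h2 : P.conjTranspose = P := hP.isSelfAdjoint
  have key : (nsq φ : ℂ) = nsq (P.mulVec φ) + nsq (φ - P.mulVec φ) := by
    rw [nsq_eq_re, nsq_eq_re, nsq_eq_re, star_sub, sub_dotProduct, dotProduct_sub,
      dotProduct_sub, Matrix.star_mulVec, ← Matrix.dotProduct_mulVec, ← Matrix.dotProduct_mulVec,
      Matrix.mulVec_mulVec, h2, h1]
    ring
  have key' : nsq φ = nsq (P.mulVec φ) + nsq (φ - P.mulVec φ) := by exact_mod_cast key
  have := nsq_nonneg (φ - P.mulVec φ)
  linarith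

end Nsq

/-! ### Queries and their expansion under reprogramming -/

namespace OracleAlg

variable {D Y O σ R Z E : Type*} [Fintype σ] [DecidableEq σ] {q : ℕ}

/-- The operation with number `i`, and the identity if there is none. -/
noncomputable def opAt (A : OracleAlg D Y O σ R Z E q) (i : ℕ) : Matrix σ σ ℂ :=
  if h : i < q then A.op ⟨i, h⟩ else 1

theorem nsq_opAt_le (A : OracleAlg D Y O σ R Z E q) (i : ℕ) (φ : σ → ℂ) :
    nsq ((A.opAt i).mulVec φ) ≤ nsq φ := by
  unfold opAt
  split_ifs with h
  · obtain ⟨U, hU, P, hP, he⟩ := A.op_spec ⟨i, h⟩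
    rw [he, ← Matrix.mulVec_mulVec, nsq_unitary hU]
    exact nsq_projection hP φ
  · simp

/-- Restriction to the basis states with query input `v`. -/
noncomputable def proj [DecidableEq D] (A : OracleAlg D Y O σ R Z E q) (v : D) :
    (σ → ℂ) →ₗ[ℂ] (σ → ℂ) where
  toFun φ s := if (A.queryReg s).2.1 = v then φ s else 0
  map_add' φ ψ := by ext s; simp only [Pi.add_apply]; split_ifs <;> simp
  map_smul' a φ := by ext s; simp

theorem proj_apply [DecidableEq D] (A : OracleAlg D Y O σ R Z E q) (v : D) (φ : σ → ℂ) (s : σ) :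
    A.proj v φ s = if (A.queryReg s).2.1 = v then φ s else 0 := rfl

/-- Pythagoras for a measurement of the query input. It lets sums over all outputs x, grouped by the
extracted point, cost one norm in total instead of one norm per point. -/
theorem sum_nsq_proj [Fintype D] [DecidableEq D] (A : OracleAlg D Y O σ R Z E q) (φ : σ → ℂ) :
    ∑ v, nsq (A.proj v φ) = nsq φ := by
  simp only [nsq]
  rw [Finset.sum_comm]
  refine Finset.sum_congr rfl fun s _ => ?_
  rw [Finset.sum_eq_single (A.queryReg s).2.1]
  · simp [proj_apply]
  · intro v _ hv
    simp [proj_apply, hv.symm]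
  · simp

section Query

variable [AddCommGroup Y]

/-- The permutation of the basis states by a query. -/
def queryPerm (A : OracleAlg D Y O σ R Z E q) (H : D → Y) : Equiv.Perm σ where
  toFun s := A.addAnswer (if (A.queryReg s).1 then H (A.queryReg s).2.1 else 0) s
  invFun s := A.addAnswer (-(if (A.queryReg s).1 then H (A.queryReg s).2.1 else 0)) s
  left_inv s := by simp [addAnswer]
  right_inv s := by simp [addAnswer]

theorem query_mulVec (A : OracleAlg D Y O σ R Z E q) (H : D → Y) (φ : σ → ℂ) :
    (A.query H).mulVec φ = fun s => φ ((A.queryPerm H).symm s) := by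
  ext s
  simp only [Matrix.mulVec, dotProduct, query]
  rw [Finset.sum_eq_single ((A.queryPerm H).symm s)]
  · have : s = A.queryPerm H ((A.queryPerm H).symm s) := by simp
    exact (congrArg (· * _) (if_pos this)).trans (one_mul _)
  · intro t _ ht
    rw [if_neg, zero_mul]
    intro h
    apply ht
    rw [h]
    exact ((A.queryPerm H).symm_apply_apply t).symm
  · simp

theorem queryPerm_symm_input (A : OracleAlg D Y O σ R Z E q) (H : D → Y) (s : σ) :
    (A.queryReg ((A.queryPerm H).symm s)).2.1 = (A.queryReg s).2.1 := by
  simp [queryPerm, addAnswer]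

/-- Locality of a query: a basis state only feels the value of the oracle at its own query input.
Both the expansion under reprogramming and the degree bound rest on this. -/
theorem queryPerm_symm_congr (A : OracleAlg D Y O σ R Z E q) {H H' : D → Y} {s : σ}
    (h : H (A.queryReg s).2.1 = H' (A.queryReg s).2.1) :
    (A.queryPerm H).symm s = (A.queryPerm H').symm s := by
  simp [queryPerm, h]

/-- Query number `i`, followed by the operation number `i`. -/
noncomputable def adv (A : OracleAlg D Y O σ R Z E q) (i : ℕ) (H : D → Y) :
    (σ → ℂ) →ₗ[ℂ] (σ → ℂ) :=
  (Matrix.mulVecLin (A.opAt i)).comp (Matrix.mulVecLin (A.query H))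

theorem nsq_adv_le (A : OracleAlg D Y O σ R Z E q) (i : ℕ) (H : D → Y) (φ : σ → ℂ) :
    nsq (A.adv i H φ) ≤ nsq φ := by
  refine (A.nsq_opAt_le i _).trans (le_of_eq ?_)
  rw [Matrix.mulVecLin_apply, query_mulVec]
  exact Equiv.sum_comp (A.queryPerm H).symm fun s => ‖φ s‖ ^ 2

/-- The last `κ` queries and operations. -/
noncomputable def runFrom (A : OracleAlg D Y O σ R Z E q) (H : D → Y) :
    ℕ → (σ → ℂ) →ₗ[ℂ] (σ → ℂ)
  | 0 => LinearMap.id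
  | κ + 1 => (runFrom A H κ).comp (A.adv (q - (κ + 1)) H)

theorem runFrom_start (A : OracleAlg D Y O σ R Z E q) (H : D → Y) :
    A.runFrom H q A.start = A.finalState H := by
  -- The recursion counts the queries that remain, the fold those already made; the last κ
  -- operations have the numbers q - κ, …, q - 1.
  have h1 : ∀ κ ≤ q, ∀ φ, A.runFrom H κ φ =
      (List.range' (q - κ) κ).foldl (fun φ i => A.adv i H φ) φ := by
    intro κ
    induction κ with
    | zero => intro _ φ; rfl
    | succ κ ih =>
      intro h φ
      rw [List.range'_succ, List.foldl_cons, show q - (κ + 1) + 1 = q - κ by omega,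
        ← ih (by omega)]
      rfl
  rw [h1 q le_rfl, Nat.sub_self, ← List.range_eq_range', ← List.map_coe_finRange_eq_range,
    List.foldl_map]
  unfold finalState
  congr 1
  ext φ i s
  simp [adv, opAt]

variable [DecidableEq D]

/-- A query to a reprogrammed function, expanded according to the reprogrammed points. -/
theorem adv_reprogram (A : OracleAlg D Y O σ R Z E q) (i : ℕ) {ι : Type*} (I : Finset ι)
    {v : ι → D} (hv : Function.Injective v) (Θ : ι → Y) (H T : D → Y)
    (h1 : ∀ j ∈ I, T (v j) = Θ j) (h2 : ∀ d, (∀ j ∈ I, d ≠ v j) → T d = H d) (φ : σ → ℂ) :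
    A.adv i T φ = A.adv i H φ + ∑ j ∈ I,
      (A.adv i (Function.update H (v j) (Θ j)) (A.proj (v j) φ) - A.adv i H (A.proj (v j) φ)) := by
  -- Compared amplitude by amplitude: since v is injective, at most one correction is nonzero at a
  -- basis state, and there it replaces the answer of H by that of T.
  have key : (A.query T).mulVec φ = (A.query H).mulVec φ + ∑ j ∈ I,
      ((A.query (Function.update H (v j) (Θ j))).mulVec (A.proj (v j) φ)
        - (A.query H).mulVec (A.proj (v j) φ)) := by
    ext s
    simp only [query_mulVec, Pi.add_apply, Finset.sum_apply, Pi.sub_apply, proj_apply,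
      queryPerm_symm_input]
    by_cases hs : ∃ j ∈ I, (A.queryReg s).2.1 = v j
    · obtain ⟨j, hj, hsj⟩ := hs
      rw [Finset.sum_eq_single j]
      · rw [if_pos hsj, if_pos hsj, A.queryPerm_symm_congr (H' := Function.update H (v j) (Θ j))]
        · ring
        · rw [hsj, h1 j hj, Function.update_self]
      · intro k _ hk
        have : ¬ (A.queryReg s).2.1 = v k := fun h => hk (hv (h.symm.trans hsj))
        simp [this]
      · exact fun h => absurd hj h
    · push Not at hs
      rw [Finset.sum_eq_zero, add_zero, A.queryPerm_symm_congr (h2 _ hs)]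
      intro k hk
      simp [hs k hk]
  simp only [adv, LinearMap.comp_apply, Matrix.mulVecLin_apply, key, Matrix.mulVec_add,
    Matrix.mulVec_sum, Matrix.mulVec_sub]

section Patterns

variable {n : ℕ}

/-- Sum of the leaf values over all ways to extract points with indices in `I` during the last `κ`
queries. -/
noncomputable def allV (A : OracleAlg D Y O σ R Z E q) (leaf : (σ → ℂ) → ℝ) (v : Fin n → D)
    (Θ : Fin n → Y) : ℕ → Finset (Fin n) → (D → Y) → (σ → ℂ) → ℝ
  | 0, _, _, φ => leaf φ
  | κ + 1, I, H, φ => allV A leaf v Θ κ I H (A.adv (q - (κ + 1)) H φ) + ∑ j ∈ I,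
      (allV A leaf v Θ κ (I.erase j) (Function.update H (v j) (Θ j))
          (A.adv (q - (κ + 1)) (Function.update H (v j) (Θ j)) (A.proj (v j) φ))
        + allV A leaf v Θ κ (I.erase j) (Function.update H (v j) (Θ j))
          (A.adv (q - (κ + 1)) H (A.proj (v j) φ)))

/-- The part of `allV` where the points are extracted in the right order, from number `s` on. -/
noncomputable def rightV (A : OracleAlg D Y O σ R Z E q) (leaf : (σ → ℂ) → ℝ) (v : Fin n → D)
    (Θ : Fin n → Y) : ℕ → ℕ → (D → Y) → (σ → ℂ) → ℝ
  | 0, _, _, φ => leaf φ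
  | κ + 1, s, H, φ => rightV A leaf v Θ κ s H (A.adv (q - (κ + 1)) H φ) +
      if h : s < n then
        rightV A leaf v Θ κ (s + 1) (Function.update H (v ⟨s, h⟩) (Θ ⟨s, h⟩))
          (A.adv (q - (κ + 1)) (Function.update H (v ⟨s, h⟩) (Θ ⟨s, h⟩)) (A.proj (v ⟨s, h⟩) φ))
        + rightV A leaf v Θ κ (s + 1) (Function.update H (v ⟨s, h⟩) (Θ ⟨s, h⟩))
          (A.adv (q - (κ + 1)) H (A.proj (v ⟨s, h⟩) φ))
      else 0

/-- The indices from `s` on. -/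
def idxFrom (n s : ℕ) : Finset (Fin n) := Finset.univ.filter fun j => s ≤ (j : ℕ)

/-- The part of `allV` where, after right extractions, some point is extracted too early. -/
noncomputable def wrongV (A : OracleAlg D Y O σ R Z E q) (leaf : (σ → ℂ) → ℝ) (v : Fin n → D)
    (Θ : Fin n → Y) : ℕ → ℕ → (D → Y) → (σ → ℂ) → ℝ
  | 0, _, _, _ => 0
  | κ + 1, s, H, φ => wrongV A leaf v Θ κ s H (A.adv (q - (κ + 1)) H φ) +
      (if h : s < n then
        wrongV A leaf v Θ κ (s + 1) (Function.update H (v ⟨s, h⟩) (Θ ⟨s, h⟩))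
          (A.adv (q - (κ + 1)) (Function.update H (v ⟨s, h⟩) (Θ ⟨s, h⟩)) (A.proj (v ⟨s, h⟩) φ))
        + wrongV A leaf v Θ κ (s + 1) (Function.update H (v ⟨s, h⟩) (Θ ⟨s, h⟩))
          (A.adv (q - (κ + 1)) H (A.proj (v ⟨s, h⟩) φ))
      else 0) + ∑ j ∈ idxFrom n (s + 1),
      (A.allV leaf v Θ κ ((idxFrom n s).erase j) (Function.update H (v j) (Θ j))
          (A.adv (q - (κ + 1)) (Function.update H (v j) (Θ j)) (A.proj (v j) φ))
        + A.allV leaf v Θ κ ((idxFrom n s).erase j) (Function.update H (v j) (Θ j))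
          (A.adv (q - (κ + 1)) H (A.proj (v j) φ)))

theorem idxFrom_erase {s : ℕ} (h : s < n) :
    (idxFrom n s).erase ⟨s, h⟩ = idxFrom n (s + 1) := by
  ext j
  simp only [idxFrom, Finset.mem_erase, Finset.mem_filter, Finset.mem_univ, true_and, Fin.ext_iff,
    ne_eq]
  omega

theorem idxFrom_eq_empty {s : ℕ} (h : n ≤ s) : idxFrom n s = ∅ := by
  ext j
  have := j.2
  simp [idxFrom]
  omega

theorem card_idxFrom (s : ℕ) : (idxFrom n s).card = n - s := by
  by_cases hs : s ≤ n
  · induction hs using Nat.decreasingInduction with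
    | self => rw [idxFrom_eq_empty le_rfl]; simp
    | of_succ s h ih =>
      have hm : (⟨s, h⟩ : Fin n) ∈ idxFrom n s := by simp [idxFrom]
      have := Finset.card_erase_add_one hm
      rw [idxFrom_erase h, ih] at this
      omega
  · rw [idxFrom_eq_empty (by omega)]; simp; omega

/-- The next extracted index is either the smallest missing one, which continues the recursion, or a
larger one, in which case every continuation is charged to `wrongV`. -/
theorem allV_eq (A : OracleAlg D Y O σ R Z E q) (leaf : (σ → ℂ) → ℝ) (v : Fin n → D)
    (Θ : Fin n → Y) (κ s : ℕ) (H : D → Y) (φ : σ → ℂ) :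
    A.allV leaf v Θ κ (idxFrom n s) H φ =
      A.rightV leaf v Θ κ s H φ + A.wrongV leaf v Θ κ s H φ := by
  induction κ generalizing s H φ with
  | zero => simp [allV, rightV, wrongV]
  | succ κ ih =>
    rw [allV, rightV, wrongV, ih]
    by_cases h : s < n
    · have hm : (⟨s, h⟩ : Fin n) ∈ idxFrom n s := by simp [idxFrom]
      rw [← Finset.add_sum_erase _ _ hm, idxFrom_erase h, dif_pos h, dif_pos h, ih, ih]
      ring
    · rw [dif_neg h, dif_neg h, idxFrom_eq_empty (by omega), idxFrom_eq_empty (by omega)]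
      simp

theorem allV_mono (A : OracleAlg D Y O σ R Z E q) {leaf leaf' : (σ → ℂ) → ℝ}
    (hl : ∀ φ, leaf φ ≤ leaf' φ) (v : Fin n → D)
    (Θ : Fin n → Y) (κ : ℕ) (I : Finset (Fin n)) (H : D → Y) (φ : σ → ℂ) :
    A.allV leaf v Θ κ I H φ ≤ A.allV leaf' v Θ κ I H φ := by
  induction κ generalizing I H φ with
  | zero => exact hl φ
  | succ κ ih =>
    rw [allV, allV]
    gcongr <;> apply ih

theorem wrongV_mono (A : OracleAlg D Y O σ R Z E q) {leaf leaf' : (σ → ℂ) → ℝ}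
    (hl : ∀ φ, leaf φ ≤ leaf' φ) (v : Fin n → D)
    (Θ : Fin n → Y) (κ s : ℕ) (H : D → Y) (φ : σ → ℂ) :
    A.wrongV leaf v Θ κ s H φ ≤ A.wrongV leaf' v Θ κ s H φ := by
  induction κ generalizing s H φ with
  | zero => exact le_rfl
  | succ κ ih =>
    rw [wrongV, wrongV]
    have h2 := A.allV_mono hl v Θ κ
    split_ifs
    all_goals
      gcongr
      all_goals first | exact ih .. | exact h2 ..

theorem allV_nonneg (A : OracleAlg D Y O σ R Z E q) {leaf : (σ → ℂ) → ℝ}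
    (hl : ∀ φ, 0 ≤ leaf φ) (v : Fin n → D)
    (Θ : Fin n → Y) (κ : ℕ) (I : Finset (Fin n)) (H : D → Y) (φ : σ → ℂ) :
    0 ≤ A.allV leaf v Θ κ I H φ := by
  induction κ generalizing I H φ with
  | zero => exact hl φ
  | succ κ ih =>
    rw [allV]
    exact add_nonneg (ih ..) (Finset.sum_nonneg fun _ _ => add_nonneg (ih ..) (ih ..))

theorem rightV_nonneg (A : OracleAlg D Y O σ R Z E q) {leaf : (σ → ℂ) → ℝ}
    (hl : ∀ φ, 0 ≤ leaf φ) (v : Fin n → D)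
    (Θ : Fin n → Y) (κ s : ℕ) (H : D → Y) (φ : σ → ℂ) :
    0 ≤ A.rightV leaf v Θ κ s H φ := by
  induction κ generalizing s H φ with
  | zero => exact hl φ
  | succ κ ih =>
    rw [rightV]
    refine add_nonneg (ih ..) ?_
    split_ifs
    · exact add_nonneg (ih ..) (ih ..)
    · exact le_rfl

theorem wrongV_nonneg (A : OracleAlg D Y O σ R Z E q) {leaf : (σ → ℂ) → ℝ}
    (hl : ∀ φ, 0 ≤ leaf φ) (v : Fin n → D)
    (Θ : Fin n → Y) (κ s : ℕ) (H : D → Y) (φ : σ → ℂ) :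
    0 ≤ A.wrongV leaf v Θ κ s H φ := by
  induction κ generalizing s H φ with
  | zero => exact le_rfl
  | succ κ ih =>
    rw [wrongV]
    refine add_nonneg (add_nonneg (ih ..) ?_) (Finset.sum_nonneg fun _ _ =>
      add_nonneg (A.allV_nonneg hl ..) (A.allV_nonneg hl ..))
    split_ifs
    · exact add_nonneg (ih ..) (ih ..)
    · exact le_rfl

/-- A random choice among M alternatives scales the state by 1/√M; this homogeneity turns that into
the probability 1/M. -/
theorem rightV_smul (A : OracleAlg D Y O σ R Z E q) {leaf : (σ → ℂ) → ℝ}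
    (hl : ∀ (a : ℂ) φ, leaf (a • φ) = ‖a‖ ^ 2 * leaf φ) (v : Fin n → D)
    (Θ : Fin n → Y) (κ s : ℕ) (H : D → Y) (a : ℂ) (φ : σ → ℂ) :
    A.rightV leaf v Θ κ s H (a • φ) = ‖a‖ ^ 2 * A.rightV leaf v Θ κ s H φ := by
  induction κ generalizing s H φ with
  | zero => exact hl a φ
  | succ κ ih =>
    rw [rightV, rightV]
    simp only [map_smul, ih]
    split_ifs <;> ring

end Patterns

end Query

end OracleAlg

/-! ### Cauchy-Schwarz with weights for the branches -/

/-- The first two terms of the binomial expansion. With a = 2κ + 1 this is the recursion behind the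
weight (2κ+1)^r: one more query allows each of the r missing points to be extracted in two ways. -/
theorem pow_add_le_add_two_pow {a : ℝ} (ha : 0 ≤ a) (r : ℕ) :
    a ^ r + 2 * r * a ^ (r - 1) ≤ (a + 2) ^ r := by
  induction r with
  | zero => simp
  | succ r ih =>
    rw [pow_succ (a + 2)]
    have h1 : (a ^ r + 2 * r * a ^ (r - 1)) * (a + 2) ≤ (a + 2) ^ r * (a + 2) := by gcongr
    refine le_trans ?_ h1
    have h2 : (r : ℝ) * a ^ (r - 1) * a = r * a ^ r := by
      cases r with
      | zero => simp
      | succ r => simp; ring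
    have h3 : 0 ≤ (r : ℝ) * a ^ (r - 1) := by positivity
    simp only [Nat.add_sub_cancel]
    push_cast
    nlinarith [pow_succ a r]

/-- Cauchy-Schwarz for two terms, with the mixed term controlled by the inequality of arithmetic and
geometric means. Unequal weights matter, because branches with fewer missing points have fewer
descendants. -/
theorem sq_add_le_of_sq_le {a s w w' x y : ℝ} (hw : 0 ≤ w) (hw' : 0 ≤ w')
    (hx : 0 ≤ x) (hy : 0 ≤ y) (h1 : a ^ 2 ≤ w * x) (h2 : s ^ 2 ≤ w' * y) :
    (a + s) ^ 2 ≤ (w + w') * (x + y) := by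
  have h3 : 2 * (a * s) ≤ w * y + w' * x := by
    refine le_of_sq_le_sq ?_ (by positivity)
    have h4 : a ^ 2 * s ^ 2 ≤ (w * x) * (w' * y) := by gcongr
    nlinarith [sq_nonneg (w * y - w' * x)]
  nlinarith

namespace OracleAlg

variable {D Y O σ R Z E : Type*} [Fintype σ] [DecidableEq σ] {q : ℕ}

/-- One query produces 1 + 2|I| vectors. The unextracted one gets weight (2κ+1)^|I|, the others
(2κ+1)^(|I|-1) each, and these weights add up to at most (2κ+3)^|I|. -/
theorem leaf_runFrom_le [AddCommGroup Y] [DecidableEq D] {n : ℕ} (A : OracleAlg D Y O σ R Z E q)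
    (L : (σ → ℂ) →ₗ[ℂ] (σ → ℂ)) {v : Fin n → D} (hv : Function.Injective v) (Θ : Fin n → Y)
    (T : D → Y) (κ : ℕ) (I : Finset (Fin n)) (H : D → Y) (φ : σ → ℂ)
    (h1 : ∀ j ∈ I, T (v j) = Θ j) (h2 : ∀ d, (∀ j ∈ I, d ≠ v j) → T d = H d) :
    nsq (L (A.runFrom T κ φ)) ≤
      (2 * κ + 1) ^ I.card * A.allV (fun φ => nsq (L φ)) v Θ κ I H φ := by
  have hl : ∀ φ, 0 ≤ nsq (L φ) := fun φ => nsq_nonneg _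
  induction κ generalizing I H φ with
  | zero => simp [runFrom, allV]
  | succ κ ih =>
    set i := q - (κ + 1)
    set H' : Fin n → D → Y := fun j => Function.update H (v j) (Θ j)
    -- Once H is updated at v_j, the target T differs from it at most at the points with index in
    -- `I.erase j`, so the induction hypothesis applies to the smaller index set.
    have step : ∀ j ∈ I, ∀ ψ, nsq (L (A.runFrom T κ ψ)) ≤ (2 * κ + 1) ^ (I.card - 1) *
        A.allV (fun φ => nsq (L φ)) v Θ κ (I.erase j) (H' j) ψ := by
      intro j hj ψ
      have := ih (I.erase j) (H' j) ψ (fun k hk => h1 k (Finset.mem_of_mem_erase hk)) ?_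
      · rwa [Finset.card_erase_of_mem hj] at this
      · intro d hd
        by_cases hdj : d = v j
        · simp only [H', hdj, Function.update_self]; exact h1 j hj
        · simp only [H', Function.update_of_ne hdj]
          refine h2 d fun k hk => ?_
          by_cases hkj : k = j
          · rwa [hkj]
          · exact hd k (Finset.mem_erase.2 ⟨hkj, hk⟩)
    have e1 : L (A.runFrom T (κ + 1) φ) = L (A.runFrom T κ (A.adv i H φ)) + ∑ j ∈ I,
        (L (A.runFrom T κ (A.adv i (H' j) (A.proj (v j) φ)))
          - L (A.runFrom T κ (A.adv i H (A.proj (v j) φ)))) := by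
      rw [runFrom, LinearMap.comp_apply, A.adv_reprogram _ I hv Θ H T h1 h2]
      simp only [map_add, map_sum, map_sub, i, H']
    set N : (σ → ℂ) → ℝ := fun ψ => ‖WithLp.toLp 2 (L (A.runFrom T κ ψ))‖
    have hN : ∀ ψ, N ψ ^ 2 = nsq (L (A.runFrom T κ ψ)) := fun ψ => (nsq_eq_norm _).symm
    have e2 : ‖WithLp.toLp 2 (L (A.runFrom T (κ + 1) φ))‖ ≤ N (A.adv i H φ) + ∑ j ∈ I,
        (N (A.adv i (H' j) (A.proj (v j) φ)) + N (A.adv i H (A.proj (v j) φ))) := by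
      rw [e1, WithLp.toLp_add, WithLp.toLp_sum]
      refine (norm_add_le _ _).trans (add_le_add le_rfl ((norm_sum_le _ _).trans
        (Finset.sum_le_sum fun j _ => ?_)))
      rw [WithLp.toLp_sub]
      exact norm_sub_le _ _
    rw [nsq_eq_norm]
    refine (pow_le_pow_left₀ (norm_nonneg _) e2 2).trans ?_
    -- The factor 2 per index comes from merging the two corrections at v_j, answered with the new
    -- and with the old value.
    have e3 : (∑ j ∈ I, (N (A.adv i (H' j) (A.proj (v j) φ)) + N (A.adv i H (A.proj (v j) φ)))) ^ 2
        ≤ (∑ j ∈ I, 2 * (2 * κ + 1 : ℝ) ^ (I.card - 1)) * ∑ j ∈ I,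
          (A.allV (fun φ => nsq (L φ)) v Θ κ (I.erase j) (H' j)
            (A.adv i (H' j) (A.proj (v j) φ))
          + A.allV (fun φ => nsq (L φ)) v Θ κ (I.erase j) (H' j)
            (A.adv i H (A.proj (v j) φ))) := by
      refine Finset.sum_sq_le_sum_mul_sum_of_sq_le_mul _ (fun j _ => by positivity)
        (fun j _ => add_nonneg (A.allV_nonneg hl ..) (A.allV_nonneg hl ..)) fun j hj => ?_
      have b1 := step j hj (A.adv i (H' j) (A.proj (v j) φ))
      have b2 := step j hj (A.adv i H (A.proj (v j) φ))
      rw [← hN] at b1 b2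
      nlinarith [sq_nonneg (N (A.adv i (H' j) (A.proj (v j) φ)) - N (A.adv i H (A.proj (v j) φ)))]
    have e4 := ih I H (A.adv i H φ) h1 h2
    rw [← hN] at e4
    refine (sq_add_le_of_sq_le (by positivity) (by positivity) (A.allV_nonneg hl ..)
      (Finset.sum_nonneg fun j _ => add_nonneg (A.allV_nonneg hl ..) (A.allV_nonneg hl ..))
      e4 e3).trans ?_
    rw [allV]
    refine mul_le_mul_of_nonneg_right ?_ (add_nonneg (A.allV_nonneg hl ..)
      (Finset.sum_nonneg fun j _ => add_nonneg (A.allV_nonneg hl ..) (A.allV_nonneg hl ..)))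
    have := pow_add_le_add_two_pow (a := 2 * κ + 1) (by positivity) I.card
    rw [Finset.sum_const, nsmul_eq_mul]
    push_cast
    refine le_trans (le_of_eq ?_) (this.trans (le_of_eq ?_)) <;> ring

open Classical in
/-- Squared norm of the part with output `x`. -/
noncomputable def outNsq (A : OracleAlg D Y O σ R Z E q) (x : O) (φ : σ → ℂ) : ℝ :=
  ∑ s, if (A.outReg s).1 = x then ‖φ s‖ ^ 2 else 0

theorem outNsq_nonneg (A : OracleAlg D Y O σ R Z E q) (x : O) (φ : σ → ℂ) : 0 ≤ A.outNsq x φ :=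
  Finset.sum_nonneg fun _ _ => by split_ifs <;> positivity

theorem sum_outNsq [Fintype O] (A : OracleAlg D Y O σ R Z E q) (φ : σ → ℂ) :
    ∑ x, A.outNsq x φ = nsq φ := by
  classical
  simp only [outNsq, nsq]
  rw [Finset.sum_comm]
  exact Finset.sum_congr rfl fun s _ => by simp

open Classical in
/-- Restriction to the basis states with output `x`. -/
noncomputable def outProj (A : OracleAlg D Y O σ R Z E q) (x : O) : (σ → ℂ) →ₗ[ℂ] (σ → ℂ) where
  toFun φ s := if (A.outReg s).1 = x then φ s else 0
  map_add' φ ψ := by ext s; simp only [Pi.add_apply]; split_ifs <;> simp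
  map_smul' a φ := by ext s; simp

theorem nsq_outProj (A : OracleAlg D Y O σ R Z E q) (x : O) (φ : σ → ℂ) :
    nsq (A.outProj x φ) = A.outNsq x φ := by
  classical
  refine Finset.sum_congr rfl fun s _ => ?_
  simp only [outProj, LinearMap.coe_mk, AddHom.coe_mk]
  split_ifs <;> simp

theorem liftZ_mulVec (A : OracleAlg D Y O σ R Z E q) [Fintype Z] (Q : Matrix Z Z ℂ) (φ : σ → ℂ)
    (s : σ) : (A.liftZ Q).mulVec φ s = ∑ z, Q (A.outReg s).2.1 z *
      φ (A.outReg.symm ((A.outReg s).1, z, (A.outReg s).2.2)) := by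
  symm
  refine Fintype.sum_of_injective (fun z => A.outReg.symm ((A.outReg s).1, z, (A.outReg s).2.2))
    (fun z z' h => by simpa using h) _ _ (fun t ht => ?_) (fun z => by simp [liftZ])
  refine (congrArg (· * _) (if_neg ?_)).trans (zero_mul _)
  rintro ⟨h1, h2⟩
  exact ht ⟨(A.outReg t).2.1, by simp [h1, h2]⟩

theorem liftZ_outProj (A : OracleAlg D Y O σ R Z E q) [Fintype Z] (Q : Matrix Z Z ℂ) (x : O)
    (φ : σ → ℂ) :
    (A.liftZ Q).mulVec (A.outProj x φ) = A.outProj x ((A.liftZ Q).mulVec φ) := by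
  classical
  ext s
  rw [liftZ_mulVec]
  simp only [outProj, LinearMap.coe_mk, AddHom.coe_mk, Equiv.apply_symm_apply]
  split_ifs with h
  · rw [liftZ_mulVec]
  · simp

theorem isStarProjection_liftZ (A : OracleAlg D Y O σ R Z E q) [Fintype Z] {Q : Matrix Z Z ℂ}
    (hQ : IsStarProjection Q) : IsStarProjection (A.liftZ Q) := by
  constructor
  · ext s t
    have := liftZ_mulVec A Q (fun u => A.liftZ Q u t) s
    refine this.trans ?_
    have h1 : Q * Q = Q := hQ.isIdempotentElem
    by_cases h : (A.outReg s).1 = (A.outReg t).1 ∧ (A.outReg s).2.2 = (A.outReg t).2.2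
    · rw [liftZ, if_pos h]
      conv_rhs => rw [← h1]
      refine Finset.sum_congr rfl fun z _ => congrArg _ ?_
      refine (if_pos (by simpa using h)).trans ?_
      simp
    · rw [liftZ, if_neg h]
      refine Finset.sum_eq_zero fun z _ => (congrArg _ (if_neg ?_)).trans (mul_zero _)
      simpa using h
  · ext s t
    have h2 : ∀ a b, star (Q a b) = Q b a := fun a b =>
      congrFun (congrFun (show star Q = Q from hQ.isSelfAdjoint) b) a
    simp only [Matrix.star_apply, liftZ]
    by_cases h : (A.outReg t).1 = (A.outReg s).1 ∧ (A.outReg t).2.2 = (A.outReg s).2.2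
    · rw [if_pos h, if_pos ⟨h.1.symm, h.2.symm⟩, h2]
    · rw [if_neg h, if_neg fun h' => h ⟨h'.1.symm, h'.2.symm⟩, star_zero]

/-- Restriction to the basis states with output `x`, followed by the test `Q`. -/
noncomputable def test (A : OracleAlg D Y O σ R Z E q) (x : O) (Q : Matrix Z Z ℂ) :
    (σ → ℂ) →ₗ[ℂ] (σ → ℂ) :=
  (A.outProj x).comp (Matrix.mulVecLin (A.liftZ Q))

theorem nsq_test (A : OracleAlg D Y O σ R Z E q) (x : O) (Q : Matrix Z Z ℂ) (φ : σ → ℂ) :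
    nsq (A.test x Q φ) = A.outNsq x ((A.liftZ Q).mulVec φ) := by
  simp [test, nsq_outProj]

/-- Discarding the predicate can only increase the norm. Applied to the wrong branches, it makes the
error terms independent of V. -/
theorem nsq_test_le (A : OracleAlg D Y O σ R Z E q) [Fintype Z] (x : O) {Q : Matrix Z Z ℂ}
    (hQ : IsStarProjection Q) (φ : σ → ℂ) : nsq (A.test x Q φ) ≤ A.outNsq x φ := by
  rw [← nsq_outProj]
  simp only [test, LinearMap.comp_apply, Matrix.mulVecLin_apply]
  rw [← liftZ_outProj]
  exact nsq_projection (A.isStarProjection_liftZ hQ) _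

theorem probOutput_eq [AddCommGroup Y] (A : OracleAlg D Y O σ R Z E q) (H : D → Y) (x : O)
    (Q : Matrix Z Z ℂ) : A.probOutput H x Q = nsq (A.test x Q (A.runFrom H q A.start)) := by
  rw [nsq_test, runFrom_start]
  rfl

end OracleAlg

/-! ### Premature extractions are rare -/

namespace OracleAlg

section Agree

variable {n : ℕ} {Y : Type*} [Fintype Y]

-- Coordinate m is not among the fixed ones, so it is uniform on the set of the |Y|^(n-s) tuples
-- that agree with t below s.
open Classical in
theorem sum_agree (s : ℕ) (t : Fin n → Y) (m : Fin n) (hm : s ≤ m) (p : Y → ℝ) :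
    ∑ Θ : Fin n → Y with ∀ k : Fin n, (k : ℕ) < s → Θ k = t k, p (Θ m) =
      (Fintype.card Y : ℝ) ^ (n - s) / Fintype.card Y * ∑ y, p y := by
  rw [← Finset.sum_fiberwise_of_maps_to (g := fun Θ : Fin n → Y => Θ m)
    (t := Finset.univ) (fun _ _ => Finset.mem_univ _), Finset.mul_sum]
  refine Finset.sum_congr rfl fun y _ => ?_
  have h1 : (Finset.univ.filter fun Θ : Fin n → Y => ∀ k : Fin n, (k : ℕ) < s → Θ k = t k).filter
      (fun Θ => Θ m = y) = Fintype.piFinset fun k : Fin n =>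
        if (k : ℕ) < s then {t k} else if k = m then {y} else Finset.univ := by
    ext Θ
    simp only [Finset.mem_filter, Finset.mem_univ, true_and, Fintype.mem_piFinset]
    constructor
    · rintro ⟨h, h'⟩ k
      split_ifs with h1 h2
      · simpa using h k h1
      · simpa [h2] using h'
      · simp
    · intro h
      refine ⟨fun k hk => by simpa [hk] using h k, ?_⟩
      have := h m
      rw [if_neg (by omega), if_pos rfl] at this
      simpa using this
  rw [Finset.sum_congr rfl (g := fun _ => p y) (fun Θ hΘ => by rw [(Finset.mem_filter.1 hΘ).2]),
    Finset.sum_const, h1, Fintype.card_piFinset, nsmul_eq_mul]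
  congr 1
  have h2 : ∀ k : Fin n, (if (k : ℕ) < s then {t k} else if k = m then {y} else
      (Finset.univ : Finset Y)).card = if k ∈ (idxFrom n s).erase m then Fintype.card Y else 1 := by
    intro k
    simp only [idxFrom, Finset.mem_erase, Finset.mem_filter, Finset.mem_univ, true_and]
    split_ifs <;> first | rfl | omega
  have hmem : m ∈ idxFrom n s := by simp [idxFrom, hm]
  have h3 : (Finset.univ.filter fun k => k ∈ (idxFrom n s).erase m) = (idxFrom n s).erase m := by
    ext; simp
  simp only [h2]
  rw [Finset.prod_ite, Finset.prod_const, Finset.prod_const_one, mul_one, h3,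
    Finset.card_erase_of_mem hmem, card_idxFrom]
  have hY : (Fintype.card Y : ℝ) ≠ 0 := by
    have : Nonempty Y := ⟨y⟩
    exact_mod_cast Fintype.card_ne_zero
  rw [eq_div_iff hY]
  have h4 : n - s = n - s - 1 + 1 := by have := m.2; omega
  conv_rhs => rw [h4]
  push_cast
  rw [pow_succ]

end Agree

variable {D Y O σ R Z E : Type*} [Fintype σ] [DecidableEq σ] {q : ℕ} [AddCommGroup Y]
  [DecidableEq D] [Fintype D] [Fintype O] {n : ℕ}

-- Among outputs whose points outside I are prescribed, grouping by the next extracted point makes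
-- the state and the updated function constant on each group; that point then joins the prescribed
-- ones. Summing over the groups uses `sum_nsq_proj`, and the constants obey the same recursion as
-- the Cauchy-Schwarz weights.
open Classical in
theorem sum_allV_le (A : OracleAlg D Y O σ R Z E q) (v : O → Fin n → D) (Θ : Fin n → Y)
    (κ : ℕ) (I : Finset (Fin n)) (w : Fin n → D) (H : D → Y) (φ : σ → ℂ) :
    ∑ x : O with ∀ k ∉ I, v x k = w k, A.allV (A.outNsq x) (v x) Θ κ I H φ ≤
      (2 * κ + 1) ^ I.card * nsq φ := by
  induction κ generalizing I w H φ with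
  | zero =>
    simp only [allV, CharP.cast_eq_zero, mul_zero, zero_add, one_pow, one_mul]
    rw [← A.sum_outNsq φ]
    exact Finset.sum_le_sum_of_subset_of_nonneg (Finset.filter_subset _ _)
      fun x _ _ => A.outNsq_nonneg x φ
  | succ κ ih =>
    set i := q - (κ + 1)
    simp only [allV]
    rw [Finset.sum_add_distrib, Finset.sum_comm]
    have h1 : ∀ j ∈ I, ∑ x : O with ∀ k ∉ I, v x k = w k,
        (A.allV (A.outNsq x) (v x) Θ κ (I.erase j) (Function.update H (v x j) (Θ j))
          (A.adv i (Function.update H (v x j) (Θ j)) (A.proj (v x j) φ))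
        + A.allV (A.outNsq x) (v x) Θ κ (I.erase j) (Function.update H (v x j) (Θ j))
          (A.adv i H (A.proj (v x j) φ))) ≤ 2 * (2 * κ + 1) ^ (I.card - 1) * nsq φ := by
      intro j hj
      rw [← Finset.sum_fiberwise_of_maps_to (g := fun x => v x j)
        (t := Finset.univ) (fun _ _ => Finset.mem_univ _), ← A.sum_nsq_proj φ, Finset.mul_sum]
      refine Finset.sum_le_sum fun d _ => ?_
      have h2 : (Finset.univ.filter fun x : O => ∀ k ∉ I, v x k = w k).filter (fun x => v x j = d)
          = Finset.univ.filter fun x : O => ∀ k ∉ I.erase j, v x k = Function.update w j d k := by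
        ext x
        simp only [Finset.mem_filter, Finset.mem_univ, true_and, Finset.mem_erase, not_and]
        constructor
        · rintro ⟨h, h'⟩ k hk
          by_cases hkj : k = j
          · subst hkj; simpa using h'
          · rw [Function.update_of_ne hkj]; exact h k (hk hkj)
        · intro h
          refine ⟨fun k hk => ?_, by simpa using h j fun h => absurd rfl h⟩
          have hkj : k ≠ j := fun h => hk (h ▸ hj)
          simpa [hkj] using h k fun _ => hk
      rw [Finset.sum_congr rfl (g := fun x =>
        A.allV (A.outNsq x) (v x) Θ κ (I.erase j) (Function.update H d (Θ j))
          (A.adv i (Function.update H d (Θ j)) (A.proj d φ))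
        + A.allV (A.outNsq x) (v x) Θ κ (I.erase j) (Function.update H d (Θ j))
          (A.adv i H (A.proj d φ))) (fun x hx => by rw [(Finset.mem_filter.1 hx).2]), h2,
        Finset.sum_add_distrib, mul_assoc, two_mul]
      rw [← Finset.card_erase_of_mem hj]
      exact add_le_add
        ((ih _ _ _ _).trans (mul_le_mul_of_nonneg_left (A.nsq_adv_le ..) (by positivity)))
        ((ih _ _ _ _).trans (mul_le_mul_of_nonneg_left (A.nsq_adv_le ..) (by positivity)))
    have h0 := (ih I w H (A.adv i H φ)).trans
      (mul_le_mul_of_nonneg_left (A.nsq_adv_le i H φ) (by positivity))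
    refine (add_le_add h0 (Finset.sum_le_sum h1)).trans ?_
    rw [Finset.sum_const, nsmul_eq_mul]
    have := mul_le_mul_of_nonneg_right
      (pow_add_le_add_two_pow (a := 2 * κ + 1) (by positivity) I.card) (nsq_nonneg φ)
    push_cast
    refine le_trans (le_of_eq ?_) (this.trans (le_of_eq ?_)) <;> ring

variable [Fintype Y]

/-- If every point but the first one contains the preceding answer, then too early extractions are
unlikely. -/
theorem sum_wrongV_le (A : OracleAlg D Y O σ R Z E q) {L : Type*} (lab : D → L) {e : Y → L}
    (he : Function.Injective e) (v : O → (Fin n → Y) → Fin n → D)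
    (hv : ∀ x Θ (j k : Fin n), (k : ℕ) + 1 = j → lab (v x Θ j) = e (Θ k))
    (κ s : ℕ) (w : Fin n → D) (t : Fin n → Y) (H : D → Y) (φ : σ → ℂ) :
    open Classical in
    ∑ ω : O × (Fin n → Y) with ∀ k : Fin n, (k : ℕ) < s → v ω.1 ω.2 k = w k ∧ ω.2 k = t k,
      A.wrongV (A.outNsq ω.1) (v ω.1 ω.2) ω.2 κ s H φ ≤
      (2 * κ + 1) ^ (n - s) * ((Fintype.card Y : ℝ) ^ (n - s) / Fintype.card Y) * nsq φ := by
  classical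
  have hcY : (0 : ℝ) < Fintype.card Y := by exact_mod_cast Fintype.card_pos
  induction κ generalizing s w t H φ with
  | zero =>
    simp only [wrongV, Finset.sum_const_zero]
    exact mul_nonneg (by positivity) (nsq_nonneg φ)
  | succ κ ih =>
    set i := q - (κ + 1)
    simp only [wrongV]
    rw [Finset.sum_add_distrib, Finset.sum_add_distrib]
    have h0 := (ih s w t H (A.adv i H φ)).trans
      (mul_le_mul_of_nonneg_left (A.nsq_adv_le i H φ) (by positivity))
    by_cases hs : s < n
    swap
    · simp only [dif_neg hs, idxFrom_eq_empty (show n ≤ s + 1 by omega), Finset.sum_empty,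
        Finset.sum_const_zero, add_zero]
      simpa [show n - s = 0 by omega] using h0
    simp only [dif_pos hs]
    set c : ℝ := (2 * κ + 1) ^ (n - s - 1) * ((Fintype.card Y : ℝ) ^ (n - s) / Fintype.card Y)
      with hc
    have h1 : ∑ ω : O × (Fin n → Y) with ∀ k : Fin n, (k : ℕ) < s →
          v ω.1 ω.2 k = w k ∧ ω.2 k = t k,
        (A.wrongV (A.outNsq ω.1) (v ω.1 ω.2) ω.2 κ (s + 1)
          (Function.update H (v ω.1 ω.2 ⟨s, hs⟩) (ω.2 ⟨s, hs⟩))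
          (A.adv i (Function.update H (v ω.1 ω.2 ⟨s, hs⟩) (ω.2 ⟨s, hs⟩))
            (A.proj (v ω.1 ω.2 ⟨s, hs⟩) φ))
        + A.wrongV (A.outNsq ω.1) (v ω.1 ω.2) ω.2 κ (s + 1)
          (Function.update H (v ω.1 ω.2 ⟨s, hs⟩) (ω.2 ⟨s, hs⟩))
          (A.adv i H (A.proj (v ω.1 ω.2 ⟨s, hs⟩) φ))) ≤ 2 * c * nsq φ := by
      -- After a right extraction both the point and its answer are known, so the sum is grouped by
      -- the pair.
      rw [← Finset.sum_fiberwise_of_maps_to (g := fun ω => (v ω.1 ω.2 ⟨s, hs⟩, ω.2 ⟨s, hs⟩))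
        (t := Finset.univ) (fun _ _ => Finset.mem_univ _), Fintype.sum_prod_type]
      have h2 : ∀ d : D, ∀ y : Y, (Finset.univ.filter fun ω : O × (Fin n → Y) => ∀ k : Fin n,
          (k : ℕ) < s → v ω.1 ω.2 k = w k ∧ ω.2 k = t k).filter
            (fun ω => (v ω.1 ω.2 ⟨s, hs⟩, ω.2 ⟨s, hs⟩) = (d, y))
          = Finset.univ.filter fun ω : O × (Fin n → Y) => ∀ k : Fin n, (k : ℕ) < s + 1 →
            v ω.1 ω.2 k = Function.update w ⟨s, hs⟩ d k ∧
              ω.2 k = Function.update t ⟨s, hs⟩ y k := by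
        intro d y
        ext ω
        simp only [Finset.mem_filter, Finset.mem_univ, true_and, Prod.mk.injEq]
        constructor
        · rintro ⟨h, h'⟩ k hk
          by_cases hkj : k = ⟨s, hs⟩
          · subst hkj; simpa using h'
          · rw [Function.update_of_ne hkj, Function.update_of_ne hkj]
            have : (k : ℕ) ≠ s := fun h => hkj (Fin.ext h)
            exact h k (by omega)
        · intro h
          refine ⟨fun k hk => ?_, by simpa using h ⟨s, hs⟩ (by simp)⟩
          have hkj : k ≠ ⟨s, hs⟩ := fun h => by simp [h] at hk
          simpa [hkj] using h k (by omega)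
      have h3 : ∀ d : D, ∀ y : Y, ∑ ω ∈ (Finset.univ.filter fun ω : O × (Fin n → Y) =>
          ∀ k : Fin n, (k : ℕ) < s → v ω.1 ω.2 k = w k ∧ ω.2 k = t k).filter
            (fun ω => (v ω.1 ω.2 ⟨s, hs⟩, ω.2 ⟨s, hs⟩) = (d, y)),
        (A.wrongV (A.outNsq ω.1) (v ω.1 ω.2) ω.2 κ (s + 1)
          (Function.update H (v ω.1 ω.2 ⟨s, hs⟩) (ω.2 ⟨s, hs⟩))
          (A.adv i (Function.update H (v ω.1 ω.2 ⟨s, hs⟩) (ω.2 ⟨s, hs⟩))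
            (A.proj (v ω.1 ω.2 ⟨s, hs⟩) φ))
        + A.wrongV (A.outNsq ω.1) (v ω.1 ω.2) ω.2 κ (s + 1)
          (Function.update H (v ω.1 ω.2 ⟨s, hs⟩) (ω.2 ⟨s, hs⟩))
          (A.adv i H (A.proj (v ω.1 ω.2 ⟨s, hs⟩) φ))) ≤
          2 * (c / Fintype.card Y) * nsq (A.proj d φ) := by
        intro d y
        rw [Finset.sum_congr rfl (g := fun ω : O × (Fin n → Y) =>
          A.wrongV (A.outNsq ω.1) (v ω.1 ω.2) ω.2 κ (s + 1) (Function.update H d y)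
            (A.adv i (Function.update H d y) (A.proj d φ))
          + A.wrongV (A.outNsq ω.1) (v ω.1 ω.2) ω.2 κ (s + 1) (Function.update H d y)
            (A.adv i H (A.proj d φ))) (fun ω hω => by
              obtain ⟨h, h'⟩ := Prod.mk.inj (Finset.mem_filter.1 hω).2
              rw [h, h']), h2, Finset.sum_add_distrib]
        -- One answer fewer is free at level s + 1; the sum over the |Y| values of that answer
        -- restores the missing factor.
        have hcc : c / Fintype.card Y = (2 * κ + 1) ^ (n - (s + 1)) *
            ((Fintype.card Y : ℝ) ^ (n - (s + 1)) / Fintype.card Y) := by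
          have : n - s = n - (s + 1) + 1 := by omega
          rw [hc, this, Nat.add_sub_cancel, pow_succ]
          field_simp
        rw [mul_assoc, two_mul, hcc]
        exact add_le_add
          ((ih _ _ _ _ _).trans (mul_le_mul_of_nonneg_left (A.nsq_adv_le ..) (by positivity)))
          ((ih _ _ _ _ _).trans (mul_le_mul_of_nonneg_left (A.nsq_adv_le ..) (by positivity)))
      refine (Finset.sum_le_sum fun d _ => Finset.sum_le_sum fun y _ => h3 d y).trans
        (le_of_eq ?_)
      simp only [Finset.sum_const, Finset.card_univ, nsmul_eq_mul]
      rw [← Finset.mul_sum, ← Finset.mul_sum, A.sum_nsq_proj]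
      field_simp
    have h4 : ∀ j ∈ idxFrom n (s + 1), ∑ ω : O × (Fin n → Y) with ∀ k : Fin n, (k : ℕ) < s →
          v ω.1 ω.2 k = w k ∧ ω.2 k = t k,
        (A.allV (A.outNsq ω.1) (v ω.1 ω.2) ω.2 κ ((idxFrom n s).erase j)
          (Function.update H (v ω.1 ω.2 j) (ω.2 j))
          (A.adv i (Function.update H (v ω.1 ω.2 j) (ω.2 j)) (A.proj (v ω.1 ω.2 j) φ))
        + A.allV (A.outNsq ω.1) (v ω.1 ω.2) ω.2 κ ((idxFrom n s).erase j)
          (Function.update H (v ω.1 ω.2 j) (ω.2 j))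
          (A.adv i H (A.proj (v ω.1 ω.2 j) φ))) ≤ 2 * c * nsq φ := by
      intro j hj
      have hsj : s + 1 ≤ j := by simpa [idxFrom] using hj
      have hjI : j ∈ idxFrom n s := by simp [idxFrom]; omega
      have hcI : ((idxFrom n s).erase j).card = n - s - 1 := by
        rw [Finset.card_erase_of_mem hjI, card_idxFrom]
      -- The predecessor m of j satisfies m ≥ s: its answer is still free, although the extracted
      -- input has to contain it.
      obtain ⟨m, hm⟩ : ∃ m : Fin n, (m : ℕ) + 1 = j := ⟨⟨j - 1, by omega⟩, by simp; omega⟩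
      -- The bound for a given value y of answer m: only query inputs that carry y contribute.
      set p : Y → ℝ := fun y => ∑ d, if lab d = e y then
        2 * (2 * κ + 1) ^ (n - s - 1) * nsq (A.proj d φ) else 0 with hp
      have h5 : ∀ Θ : Fin n → Y, ∑ x : O with ∀ k : Fin n, (k : ℕ) < s → v x Θ k = w k,
          (A.allV (A.outNsq x) (v x Θ) Θ κ ((idxFrom n s).erase j)
            (Function.update H (v x Θ j) (Θ j))
            (A.adv i (Function.update H (v x Θ j) (Θ j)) (A.proj (v x Θ j) φ))
          + A.allV (A.outNsq x) (v x Θ) Θ κ ((idxFrom n s).erase j)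
            (Function.update H (v x Θ j) (Θ j))
            (A.adv i H (A.proj (v x Θ j) φ))) ≤ p (Θ m) := by
        intro Θ
        rw [← Finset.sum_fiberwise_of_maps_to (g := fun x => v x Θ j)
          (t := Finset.univ) (fun _ _ => Finset.mem_univ _)]
        refine Finset.sum_le_sum fun d _ => ?_
        have h2 : (Finset.univ.filter fun x : O => ∀ k : Fin n, (k : ℕ) < s → v x Θ k = w k).filter
            (fun x => v x Θ j = d) = Finset.univ.filter fun x : O =>
              ∀ k ∉ (idxFrom n s).erase j, v x Θ k = Function.update w j d k := by
          ext x
          simp only [idxFrom, Finset.mem_filter, Finset.mem_univ, true_and, Finset.mem_erase,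
            not_and, not_le]
          constructor
          · rintro ⟨h, h'⟩ k hk
            by_cases hkj : k = j
            · subst hkj; simpa using h'
            · rw [Function.update_of_ne hkj]; exact h k (hk hkj)
          · intro h
            refine ⟨fun k hk => ?_, by simpa using h j fun h => absurd rfl h⟩
            have hkj : k ≠ j := fun h => by rw [h] at hk; omega
            simpa [hkj] using h k fun _ => hk
        split_ifs with hd
        · rw [Finset.sum_congr rfl (g := fun x =>
            A.allV (A.outNsq x) (v x Θ) Θ κ ((idxFrom n s).erase j) (Function.update H d (Θ j))
              (A.adv i (Function.update H d (Θ j)) (A.proj d φ))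
            + A.allV (A.outNsq x) (v x Θ) Θ κ ((idxFrom n s).erase j) (Function.update H d (Θ j))
              (A.adv i H (A.proj d φ))) (fun x hx => by rw [(Finset.mem_filter.1 hx).2]), h2,
            Finset.sum_add_distrib, mul_assoc, two_mul, ← hcI]
          exact add_le_add
            ((A.sum_allV_le (fun x => v x Θ) Θ κ _ _ _ _).trans
              (mul_le_mul_of_nonneg_left (A.nsq_adv_le ..) (by positivity)))
            ((A.sum_allV_le (fun x => v x Θ) Θ κ _ _ _ _).trans
              (mul_le_mul_of_nonneg_left (A.nsq_adv_le ..) (by positivity)))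
        · rw [Finset.filter_eq_empty_iff.2, Finset.sum_empty]
          intro x _ hx
          apply hd
          rw [← hx, hv x Θ j m hm]
      -- Since e is injective, every query input carries at most one y and is counted at most once.
      -- This is where the factor |Y| is saved.
      have h6 : ∑ y, p y ≤ 2 * (2 * κ + 1) ^ (n - s - 1) * nsq φ := by
        rw [← A.sum_nsq_proj φ, Finset.mul_sum, hp, Finset.sum_comm]
        refine Finset.sum_le_sum fun d _ => ?_
        have hnn : 0 ≤ 2 * (2 * (κ : ℝ) + 1) ^ (n - s - 1) * nsq (A.proj d φ) :=
          mul_nonneg (by positivity) (nsq_nonneg _)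
        by_cases hd : ∃ y, lab d = e y
        · obtain ⟨y, hy⟩ := hd
          rw [Finset.sum_eq_single y]
          · rw [if_pos hy]
          · intro y' _ hy'
            exact if_neg fun h => hy' (he (h.symm.trans hy))
          · simp
        · push Not at hd
          rw [Finset.sum_eq_zero fun y _ => if_neg (hd y)]
          exact hnn
      rw [Finset.sum_filter, Fintype.sum_prod_type_right]
      calc _ ≤ ∑ Θ : Fin n → Y, (if ∀ k : Fin n, (k : ℕ) < s → Θ k = t k then p (Θ m) else 0) := by
            refine Finset.sum_le_sum fun Θ _ => ?_
            split_ifs with hΘ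
            · refine le_trans (le_of_eq ?_) (h5 Θ)
              rw [Finset.sum_filter]
              refine Finset.sum_congr rfl fun x _ => ?_
              refine if_congr ?_ rfl rfl
              exact ⟨fun h k hk => (h k hk).1, fun h k hk => ⟨h k hk, hΘ k hk⟩⟩
            · refine le_of_eq (Finset.sum_eq_zero fun x _ => if_neg ?_)
              exact fun h => hΘ fun k hk => (h k hk).2
        _ = (Fintype.card Y : ℝ) ^ (n - s) / Fintype.card Y * ∑ y, p y := by
            rw [← Finset.sum_filter]
            exact sum_agree s t m (by omega) p
        _ ≤ (Fintype.card Y : ℝ) ^ (n - s) / Fintype.card Y *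
            (2 * (2 * κ + 1) ^ (n - s - 1) * nsq φ) := by gcongr
        _ = _ := by rw [hc]; ring
    rw [Finset.sum_comm]
    refine (add_le_add (add_le_add h0 h1) (Finset.sum_le_sum h4)).trans ?_
    rw [Finset.sum_const, nsmul_eq_mul, card_idxFrom]
    -- One right index and n - s - 1 wrong ones, each contributing 2c, complete the usual recursion
    -- with r = n - s.
    have h7 := pow_add_le_add_two_pow (a := 2 * κ + 1) (by positivity) (n - s)
    have h8 : ((n - (s + 1) : ℕ) : ℝ) = ((n - s : ℕ) : ℝ) - 1 := by
      rw [show n - s = n - (s + 1) + 1 by omega]; push_cast; ring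
    have h9 : 0 ≤ (Fintype.card Y : ℝ) ^ (n - s) / Fintype.card Y * nsq φ :=
      mul_nonneg (by positivity) (nsq_nonneg φ)
    have := mul_le_mul_of_nonneg_right h7 h9
    rw [h8, hc]
    push_cast
    refine le_trans (le_of_eq ?_) (this.trans (le_of_eq ?_)) <;> ring

end OracleAlg

/-! ### Polynomial hash functions and juntas -/

section Junta

variable {D B : Type*}

/-- The span of the functions of `f : D → B` that depend on at most `d` values of `f`. -/
def degSpan (D B : Type*) (d : ℕ) : Submodule ℂ ((D → B) → ℂ) :=
  Submodule.span ℂ {g | ∃ F : Finset D, F.card ≤ d ∧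
    ∀ f f' : D → B, (∀ v ∈ F, f v = f' v) → g f = g f'}

theorem const_mem_degSpan (d : ℕ) (z : ℂ) : (fun _ => z) ∈ degSpan D B d :=
  Submodule.subset_span ⟨∅, by simp, fun _ _ _ => rfl⟩

/-- A product of two juntas depends on the union of the two sets of inputs, so degrees add as for
polynomials. -/
theorem mul_mem_degSpan {d d' : ℕ} {g g' : (D → B) → ℂ} (h : g ∈ degSpan D B d)
    (h' : g' ∈ degSpan D B d') : (fun f => g f * g' f) ∈ degSpan D B (d + d') := by
  classical
  have h1 : (fun f => g f * g' f) = g * g' := rfl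
  rw [h1]
  have h2 := Submodule.mul_mem_mul h h'
  rw [degSpan, degSpan, Submodule.span_mul_span] at h2
  refine Submodule.span_mono ?_ h2
  rintro _ ⟨a, ⟨F, hF, ha⟩, b, ⟨F', hF', hb⟩, rfl⟩
  refine ⟨F ∪ F', (Finset.card_union_le _ _).trans (add_le_add hF hF'), fun f f' hff => ?_⟩
  simp only [Pi.mul_apply]
  rw [ha f f' fun v hv => hff v (Finset.mem_union_left _ hv),
    hb f f' fun v hv => hff v (Finset.mem_union_right _ hv)]

theorem star_mem_degSpan {d : ℕ} {g : (D → B) → ℂ} (h : g ∈ degSpan D B d) :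
    (fun f => star (g f)) ∈ degSpan D B d := by
  induction h using Submodule.span_induction with
  | mem g hg =>
    obtain ⟨F, hF, hg⟩ := hg
    exact Submodule.subset_span ⟨F, hF, fun f f' h => congrArg star (hg f f' h)⟩
  | zero => simpa using const_mem_degSpan d 0
  | add a b _ _ ha hb =>
    have := Submodule.add_mem _ ha hb
    convert this using 1
    ext f; simp
  | smul z a _ ha =>
    have := Submodule.smul_mem _ (star z) ha
    convert this using 1
    ext f; simp

theorem sum_mem_degSpan {ι : Type*} {d : ℕ} (I : Finset ι) {g : ι → (D → B) → ℂ}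
    (h : ∀ i ∈ I, g i ∈ degSpan D B d) : (fun f => ∑ i ∈ I, g i f) ∈ degSpan D B d := by
  have h1 : (fun f => ∑ i ∈ I, g i f) = ∑ i ∈ I, g i := by ext f; simp
  rw [h1]
  exact Submodule.sum_mem _ h

theorem linearMap_mem_degSpan {σ : Type*} [Fintype σ] {d : ℕ}
    (L : (σ → ℂ) →ₗ[ℂ] (σ → ℂ)) {φ : (D → B) → σ → ℂ}
    (h : ∀ s, (fun f => φ f s) ∈ degSpan D B d) (s : σ) :
    (fun f => L (φ f) s) ∈ degSpan D B d := by
  classical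
  have h1 : ∀ f, L (φ f) s = ∑ t, L (Pi.single t 1) s * φ f t := by
    intro f
    rw [LinearMap.pi_apply_eq_sum_univ L, Finset.sum_apply]
    refine Finset.sum_congr rfl fun t _ => ?_
    rw [Pi.smul_apply, smul_eq_mul, mul_comm]
    have h2 : (Pi.single t 1 : σ → ℂ) = fun j => if t = j then 1 else 0 := by
      ext u
      simp [Pi.single_apply, eq_comm]
    rw [h2]
  simp only [h1]
  exact sum_mem_degSpan _ fun t _ => Submodule.smul_mem _ _ (h t)

theorem nsq_mem_degSpan {σ : Type*} [Fintype σ] {d : ℕ} {φ : (D → B) → σ → ℂ}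
    (h : ∀ s, (fun f => φ f s) ∈ degSpan D B d) :
    (fun f => (nsq (φ f) : ℂ)) ∈ degSpan D B (d + d) := by
  simp only [nsq_eq_re, dotProduct, Pi.star_apply]
  exact sum_mem_degSpan _ fun s _ => mul_mem_degSpan (star_mem_degSpan (h s)) (h s)

end Junta

/-! ### The degree of the branch values in the oracle -/

namespace OracleAlg

variable {D B Y O σ R Z E : Type*} [Fintype σ] [DecidableEq σ] {q : ℕ} [AddCommGroup Y]

/-- The amplitude at s after a query is the old amplitude at a basis state selected by one oracle
value. Written as a sum of indicators times amplitudes, this raises the degree by one; the fixed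
linear operation that follows does not raise it. -/
theorem adv_mem_degSpan (A : OracleAlg D Y O σ R Z E q) (i : ℕ) {d : ℕ} {φ : (D → B) → σ → ℂ}
    (h : ∀ s, (fun f => φ f s) ∈ degSpan D B d) {H : (D → B) → D → Y}
    (hH : ∀ v f f', f v = f' v → H f v = H f' v) (s : σ) :
    (fun f => A.adv i (H f) (φ f) s) ∈ degSpan D B (d + 1) := by
  simp only [adv, LinearMap.comp_apply]
  refine linearMap_mem_degSpan (Matrix.mulVecLin (A.opAt i)) (fun s => ?_) s
  have h1 : ∀ f, Matrix.mulVecLin (A.query (H f)) (φ f) s =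
      ∑ t, (if t = (A.queryPerm (H f)).symm s then 1 else 0) * φ f t := by
    intro f
    rw [Matrix.mulVecLin_apply, query_mulVec]
    simp
  simp only [h1]
  rw [add_comm]
  refine sum_mem_degSpan _ fun t _ => mul_mem_degSpan ?_ (h t)
  refine Submodule.subset_span ⟨{(A.queryReg s).2.1}, by simp, fun f f' hf => ?_⟩
  beta_reduce
  rw [A.queryPerm_symm_congr (hH _ f f' (hf _ (Finset.mem_singleton_self _)))]

/-- Projections onto fixed points and updates by fixed answers do not increase the degree, so only
the queries count; squaring the amplitudes doubles it. Starting from a constant state, q queries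
give 2q, which is the number of coefficients the simulator needs. -/
theorem rightV_mem_degSpan [DecidableEq D] {n : ℕ} (A : OracleAlg D Y O σ R Z E q) (L : (σ → ℂ) →ₗ[ℂ] (σ → ℂ))
    (v : Fin n → D) (Θ : Fin n → Y) (κ s d : ℕ) {φ : (D → B) → σ → ℂ}
    (h : ∀ s, (fun f => φ f s) ∈ degSpan D B d) {H : (D → B) → D → Y}
    (hH : ∀ v f f', f v = f' v → H f v = H f' v) :
    (fun f => (A.rightV (fun φ => nsq (L φ)) v Θ κ s (H f) (φ f) : ℂ)) ∈
      degSpan D B (2 * (d + κ)) := by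
  induction κ generalizing s d φ H with
  | zero =>
    have := nsq_mem_degSpan (linearMap_mem_degSpan L h)
    rwa [← two_mul] at this
  | succ κ ih =>
    simp only [rightV]
    rw [show d + (κ + 1) = d + 1 + κ by ring]
    by_cases hs : s < n
    · simp only [dif_pos hs, Complex.ofReal_add]
      have hH' : ∀ u f f', f u = f' u → Function.update (H f) (v ⟨s, hs⟩) (Θ ⟨s, hs⟩) u =
          Function.update (H f') (v ⟨s, hs⟩) (Θ ⟨s, hs⟩) u := by
        intro u f f' hu
        by_cases hus : u = v ⟨s, hs⟩
        · simp [hus]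
        · simp only [Function.update_of_ne hus]; exact hH u f f' hu
      have hp := linearMap_mem_degSpan (A.proj (v ⟨s, hs⟩)) h
      exact Submodule.add_mem _ (ih _ _ (A.adv_mem_degSpan _ h hH) hH)
        (Submodule.add_mem _ (ih _ _ (A.adv_mem_degSpan _ hp hH') hH')
          (ih _ _ (A.adv_mem_degSpan _ hp hH) hH'))
    · simp only [dif_neg hs, add_zero]
      exact ih _ _ (A.adv_mem_degSpan _ h hH) hH

end OracleAlg

/-! ### Limited independence of polynomial hashing -/

section Uniform

/-- All fibres of a surjective homomorphism have the size of the kernel, so it maps the uniform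
distribution to the uniform one. -/
theorem sum_comp_surjective {G K : Type*} [AddGroup G] [AddGroup K] [Fintype G] [Fintype K]
    (h : G →+ K) (hh : Function.Surjective h) (g : K → ℂ) :
    (Fintype.card K : ℂ) * ∑ x, g (h x) = Fintype.card G * ∑ y, g y := by
  classical
  have h1 : ∀ y, (Finset.univ.filter fun x => h x = y).card =
      (Finset.univ.filter fun x => h x = 0).card := fun y =>
    AddMonoidHom.card_fiber_eq_of_mem_range h (hh y) (hh 0)
  have h2 : ∑ x, g (h x) = (Finset.univ.filter fun x => h x = 0).card * ∑ y, g y := by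
    rw [← Finset.sum_fiberwise_of_maps_to (g := fun x => h x)
      (t := Finset.univ) (fun _ _ => Finset.mem_univ _), Finset.mul_sum]
    refine Finset.sum_congr rfl fun y _ => ?_
    rw [Finset.sum_congr rfl (g := fun _ => g y) (fun x hx => by rw [(Finset.mem_filter.1 hx).2]),
      Finset.sum_const, h1, nsmul_eq_mul]
  have h3 : Fintype.card G = Fintype.card K * (Finset.univ.filter fun x => h x = 0).card := by
    rw [← Finset.card_univ, Finset.card_eq_sum_card_fiberwise (f := fun x => h x)
      (t := Finset.univ) (fun _ _ => Finset.mem_univ _), Finset.sum_congr rfl fun y _ => h1 y]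
    simp
  rw [h2, h3]
  push_cast
  ring

variable {D : Type*} {Q : ℕ}

/-- The polynomial hash function with coefficients `c`. -/
def polyHash {t : ℕ} (num : D → ZMod Q) : (Fin t → ZMod Q) →+ (D → ZMod Q) where
  toFun c v := ∑ j : Fin t, c j * num v ^ (t - 1 - j)
  map_zero' := by ext v; simp
  map_add' c c' := by ext v; simp [add_mul, Finset.sum_add_distrib]

/-- Newton interpolation. The modulus is a prime power, so `ZMod Q` need not be a field; unit
differences are all that is needed. -/
theorem exists_interpolation {num : D → ZMod Q}
    (hnum : ∀ v w, v ≠ w → IsUnit (num v - num w)) (F : Finset D) (y : D → ZMod Q) :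
    ∃ p : Polynomial (ZMod Q), p.degree < F.card ∧ ∀ v ∈ F, p.eval (num v) = y v := by
  classical
  induction F using Finset.induction_on with
  | empty => exact ⟨0, by simp, by simp⟩
  | insert a F ha ih =>
    obtain ⟨p, hp, hpy⟩ := ih
    have hu : IsUnit (∏ w ∈ F, (num a - num w)) :=
      IsUnit.prod_iff.2 fun w hw => hnum a w fun h => ha (h ▸ hw)
    obtain ⟨u, hu⟩ := hu
    set P : Polynomial (ZMod Q) := ∏ w ∈ F, (Polynomial.X - Polynomial.C (num w))
    have hP : P.degree ≤ F.card := by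
      refine (Polynomial.degree_prod_le _ _).trans ?_
      refine (Finset.sum_le_sum fun w _ => Polynomial.degree_X_sub_C_le _).trans ?_
      simp
    -- The added multiple of P vanishes at the old nodes and corrects the value at the new one.
    refine ⟨p + Polynomial.C ((y a - p.eval (num a)) * ↑u⁻¹) * P, ?_, ?_⟩
    · rw [Finset.card_insert_of_notMem ha]
      refine lt_of_le_of_lt (Polynomial.degree_add_le _ _) (max_lt ?_ ?_)
      · exact hp.trans (by exact_mod_cast Nat.lt_succ_self _)
      · refine lt_of_le_of_lt (Polynomial.degree_mul_le_of_le (a := 0) Polynomial.degree_C_le hP) ?_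
        exact_mod_cast (by omega : 0 + F.card < F.card + 1)
    · intro v hv
      have hPe : ∀ v, P.eval (num v) = ∏ w ∈ F, (num v - num w) := fun v => by
        simp [P, Polynomial.eval_prod]
      rw [Polynomial.eval_add, Polynomial.eval_mul, Polynomial.eval_C, hPe]
      rcases Finset.mem_insert.1 hv with rfl | hv
      · rw [← hu, mul_assoc, Units.inv_mul]; ring
      · rw [Finset.prod_eq_zero hv (sub_self _), mul_zero, add_zero, hpy v hv]

/-- By linearity one junta suffices. Interpolation makes the map from coefficients to values on its
at most t inputs surjective; since that map is additive, these values are exactly uniform. -/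
theorem sum_polyHash [NeZero Q] [Fintype D] [DecidableEq D] {t : ℕ} {num : D → ZMod Q}
    (hnum : ∀ v w, v ≠ w → IsUnit (num v - num w)) {g : (D → ZMod Q) → ℂ}
    (hg : g ∈ degSpan D (ZMod Q) t) :
    (Q : ℂ) ^ Fintype.card D * ∑ c : Fin t → ZMod Q, g (polyHash num c) =
      (Q : ℂ) ^ t * ∑ f, g f := by
  have hQ : (Q : ℂ) ≠ 0 := by exact_mod_cast NeZero.ne Q
  induction hg using Submodule.span_induction with
  | zero => simp
  | add a b _ _ ha hb =>
    simp only [Pi.add_apply, Finset.sum_add_distrib, mul_add, ha, hb]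
  | smul z a _ ha =>
    simp only [Pi.smul_apply, smul_eq_mul, ← Finset.mul_sum]
    linear_combination z * ha
  | mem g hg =>
    obtain ⟨F, hF, hg⟩ := hg
    let ρ : (D → ZMod Q) →+ (F → ZMod Q) :=
      { toFun := fun f v => f v, map_zero' := rfl, map_add' := fun _ _ => rfl }
    let ext : (F → ZMod Q) → (D → ZMod Q) := fun f v => if h : v ∈ F then f ⟨v, h⟩ else 0
    have hext : ∀ f, ρ (ext f) = f := fun f => by ext v; simp [ρ, ext]
    have hgρ : ∀ f, g f = g (ext (ρ f)) := fun f => hg _ _ fun v hv => by simp [ext, ρ, hv]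
    have hρ : Function.Surjective ρ := fun f => ⟨ext f, hext f⟩
    have hρp : Function.Surjective (ρ.comp (polyHash (t := t) num)) := by
      intro f
      obtain ⟨p, hp, hpy⟩ := exists_interpolation hnum F (ext f)
      -- Coefficients are stored from the leading one down, as Horner's scheme consumes them.
      refine ⟨fun j => p.coeff (t - 1 - j), ?_⟩
      ext v
      have h1 := hpy v v.2
      rw [Polynomial.eval_eq_sum_range' (n := t)] at h1
      · refine Eq.trans ?_ (h1.trans (by simp [ext]))
        rw [Finset.sum_range]
        refine Fintype.sum_equiv Fin.revPerm _ _ fun j => ?_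
        simp only [Fin.revPerm_apply, Fin.val_rev]
        rw [show t - (j + 1 : ℕ) = t - 1 - j by omega]
      · have hF0 : 0 < F.card := Finset.card_pos.2 ⟨v, v.2⟩
        by_cases hp0 : p = 0
        · simp [hp0]; omega
        · exact (Polynomial.natDegree_lt_iff_degree_lt hp0).2
            (hp.trans_le (by exact_mod_cast hF))
    have e1 := sum_comp_surjective ρ hρ fun f => g (ext f)
    have e2 := sum_comp_surjective _ hρp fun f => g (ext f)
    simp only [AddMonoidHom.comp_apply, ← hgρ] at e1 e2
    simp only [Fintype.card_fun, ZMod.card, Fintype.card_fin, Fintype.card_coe,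
      Nat.cast_pow] at e1 e2
    have hF0 : (Q : ℂ) ^ F.card ≠ 0 := pow_ne_zero _ hQ
    apply mul_left_cancel₀ hF0
    linear_combination (Q : ℂ) ^ Fintype.card D * e2 - (Q : ℂ) ^ t * e1

/-- Each value in Y is hit by at least ⌊Q/M⌋ residues. Because Φ is nonnegative, the surplus
residues can be dropped; a one-sided estimate is enough. -/
theorem card_mul_sum_le_sum_mod [NeZero Q] [Fintype D] [DecidableEq D] {Y : Type*} [Fintype Y]
    {M : ℕ} (hM : 0 < M)
    {num : Y → ℕ} (hnum : ∀ y, num y < M) {toY : ℕ → Y} (hto : ∀ y, toY (num y) = y)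
    {Φ : (D → Y) → ℝ} (hΦ : ∀ H, 0 ≤ Φ H) :
    ((Q / M : ℕ) : ℝ) ^ Fintype.card D * ∑ H, Φ H ≤
      ∑ f : D → ZMod Q, Φ fun v => toY ((f v).val % M) := by
  -- The residue with quotient `p.1 v` and remainder `num (p.2 v)` on division by M.
  let j : (D → Fin (Q / M)) × (D → Y) → (D → ZMod Q) := fun p v =>
    (((p.1 v : ℕ) * M + num (p.2 v) : ℕ) : ZMod Q)
  have hval : ∀ p v, (j p v).val = (p.1 v : ℕ) * M + num (p.2 v) := by
    intro p v
    refine ZMod.val_cast_of_lt ?_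
    have h1 : ((p.1 v : ℕ) + 1) * M ≤ Q / M * M := Nat.mul_le_mul_right _ (p.1 v).2
    have h2 := Nat.div_mul_le_self Q M
    have h3 := hnum (p.2 v)
    nlinarith
  have hmod : ∀ p v, toY ((j p v).val % M) = p.2 v := by
    intro p v
    rw [hval, mul_comm, Nat.mul_add_mod, Nat.mod_eq_of_lt (hnum _), hto]
  have hdiv : ∀ p v, (j p v).val / M = p.1 v := by
    intro p v
    rw [hval, mul_comm, Nat.mul_add_div hM, Nat.div_eq_of_lt (hnum _), add_zero]
  have hj : Function.Injective j := by
    intro p p' h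
    ext1
    · ext v; rw [← hdiv, ← hdiv, h]
    · ext v; rw [← hmod, ← hmod p', h]
  calc _ = ∑ p : (D → Fin (Q / M)) × (D → Y), Φ fun v => toY ((j p v).val % M) := by
        rw [Fintype.sum_prod_type]
        simp only [hmod]
        simp
    _ = ∑ f ∈ Finset.univ.map ⟨j, hj⟩, Φ fun v => toY ((f v).val % M) := by
        rw [Finset.sum_map]; rfl
    _ ≤ _ := Finset.sum_le_sum_of_subset_of_nonneg (Finset.subset_univ _) fun _ _ _ => hΦ _

/-- Bernoulli's inequality for the d hash inputs: rounding Q down to a multiple of M loses at most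
the fraction M/Q at each input. -/
theorem one_sub_le_pow {M d N : ℕ} (hM : 0 < M) (hN : 0 < N) (hQ : d * M * N ≤ Q) (hQ0 : 0 < Q) :
    (1 - 1 / (N : ℝ)) * (Q : ℝ) ^ d ≤ (((Q / M : ℕ) : ℝ) * M) ^ d := by
  have hQ' : (0 : ℝ) < Q := by exact_mod_cast hQ0
  have hN' : (0 : ℝ) < N := by exact_mod_cast hN
  have h1 : (Q : ℝ) - M ≤ ((Q / M : ℕ) : ℝ) * M := by
    have : Q ≤ Q / M * M + M := by
      have := Nat.div_add_mod' Q M; have := Nat.mod_lt Q hM; omega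
    have : (Q : ℝ) ≤ ((Q / M : ℕ) : ℝ) * M + M := by exact_mod_cast this
    linarith
  rcases Nat.eq_zero_or_pos d with rfl | hd
  · simp
  have hQ2 : (d : ℝ) * M * N ≤ Q := by exact_mod_cast hQ
  have hMQ : (M : ℝ) ≤ Q := by
    have : M ≤ Q := by nlinarith [Nat.mul_le_mul (Nat.mul_le_mul hd (le_refl M)) hN]
    exact_mod_cast this
  have h2 := one_add_mul_le_pow (a := -(M / Q : ℝ)) (by
    have : (M : ℝ) / Q ≤ 1 := (div_le_one hQ').2 hMQ
    linarith) d
  have h3 : 1 - 1 / (N : ℝ) ≤ 1 + d * -(M / Q : ℝ) := by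
    have : (d : ℝ) * (M / Q) ≤ 1 / N := by
      rw [← mul_div_assoc, div_le_div_iff₀ hQ' hN']; linarith
    linarith
  calc _ ≤ (1 + -(M / Q : ℝ)) ^ d * (Q : ℝ) ^ d := by gcongr; exact h3.trans h2
    _ = ((Q : ℝ) - M) ^ d := by rw [← mul_pow]; congr 1; field_simp; ring
    _ ≤ _ := by gcongr

end Uniform

/-! ### Execution of programs -/

section Cost

/-- Number of nodes of an expression. -/
def CExpr.nodes : CExpr → ℕ
  | lit _ => 1
  | mem e => 1 + nodes e
  | bin _ e f => 1 + nodes e + nodes f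

/-- All literals are less than `W`. -/
def CExpr.Small (W : ℕ) : CExpr → Prop
  | lit k => k < W
  | mem e => Small W e
  | bin _ e f => Small W e ∧ Small W f

/-- Number of nodes of an expression. -/
def QExpr.nodes : QExpr → ℕ
  | lit e => 1 + e.nodes
  | cell e => 1 + e.nodes
  | bin _ e f => 1 + nodes e + nodes f

/-- All literals are less than `W`. -/
def QExpr.Small (W : ℕ) : QExpr → Prop
  | lit e => e.Small W
  | cell e => e.Small W
  | bin _ e f => Small W e ∧ Small W f

/-- Number of nodes of a register name. -/
def Reg.nodes : Reg → ℕ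
  | out e => 1 + e.nodes
  | _ => 1

/-- All literals are less than `W`. -/
def Reg.Small (W : ℕ) : Reg → Prop
  | out e => e.Small W
  | _ => True

theorem CExpr.one_le_nodes (e : CExpr) : 1 ≤ e.nodes := by cases e <;> simp only [nodes] <;> omega

variable {β : ℕ} {m : ℕ → ℕ}

/-- An arithmetic operation at most adds the bit lengths of its arguments, up to a carry that the β
bits of its own node absorb. -/
theorem CExpr.eval_lt (hβ : 1 ≤ β) (hm : ∀ a, m a < 2 ^ β) {e : CExpr} (he : e.Small (2 ^ β)) :
    e.eval m < 2 ^ (e.nodes * β) := by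
  induction e with
  | lit k =>
    have : k < 2 ^ β := he
    simpa only [eval, nodes, one_mul] using this
  | mem e ih =>
    exact (hm _).trans_le (Nat.pow_le_pow_right (by norm_num)
      (Nat.le_mul_of_pos_left _ (one_le_nodes _)))
  | bin o e f ihe ihf =>
    have h1 := ihe he.1
    have h2 := ihf he.2
    have h3 : 2 ^ ((bin o e f).nodes * β) =
        2 ^ β * (2 ^ (e.nodes * β) * 2 ^ (f.nodes * β)) := by
      rw [← pow_add, ← pow_add]; congr 1; simp only [nodes]; ring
    have h4 : 2 ≤ 2 ^ β := by
      calc 2 = 2 ^ 1 := rfl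
        _ ≤ 2 ^ β := Nat.pow_le_pow_right (by norm_num) hβ
    rw [h3]
    simp only [eval]
    generalize 2 ^ (e.nodes * β) = x at *
    generalize 2 ^ (f.nodes * β) = y at *
    generalize 2 ^ β = z at *
    generalize e.eval m = a at *
    generalize f.eval m = b at *
    have h5 : z * (x * y) ≥ 2 * (x * y) := Nat.mul_le_mul_right _ h4
    have h6 : x ≤ x * y := Nat.le_mul_of_pos_right _ (by omega)
    have h7 : y ≤ x * y := Nat.le_mul_of_pos_left _ (by omega)
    cases o <;> simp only [ArithOp.apply]
    · omega
    · omega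
    · have : a * b ≤ x * y := Nat.mul_le_mul h1.le h2.le
      omega
    · have := Nat.div_le_self a b; omega
    · have := Nat.mod_le a b; omega
    · split_ifs <;> omega

theorem CExpr.size_eval_le (hβ : 1 ≤ β) (hm : ∀ a, m a < 2 ^ β) {e : CExpr}
    (he : e.Small (2 ^ β)) : (e.eval m).size ≤ e.nodes * β :=
  Nat.size_le.2 (eval_lt hβ hm he)

theorem CExpr.cost_le (hβ : 1 ≤ β) (hm : ∀ a, m a < 2 ^ β) {e : CExpr}
    (he : e.Small (2 ^ β)) : e.cost m ≤ e.nodes * (1 + e.nodes * β) := by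
  induction e with
  | lit k =>
    have := size_eval_le hβ hm he
    simpa [cost, nodes, eval] using this
  | mem e ih =>
    have h1 := ih he
    have h2 := size_eval_le (e := mem e) hβ hm he
    simp only [cost, nodes, eval] at *
    nlinarith
  | bin o e f ihe ihf =>
    have h1 := ihe he.1
    have h2 := ihf he.2
    have h3 := size_eval_le (e := bin o e f) hβ hm he
    simp only [cost, nodes, eval] at *
    nlinarith [Nat.zero_le (e.nodes * f.nodes * β), Nat.zero_le (e.nodes * β),
      Nat.zero_le (f.nodes * β)]

theorem QExpr.cost_le (hβ : 1 ≤ β) (hm : ∀ a, m a < 2 ^ β) {e : QExpr}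
    (he : e.Small (2 ^ β)) (M : ℕ) : e.cost M m ≤ e.nodes * (2 + e.nodes * β + M.size) := by
  induction e with
  | lit e =>
    have h1 := CExpr.cost_le hβ hm (e := e) he
    simp only [cost, nodes]
    nlinarith
  | cell e =>
    have h1 := CExpr.cost_le hβ hm (e := e) he
    simp only [cost, nodes]
    nlinarith
  | bin o e f ihe ihf =>
    have h1 := ihe he.1
    have h2 := ihf he.2
    simp only [cost, nodes]
    nlinarith [Nat.zero_le (e.nodes * M.size), Nat.zero_le (f.nodes * M.size),
      Nat.zero_le (e.nodes * f.nodes * β)]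

/-- A common bound for the costs of all commands with expressions of at most `200` nodes. -/
def tau (β : ℕ) : ℕ := 200000 * β

theorem CExpr.cost_le_of_nodes (hβ : 1 ≤ β) (hm : ∀ a, m a < 2 ^ β) {e : CExpr}
    (he : e.Small (2 ^ β)) (hn : e.nodes ≤ 200) : e.cost m ≤ 200 + 40000 * β := by
  have h1 := cost_le hβ hm he
  have h2 : e.nodes * (1 + e.nodes * β) ≤ 200 * (1 + 200 * β) :=
    Nat.mul_le_mul hn (Nat.add_le_add_left (Nat.mul_le_mul_right _ hn) _)
  omega

theorem QExpr.cost_le_of_nodes (hβ : 1 ≤ β) (hm : ∀ a, m a < 2 ^ β) {e : QExpr}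
    (he : e.Small (2 ^ β)) (hn : e.nodes ≤ 200) {M : ℕ} (hM : M < 2 ^ β) :
    e.cost M m ≤ 400 + 40200 * β := by
  have h1 := cost_le hβ hm he M
  have h2 : e.nodes * (2 + e.nodes * β + M.size) ≤ 200 * (2 + 200 * β + β) :=
    Nat.mul_le_mul hn (Nat.add_le_add (Nat.add_le_add_left (Nat.mul_le_mul_right _ hn) _)
      (Nat.size_le.2 hM))
  omega

theorem Reg.cost_le_of_nodes (hβ : 1 ≤ β) (hm : ∀ a, m a < 2 ^ β) {r : Reg}
    (he : r.Small (2 ^ β)) (hn : r.nodes ≤ 200) : r.cost m ≤ 201 + 40000 * β := by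
  cases r with
  | out e =>
    have := CExpr.cost_le_of_nodes hβ hm (e := e) he (by simp only [nodes] at hn; omega)
    simp only [cost]
    omega
  | _ => simp only [cost]; omega

end Cost

/-! ### Quantum memory that is a function of the basis state -/

section Embed

variable {σ : Type*} [Fintype σ]

/-- The joint state where the quantum memory is the function `w` of the basis state. -/
noncomputable def emb (w : σ → ℕ → ℕ) (ψ : σ → ℂ) : JointState σ :=
  ∑ s, Finsupp.single (w s, s) (ψ s)

open Classical in
theorem emb_apply (w : σ → ℕ → ℕ) (ψ : σ → ℂ) (b : (ℕ → ℕ) × σ) :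
    emb w ψ b = if b.1 = w b.2 then ψ b.2 else 0 := by
  rw [emb, Finsupp.finsetSum_apply, Finset.sum_eq_single b.2]
  · simp only [Finsupp.single_apply]
    refine if_congr ⟨fun h => by rw [← h], fun h => ?_⟩ rfl rfl
    rw [← h]
  · intro s _ hs
    rw [Finsupp.single_apply, if_neg]
    rintro rfl
    exact hs rfl
  · simp

theorem smul_emb (w : σ → ℕ → ℕ) (a : ℂ) (ψ : σ → ℂ) : a • emb w ψ = emb w (a • ψ) := by
  simp [emb, Finset.smul_sum]

theorem mapDomain_emb (w : σ → ℕ → ℕ) (ψ : σ → ℂ) (u : (ℕ → ℕ) × σ → ℕ → ℕ) :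
    (emb w ψ).mapDomain (fun p => (u p, p.2)) = emb (fun s => u (w s, s)) ψ := by
  simp only [emb, Finsupp.mapDomain_finsetSum, Finsupp.mapDomain_single]

theorem emb_sum {M : Type*} [AddCommMonoid M] (w : σ → ℕ → ℕ) (ψ : σ → ℂ)
    (h : (ℕ → ℕ) × σ → ℂ → M) (h0 : ∀ b, h b 0 = 0) (hadd : ∀ b x y, h b (x + y) = h b x + h b y) :
    (emb w ψ).sum h = ∑ s, h (w s, s) (ψ s) := by
  rw [emb, ← Finsupp.sum_finsetSum_index h0 hadd]
  exact Finset.sum_congr rfl fun s _ => Finsupp.sum_single_index (h0 _)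

/-- Here the memory content must not depend on the basis state: an entangled memory would not remain
a function of the basis state after T. For this reason the simulator clears its memory before every
call. -/
theorem applyBox_emb [DecidableEq σ] (w : ℕ → ℕ) (T : Matrix σ σ ℂ) (ψ : σ → ℂ) :
    (emb (fun _ => w) ψ).applyBox T = emb (fun _ => w) (T.mulVec ψ) := by
  rw [JointState.applyBox, emb_sum]
  · rw [Finset.sum_comm, emb]
    refine Finset.sum_congr rfl fun s _ => ?_
    simp only [Matrix.mulVec, dotProduct]
    exact (map_sum (Finsupp.singleAddHom (w, s)) _ _).symm
  · simp
  · intro b x y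
    simp [mul_add, Finset.sum_add_distrib]

theorem normSq_emb (w : σ → ℕ → ℕ) (ψ : σ → ℂ) : (emb w ψ).normSq = nsq ψ := by
  classical
  rw [JointState.normSq, Finsupp.sum_of_support_subset (s := Finset.univ.image fun s => (w s, s))]
  · rw [Finset.sum_image (fun a _ b _ h => (Prod.mk.inj h).2)]
    simp [emb_apply, nsq]
  · intro b hb
    rw [Finsupp.mem_support_iff, emb_apply] at hb
    simp only [Finset.mem_image, Finset.mem_univ, true_and]
    refine ⟨b.2, ?_⟩
    by_contra h
    exact hb (if_neg fun h' => h (by rw [← h']))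
  · simp

theorem filter_emb (w : σ → ℕ → ℕ) (ψ : σ → ℂ) (p : (ℕ → ℕ) × σ → Prop) [DecidablePred p] :
    (emb w ψ).filter p = emb w fun s => if p (w s, s) then ψ s else 0 := by
  classical
  ext b
  rw [Finsupp.filter_apply, emb_apply, emb_apply]
  by_cases h : b.1 = w b.2
  · simp [← h]
  · simp [h]

end Embed

/-! ### Rules for execution time and expected values -/

namespace Prog

variable {σ : Type*} [Fintype σ] {B : BlackBox σ}

/-- Deterministic execution in time at most `T`. -/
def Step (B : BlackBox σ) (P : Prog) (m : ℕ → ℕ) (ψ : JointState σ) (m' : ℕ → ℕ)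
    (ψ' : JointState σ) (T : ℕ) : Prop :=
  ∀ t, ∃ t' ≤ t + T, exec B P ⟨t, m, ψ⟩ = [⟨t', m', ψ'⟩]

/-- Every branch takes time at most `T` and satisfies the postcondition. -/
def All (B : BlackBox σ) (P : Prog) (m : ℕ → ℕ) (ψ : JointState σ) (T : ℕ)
    (post : (ℕ → ℕ) → JointState σ → Prop) : Prop :=
  ∀ t, ∀ d ∈ exec B P ⟨t, m, ψ⟩, d.time ≤ t + T ∧ post d.mem d.state

/-- Sum of `K` over all branches. -/
noncomputable def val (B : BlackBox σ) (K : Branch σ → ℝ) (P : Prog) (c : Branch σ) : ℝ :=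
  ((exec B P c).map K).sum

/-- A lower bound that holds at all times. -/
def LB (K : Branch σ → ℝ) (m : ℕ → ℕ) (ψ : JointState σ) (z : ℝ) : Prop :=
  ∀ t, z ≤ K ⟨t, m, ψ⟩

variable {P P' : Prog} {m m' m'' : ℕ → ℕ} {ψ ψ' ψ'' : JointState σ} {T T' : ℕ}
  {K : Branch σ → ℝ} {z : ℝ} {post post' : (ℕ → ℕ) → JointState σ → Prop} {e : CExpr}

theorem sum_flatMap {α β : Type*} (l : List α) (f : α → List β) (K : β → ℝ) :
    ((l.flatMap f).map K).sum = (l.map fun a => ((f a).map K).sum).sum := by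
  induction l with
  | nil => simp
  | cons a l ih => simp [ih]

theorem val_seq (c : Branch σ) : val B K (seq P P') c = val B (val B K P') P c := by
  simp only [val, exec, sum_flatMap]
  rfl

theorem val_nonneg (hK : ∀ c, 0 ≤ K c) (c : Branch σ) : 0 ≤ val B K P c :=
  List.sum_nonneg fun x hx => by
    obtain ⟨d, _, rfl⟩ := List.mem_map.1 hx
    exact hK d

theorem Step.mono (h : Step B P m ψ m' ψ' T) (hT : T ≤ T') : Step B P m ψ m' ψ' T' := by
  intro t
  obtain ⟨t', ht, he⟩ := h t
  exact ⟨t', by omega, he⟩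

theorem Step.seq (h : Step B P m ψ m' ψ' T) (h' : Step B P' m' ψ' m'' ψ'' T') :
    Step B (seq P P') m ψ m'' ψ'' (T + T') := by
  intro t
  obtain ⟨t1, ht1, he1⟩ := h t
  obtain ⟨t2, ht2, he2⟩ := h' t1
  exact ⟨t2, by omega, by simp [exec, he1, he2]⟩

theorem Step.all (h : Step B P m ψ m' ψ' T) (hp : post m' ψ') : All B P m ψ T post := by
  intro t d hd
  obtain ⟨t1, ht1, he1⟩ := h t
  rw [he1, List.mem_singleton] at hd
  subst hd
  exact ⟨ht1, hp⟩

theorem Step.lb (h : Step B P m ψ m' ψ' T) (hp : LB K m' ψ' z) : LB (val B K P) m ψ z := by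
  intro t
  obtain ⟨t1, ht1, he1⟩ := h t
  simpa [val, he1] using hp t1

theorem LB.seq (h : LB (val B (val B K P') P) m ψ z) : LB (val B K (Prog.seq P P')) m ψ z := by
  intro t
  rw [val_seq]
  exact h t

theorem All.mono (h : All B P m ψ T post) (hT : T ≤ T') (hp : ∀ m ψ, post m ψ → post' m ψ) :
    All B P m ψ T' post' := by
  intro t d hd
  have := h t d hd
  exact ⟨by omega, hp _ _ this.2⟩

theorem All.seq (h : All B P m ψ T post) (h' : ∀ m ψ, post m ψ → All B P' m ψ T' post') :
    All B (Prog.seq P P') m ψ (T + T') post' := by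
  intro t d hd
  simp only [exec, List.mem_flatMap] at hd
  obtain ⟨⟨t1, m1, ψ1⟩, hc, hd⟩ := hd
  have h1 := h t _ hc
  have h2 := h' m1 ψ1 h1.2 t1 d hd
  exact ⟨by simp only at h1; omega, h2.2⟩

/-- The iterations of a loop. -/
noncomputable def iter (B : BlackBox σ) (P : Prog) : ℕ → Branch σ → List (Branch σ)
  | 0, c => [c]
  | k + 1, c => (exec B P (c.tick 1)).flatMap (iter B P k)

/-- The semantics iterates on lists of branches; following one branch through all iterations is what
inductions over loops need. -/
theorem iterate_eq_flatMap (k : ℕ) (l : List (Branch σ)) :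
    (fun l : List (Branch σ) => l.flatMap fun d => exec B P (d.tick 1))^[k] l =
      l.flatMap (iter B P k) := by
  induction k generalizing l with
  | zero =>
    rw [Function.iterate_zero, id]
    exact List.flatMap_singleton' l |>.symm
  | succ k ih =>
    rw [Function.iterate_succ_apply, ih, List.flatMap_assoc]
    rfl

theorem exec_loop (c : Branch σ) :
    exec B (loop e P) c = iter B P (e.eval c.mem) (c.tick (1 + e.cost c.mem)) := by
  rw [exec, iterate_eq_flatMap]
  simp

theorem Step.loop {β : ℕ} (hβ : 1 ≤ β) (hm : ∀ a, m a < 2 ^ β) (hs : e.Small (2 ^ β))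
    (hn : e.nodes ≤ 200)
    (M : ℕ → ℕ → ℕ) (Ψ : ℕ → JointState σ) (k : ℕ) (hk : e.eval m = k) (h0 : M 0 = m)
    (h0' : Ψ 0 = ψ) (h : ∀ i < k, Step B P (M i) (Ψ i) (M (i + 1)) (Ψ (i + 1)) T) :
    Step B (Prog.loop e P) m ψ (M k) (Ψ k) (tau β + k * (T + 1)) := by
  have key : ∀ j i, i + j = k → ∀ t, ∃ t' ≤ t + j * (T + 1),
      iter B P j ⟨t, M i, Ψ i⟩ = [⟨t', M k, Ψ k⟩] := by
    intro j
    induction j with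
    | zero => intro i hi t; exact ⟨t, by omega, by simp at hi; subst hi; rfl⟩
    | succ j ih =>
      intro i hi t
      obtain ⟨t1, ht1, he1⟩ := h i (by omega) (t + 1)
      obtain ⟨t2, ht2, he2⟩ := ih (i + 1) (by omega) t1
      refine ⟨t2, ?_, ?_⟩
      · rw [Nat.add_mul]; omega
      · simp only [iter, Branch.tick, he1, List.flatMap_cons, List.flatMap_nil, he2,
          List.append_nil]
  intro t
  have h1 := CExpr.cost_le_of_nodes hβ hm hs hn
  obtain ⟨t', ht', he⟩ := key k 0 (by omega) (t + (1 + e.cost m))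
  refine ⟨t', ?_, ?_⟩
  · unfold tau; omega
  · rw [exec_loop]
    simp only [hk, Branch.tick]
    rw [← he, h0, h0']

theorem step_skip : Step B skip m ψ m ψ 1 := fun t => ⟨t + 1, le_rfl, rfl⟩

section Primitive

variable {β : ℕ} {a b M : CExpr} {f : QExpr} {r : Reg}

theorem All.ite (hβ : 1 ≤ β) (hm : ∀ a, m a < 2 ^ β) (hs : e.Small (2 ^ β))
    (hn : e.nodes ≤ 200) (h : e.eval m ≠ 0 → All B P m ψ T post)
    (h' : e.eval m = 0 → All B P' m ψ T post) : All B (Prog.ite e P P') m ψ (tau β + T) post := by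
  intro t d hd
  have h1 := CExpr.cost_le_of_nodes hβ hm hs hn
  have h2 : tau β = 200000 * β := rfl
  rw [exec] at hd
  split_ifs at hd with he
  · have := h he (t + (1 + e.cost m)) d hd
    exact ⟨by have := this.1; omega, this.2⟩
  · have := h' (not_not.1 he) (t + (1 + e.cost m)) d hd
    exact ⟨by have := this.1; omega, this.2⟩

theorem Step.ite_pos (hβ : 1 ≤ β) (hm : ∀ a, m a < 2 ^ β) (hs : e.Small (2 ^ β))
    (hn : e.nodes ≤ 200) (he : e.eval m ≠ 0) (h : Step B P m ψ m' ψ' T) :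
    Step B (Prog.ite e P P') m ψ m' ψ' (tau β + T) := by
  intro t
  have h1 := CExpr.cost_le_of_nodes hβ hm hs hn
  have h2 : tau β = 200000 * β := rfl
  obtain ⟨t', ht', he'⟩ := h (t + (1 + e.cost m))
  refine ⟨t', by omega, ?_⟩
  rw [exec, if_pos he]
  exact he'

theorem Step.ite_neg (hβ : 1 ≤ β) (hm : ∀ a, m a < 2 ^ β) (hs : e.Small (2 ^ β))
    (hn : e.nodes ≤ 200) (he : e.eval m = 0) (h : Step B P' m ψ m' ψ' T) :
    Step B (Prog.ite e P P') m ψ m' ψ' (tau β + T) := by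
  intro t
  have h1 := CExpr.cost_le_of_nodes hβ hm hs hn
  have h2 : tau β = 200000 * β := rfl
  obtain ⟨t', ht', he'⟩ := h (t + (1 + e.cost m))
  refine ⟨t', by omega, ?_⟩
  rw [exec, if_neg (not_not.2 he)]
  exact he'

theorem LB.ite_pos (he : e.eval m ≠ 0) (h : LB (val B K P) m ψ z) :
    LB (val B K (Prog.ite e P P')) m ψ z := by
  intro t
  rw [val, exec, if_pos he]
  exact h _

theorem LB.ite_neg (he : e.eval m = 0) (h : LB (val B K P') m ψ z) :
    LB (val B K (Prog.ite e P P')) m ψ z := by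
  intro t
  rw [val, exec, if_neg (not_not.2 he)]
  exact h _

theorem step_assign (hβ : 1 ≤ β) (hm : ∀ a, m a < 2 ^ β) (hsa : a.Small (2 ^ β))
    (hna : a.nodes ≤ 200) (hs : e.Small (2 ^ β)) (hn : e.nodes ≤ 200) :
    Step B (assign a e) m ψ (Function.update m (a.eval m) (e.eval m)) ψ (tau β) := by
  intro t
  have h1 := CExpr.cost_le_of_nodes hβ hm hsa hna
  have h2 := CExpr.cost_le_of_nodes hβ hm hs hn
  have h3 : tau β = 200000 * β := rfl
  exact ⟨t + 1 + a.cost m + e.cost m, by omega, rfl⟩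

theorem step_addTo (hβ : 1 ≤ β) (hm : ∀ a, m a < 2 ^ β) (hsa : a.Small (2 ^ β))
    (hna : a.nodes ≤ 200) (hs : M.Small (2 ^ β)) (hn : M.nodes ≤ 200) (hM : M.eval m < 2 ^ β)
    (hsf : f.Small (2 ^ β)) (hnf : f.nodes ≤ 200) (w : σ → ℕ → ℕ) (φ : σ → ℂ) :
    Step B (addTo a M f) m (emb w φ) m (emb (fun s => Function.update (w s) (a.eval m)
      (modAdd (M.eval m) (f.eval (M.eval m) m (Function.update (w s) (a.eval m) 0))
        (w s (a.eval m)))) φ) (tau β) := by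
  intro t
  have h1 := CExpr.cost_le_of_nodes hβ hm hsa hna
  have h2 := CExpr.cost_le_of_nodes hβ hm hs hn
  have h4 := QExpr.cost_le_of_nodes hβ hm hsf hnf hM
  have h3 : tau β = 200000 * β := rfl
  refine ⟨t + 1 + a.cost m + M.cost m + f.cost (M.eval m) m, by omega, ?_⟩
  · rw [exec]
    simp only
    rw [mapDomain_emb w φ fun s => Function.update s.1 (a.eval m) (modAdd (M.eval m)
      (f.eval (M.eval m) m (Function.update s.1 (a.eval m) 0)) (s.1 (a.eval m)))]

theorem step_read (hβ : 1 ≤ β) (hm : ∀ a, m a < 2 ^ β) (hsa : a.Small (2 ^ β))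
    (hna : a.nodes ≤ 200) (hs : r.Small (2 ^ β)) (hn : r.nodes ≤ 200) (hM : B.range m r < 2 ^ β)
    (w : σ → ℕ → ℕ) (φ : σ → ℂ) :
    Step B (read r a) m (emb w φ) m (emb (fun s => Function.update (w s) (a.eval m)
      (modAdd (B.range m r) (B.content m r s) (w s (a.eval m)))) φ) (tau β) := by
  intro t
  have h1 := CExpr.cost_le_of_nodes hβ hm hsa hna
  have h2 := Reg.cost_le_of_nodes hβ hm hs hn
  have h4 := Nat.size_le.2 hM
  have h3 : tau β = 200000 * β := rfl
  refine ⟨t + 1 + r.cost m + a.cost m + (B.range m r).size, by omega, ?_⟩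
  · rw [exec]
    simp only
    rw [mapDomain_emb w φ fun s => Function.update s.1 (a.eval m)
      (modAdd (B.range m r) (B.content m r s.2) (s.1 (a.eval m)))]

/-- Since w is invariant under the permutation, the moved basis states still carry the right memory
and the state keeps its form `emb w _`. -/
theorem step_respond (hβ : 1 ≤ β) (hm : ∀ a, m a < 2 ^ β) (hsa : a.Small (2 ^ β))
    (hna : a.nodes ≤ 200) (hs : b.Small (2 ^ β)) (hn : b.nodes ≤ 200)
    (hM : B.range m .answer < 2 ^ β) (w : σ → ℕ → ℕ) (φ : σ → ℂ) (π : Equiv.Perm σ)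
    (hπ : ∀ s, π s = if w s (b.eval m) ≠ 0 then B.addAnswer (w s (a.eval m)) s else s)
    (hw : ∀ s, w (π.symm s) = w s) :
    Step B (respond b a) m (emb w φ) m (emb w fun s => φ (π.symm s)) (tau β) := by
  intro t
  have h1 := CExpr.cost_le_of_nodes hβ hm hsa hna
  have h2 := CExpr.cost_le_of_nodes hβ hm hs hn
  have h4 := Nat.size_le.2 hM
  have h3 : tau β = 200000 * β := rfl
  refine ⟨t + 1 + b.cost m + a.cost m + (B.range m .answer).size, by omega, ?_⟩
  · rw [exec]
    simp only
    congr 2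
    simp only [emb, Finsupp.mapDomain_finsetSum, Finsupp.mapDomain_single, ← hπ]
    refine Fintype.sum_equiv π _ _ fun s => ?_
    rw [← hw (π s), Equiv.symm_apply_apply]

theorem step_call [DecidableEq σ] (hβ : 1 ≤ β) (hm : ∀ a, m a < 2 ^ β) (hs : e.Small (2 ^ β))
    (hn : e.nodes ≤ 200) (w : ℕ → ℕ) (φ : σ → ℂ) :
    Step B (call e) m (emb (fun _ => w) φ) m
      (emb (fun _ => w) ((B.op (e.eval m)).mulVec φ)) (tau β) := by
  intro t
  have h1 := CExpr.cost_le_of_nodes hβ hm hs hn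
  have h3 : tau β = 200000 * β := rfl
  refine ⟨t + 1 + e.cost m, by omega, ?_⟩
  · rw [exec]
    simp only
    rw [applyBox_emb]

theorem all_sample (hβ : 1 ≤ β) (hm : ∀ a, m a < 2 ^ β) (hsa : a.Small (2 ^ β))
    (hna : a.nodes ≤ 200) (hs : e.Small (2 ^ β)) (hn : e.nodes ≤ 200) (w : σ → ℕ → ℕ) (φ : σ → ℂ) :
    All B (sample a e) m (emb w φ) (tau β) fun m' ψ' => ∃ v ≤ e.eval m,
      m' = Function.update m (a.eval m) v ∧ ∃ φ', ψ' = emb w φ' := by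
  intro t d hd
  have h1 := CExpr.cost_le_of_nodes hβ hm hsa hna
  have h2 := CExpr.cost_le_of_nodes hβ hm hs hn
  have h3 : tau β = 200000 * β := rfl
  simp only [exec, List.mem_map, List.mem_range] at hd
  obtain ⟨v, hv, rfl⟩ := hd
  exact ⟨by simp only; omega, v, by omega, rfl, _, smul_emb _ _ _⟩

theorem lb_sample (w : σ → ℕ → ℕ) (φ : σ → ℂ) (z : ℕ → ℝ)
    (h : ∀ v ≤ e.eval m, LB K (Function.update m (a.eval m) v)
      (emb w (((1 / Real.sqrt (e.eval m + 1) : ℝ) : ℂ) • φ)) (z v)) :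
    LB (val B K (sample a e)) m (emb w φ) (∑ v ∈ Finset.range (e.eval m + 1), z v) := by
  intro t
  rw [val, exec, List.map_map]
  refine le_trans (Finset.sum_le_sum fun v hv => h v (by simpa [Nat.lt_succ_iff] using hv)
    (t + 1 + a.cost m + e.cost m)) (le_of_eq ?_)
  rw [← List.sum_toFinset _ List.nodup_range, List.toFinset_range]
  refine Finset.sum_congr rfl fun v _ => ?_
  simp only [Function.comp_apply, smul_emb]

theorem exec_measure (w : σ → ℕ → ℕ) (φ : σ → ℂ) (t : ℕ) :
    ∃ L : List ℕ, (∀ v, v ∈ L ↔ ∃ s, φ s ≠ 0 ∧ w s (b.eval m) = v) ∧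
      exec B (measure a b) ⟨t, m, emb w φ⟩ = L.map fun v =>
        ⟨t + 1 + a.cost m + b.cost m + v.size, Function.update m (a.eval m) v,
          emb w fun s => if w s (b.eval m) = v then φ s else 0⟩ := by
  classical
  refine ⟨((emb w φ).support.image fun s => s.1 (b.eval m)).toList, fun v => ?_, ?_⟩
  rotate_left
  · rw [exec]
    refine List.map_congr_left fun v _ => ?_
    simp only [filter_emb]
  · simp only [Finset.mem_toList, Finset.mem_image, Finsupp.mem_support_iff, emb_apply]
    constructor
    · rintro ⟨s, hs, rfl⟩
      by_cases h : s.1 = w s.2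
      · exact ⟨s.2, by simpa [h] using hs, by rw [h]⟩
      · exact absurd (if_neg h) hs
    · rintro ⟨s, hs, rfl⟩
      exact ⟨(w s, s), by simpa using hs, rfl⟩

theorem all_measure (hβ : 1 ≤ β) (hm : ∀ a, m a < 2 ^ β) (hsa : a.Small (2 ^ β))
    (hna : a.nodes ≤ 200) (hs : b.Small (2 ^ β)) (hn : b.nodes ≤ 200) (w : σ → ℕ → ℕ) (φ : σ → ℂ)
    {k : ℕ} (hk : k ≤ 2 ^ β) (hw : ∀ s, w s (b.eval m) < k) :
    All B (measure a b) m (emb w φ) (tau β) fun m' ψ' => ∃ v < k,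
      m' = Function.update m (a.eval m) v ∧
        ψ' = emb w fun s => if w s (b.eval m) = v then φ s else 0 := by
  intro t d hd
  have h1 := CExpr.cost_le_of_nodes hβ hm hsa hna
  have h2 := CExpr.cost_le_of_nodes hβ hm hs hn
  have h3 : tau β = 200000 * β := rfl
  obtain ⟨L, hL, he⟩ := exec_measure (B := B) (a := a) (b := b) (m := m) w φ t
  rw [he] at hd
  obtain ⟨v, hv, rfl⟩ := List.mem_map.1 hd
  have hvk : v < k := by
    obtain ⟨s, _, rfl⟩ := (hL v).1 hv
    exact hw s
  have := Nat.size_le.2 (hvk.trans_le hk)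
  exact ⟨by simp only; omega, v, hvk, rfl, rfl⟩

/-- All outcomes but v are dropped. Only outcomes of nonzero amplitude have a branch at all; `h0`
covers the case that v has none. -/
theorem lb_measure (hK : ∀ c, 0 ≤ K c) (w : σ → ℕ → ℕ) (φ : σ → ℂ) (v : ℕ)
    (h : LB K (Function.update m (a.eval m) v)
      (emb w fun s => if w s (b.eval m) = v then φ s else 0) z)
    (h0 : (∀ s, w s (b.eval m) = v → φ s = 0) → z ≤ 0) :
    LB (val B K (measure a b)) m (emb w φ) z := by
  intro t
  obtain ⟨L, hL, he⟩ := exec_measure (B := B) (a := a) (b := b) (m := m) w φ t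
  rw [val, he, List.map_map]
  by_cases hv : v ∈ L
  · refine (h _).trans (List.single_le_sum ?_ _ (List.mem_map.2 ⟨v, hv, rfl⟩))
    intro x hx
    obtain ⟨u, _, rfl⟩ := List.mem_map.1 hx
    exact hK _
  · refine (h0 fun s hs => ?_).trans (List.sum_nonneg fun x hx => ?_)
    · by_contra hne
      exact hv ((hL v).2 ⟨s, hne, hs⟩)
    · obtain ⟨u, _, rfl⟩ := List.mem_map.1 hx
      exact hK _

end Primitive

end Prog

/-! ### The simulator -/

/-- Content of a classical cell. -/
abbrev var (k : ℕ) : CExpr := .mem (.lit k)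

/-- Element with number `e` of the array that starts at `k`; arrays have stride `4`. -/
abbrev arrayAt (k : ℕ) (e : CExpr) : CExpr := .bin .add (.lit k) (.bin .mul (.lit 4) e)

/-- The truth value of `a < b`. -/
abbrev ltExpr (a b : CExpr) : CExpr := .bin .eq (.bin .sub (.bin .add a (.lit 1)) b) (.lit 0)

/-- The negative of `f`, computed modulo `R`. -/
abbrev negExpr (R : CExpr) (f : QExpr) : QExpr :=
  .bin .add (.bin .sub (.lit (.bin .sub R (.lit 1))) f) (.lit (.lit 1))

theorem eval_ltExpr (m : ℕ → ℕ) (a b : CExpr) :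
    (ltExpr a b).eval m = if a.eval m < b.eval m then 1 else 0 := by
  simp only [CExpr.eval, ArithOp.apply]
  refine if_congr ?_ rfl rfl
  omega

theorem QExpr.eval_lt {M : ℕ} (hM : 0 < M) (m w : ℕ → ℕ) (f : QExpr) : f.eval M m w < M := by
  cases f <;> exact Nat.mod_lt _ hM

/-- The detour over M - 1 is needed because the literal M would be reduced to 0, from which
truncated subtraction only gives 0. -/
theorem eval_negExpr {M : ℕ} (m w : ℕ → ℕ) {R : CExpr} (hR : R.eval m = M) (hM : 0 < M)
    (f : QExpr) : (negExpr R f).eval M m w = (M - f.eval M m w) % M := by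
  have h := f.eval_lt hM m w
  simp only [QExpr.eval, CExpr.eval, ArithOp.apply, hR]
  rw [Nat.mod_eq_of_lt (show M - 1 < M by omega), ← Nat.add_mod]
  congr 1
  omega

/-- Parameters of the simulator: number of messages, a prime number, and the numbers of left and
right components of hash inputs and of hash values. -/
structure SimParams where
  n : ℕ
  p : ℕ
  cL : ℕ
  cX : ℕ
  cY : ℕ

namespace SimParams

/-- All literals of the simulator are less than `W`. -/
structure Fits (P : SimParams) (W : ℕ) : Prop where
  n_lt : P.n + 8 < W
  p_lt : P.p < W
  cL_lt : P.cL < W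
  cX_lt : P.cX < W
  cY_lt : P.cY < W
  const : 64 < W

/-- Number of coefficients of the polynomial. -/
abbrev numCoeffs : CExpr := .bin .mul (.lit 2) (var 3)

/-- Number of steps of the evaluation of the hash function. -/
abbrev chainLen : CExpr := .bin .add numCoeffs (var 6)

/-- The number of the query input. -/
abbrev inputNum (P : SimParams) : QExpr :=
  .bin .add (.bin .mul (.cell (.lit 1)) (.lit (.lit P.cX))) (.cell (.lit 2))

/-- Next value in the evaluation of the hash function. -/
abbrev stepExpr (P : SimParams) : QExpr :=
  .bin .add
    (.bin .mul (.lit (ltExpr (var 10) numCoeffs))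
      (.bin .add (.bin .mul (.cell (.bin .add (.lit 4) (var 10))) P.inputNum)
        (.lit (.mem (arrayAt 16 (var 10))))))
    (.bin .mul (.bin .sub (.lit (.lit 1)) (.lit (ltExpr (var 10) numCoeffs)))
      (.bin .add
        (.bin .mul (.bin .eq P.inputNum (.lit (.mem (arrayAt 17 (.bin .sub (var 10) numCoeffs)))))
          (.lit (.mem (arrayAt 18 (.bin .sub (var 10) numCoeffs)))))
        (.bin .mul (.bin .sub (.lit (.lit 1))
            (.bin .eq P.inputNum (.lit (.mem (arrayAt 17 (.bin .sub (var 10) numCoeffs))))))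
          (.cell (.bin .add (.lit 4) (var 10))))))

/-- The hash value. -/
abbrev answerExpr (P : SimParams) : QExpr :=
  .bin .mod (.cell (.bin .add (.lit 4) chainLen)) (.lit (.lit P.cY))

/-- Set the quantum cell `a`, which contains the content of register `r`, to zero. -/
def unread (r : Reg) (R a : ℕ) : Prog :=
  .seq (.addTo (.lit 3) (.lit R) (negExpr (.lit R) (.cell (.lit a))))
    (.seq (.addTo (.lit a) (.lit R) (.cell (.lit 3))) (.read r (.lit 3)))

/-- Measure register `r` into the classical cell `a`. -/
def grab (r : Reg) (R a : ℕ) : Prog :=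
  .seq (.read r (.lit 1)) (.seq (.measure (.lit a) (.lit 1)) (unread r R 1))

/-- One step of the evaluation of the hash function. -/
def forward (P : SimParams) : Prog :=
  .seq (.addTo (.bin .add (.lit 5) (var 10)) (var 4) P.stepExpr)
    (.assign (.lit 10) (.bin .add (var 10) (.lit 1)))

/-- The inverse of `forward`. -/
def backward (P : SimParams) : Prog :=
  .seq (.assign (.lit 10) (.bin .sub (var 10) (.lit 1)))
    (.addTo (.bin .add (.lit 5) (var 10)) (var 4) (negExpr (var 4) P.stepExpr))

/-- Answer a query of the black box. -/
def query (P : SimParams) : Prog :=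
  .seq (.read .ctrl (.lit 0)) (.seq (.read .left (.lit 1)) (.seq (.read .right (.lit 2))
  (.seq (.assign (.lit 10) (.lit 0)) (.seq (.loop chainLen P.forward)
  (.seq (.addTo (.bin .add (.lit 5) chainLen) (var 4) P.answerExpr)
  (.seq (.respond (.lit 0) (.bin .add (.lit 5) chainLen))
  (.seq (.addTo (.bin .add (.lit 5) chainLen) (var 4) (negExpr (var 4) P.answerExpr))
  (.seq (.loop chainLen P.backward)
  (.seq (unread .ctrl 2 0) (.seq (unread .left P.cL 1) (unread .right P.cX 2)))))))))))

/-- Answer a query and let the black box proceed. -/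
def advance (P : SimParams) : Prog :=
  .seq P.query (.seq (.call (var 5)) (.assign (.lit 5) (.bin .add (var 5) (.lit 1))))

/-- Value of one step of the evaluation of the hash function on the input with number `v`. -/
def stepVal (m : ℕ → ℕ) (v j g : ℕ) : ℕ :=
  if j < 2 * m 3 then (g * v + m (16 + 4 * j)) % m 4
  else if v = m (17 + 4 * (j - 2 * m 3)) % m 4 then m (18 + 4 * (j - 2 * m 3)) % m 4 else g

/-- The successive values in the evaluation of the hash function. -/
def chainVal (m : ℕ → ℕ) (v : ℕ) : ℕ → ℕ
  | 0 => 0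
  | j + 1 => stepVal m v j (chainVal m v j)

/-- The hash value of the input with number `v`. -/
def hashVal (P : SimParams) (m : ℕ → ℕ) (v : ℕ) : ℕ := chainVal m v (2 * m 3 + m 6) % P.cY

theorem chainVal_lt {m : ℕ → ℕ} (hQ : 0 < m 4) (v j : ℕ) : chainVal m v j < m 4 := by
  induction j with
  | zero => exact hQ
  | succ j ih =>
    rw [chainVal, stepVal]
    split_ifs
    · exact Nat.mod_lt _ hQ
    · exact Nat.mod_lt _ hQ
    · exact ih

/-- The first 2q steps (q is in cell 3) are Horner's scheme with the coefficients in cells 16 + 4i;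
later steps overwrite the value if the input is a recorded one, with keys in cells 17 + 4i and
values in cells 18 + 4i. Stride 4 keeps the three arrays apart. -/
theorem chainVal_congr {m m' : ℕ → ℕ} (h3 : m 3 = m' 3) (h4 : m 4 = m' 4) (v j : ℕ)
    (h : ∀ i < j, ∀ k < 3, m (16 + 4 * i + k) = m' (16 + 4 * i + k)) :
    chainVal m v j = chainVal m' v j := by
  induction j with
  | zero => rfl
  | succ j ih =>
    have h16 := h j (by omega) 0 (by omega)
    have h17 := h (j - 2 * m 3) (by omega) 1 (by omega)
    have h18 := h (j - 2 * m 3) (by omega) 2 (by omega)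
    rw [show 16 + 4 * j + 0 = 16 + 4 * j by omega] at h16
    rw [show ∀ x, 16 + 4 * x + 1 = 17 + 4 * x by omega] at h17
    rw [show ∀ x, 16 + 4 * x + 2 = 18 + 4 * x by omega] at h18
    rw [chainVal, chainVal, ih fun i hi => h i (by omega), stepVal, stepVal, h16, h17, h18, h3, h4]

/-- Coherent expressions have no conditionals, so both case distinctions are products with
indicators. A modulus of at least 2 keeps the indicator 1 from being reduced to 0. -/
theorem eval_stepExpr (P : SimParams) {m w : ℕ → ℕ} {v g j : ℕ} (hQ : 2 ≤ m 4) (hj : m 10 = j)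
    (hv : w 1 * P.cX + w 2 = v) (hvQ : v < m 4) (hg : w (4 + j) = g) (hgQ : g < m 4) :
    P.stepExpr.eval (m 4) m w = stepVal m v j g := by
  have h1 : P.inputNum.eval (m 4) m w = v := by
    simp only [QExpr.eval, CExpr.eval, ArithOp.apply]
    rw [← Nat.mul_mod, ← Nat.add_mod, hv, Nat.mod_eq_of_lt hvQ]
  have h2 : (1 : ℕ) % m 4 = 1 := Nat.mod_eq_of_lt hQ
  have h3 : (0 : ℕ) % m 4 = 0 := Nat.zero_mod _
  unfold stepVal
  simp only [QExpr.eval, eval_ltExpr] at h1 ⊢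
  simp only [CExpr.eval, ArithOp.apply] at h1 ⊢
  simp only [h1, hj, hg, Nat.mod_eq_of_lt hgQ]
  by_cases hjt : j < 2 * m 3
  · simp only [if_pos hjt, h2, Nat.sub_self, h3, one_mul, zero_mul, add_zero, Nat.mod_mod]
    rw [← Nat.add_mod]
  · simp only [if_neg hjt, h2, h3, one_mul, zero_mul, zero_add, Nat.mod_mod, Nat.sub_zero]
    by_cases hvm : v = m (17 + 4 * (j - 2 * m 3)) % m 4
    · simp only [if_pos hvm, h2, h3, one_mul, zero_mul, add_zero, Nat.mod_mod, Nat.sub_self]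
    · simp only [if_neg hvm, h2, h3, one_mul, zero_mul, zero_add, Nat.sub_zero,
        Nat.mod_eq_of_lt hgQ]

end SimParams

/-! ### Reading, measuring and uncomputing registers -/

theorem modAdd_zero {M v : ℕ} (h : v < M) : modAdd M v 0 = v := by
  rw [modAdd, if_pos (by omega), zero_add, Nat.mod_eq_of_lt h]

theorem modAdd_neg {M v : ℕ} (h : v < M) : modAdd M ((M - v) % M) v = 0 := by
  rw [modAdd, if_pos h, Nat.add_mod_mod, show v + (M - v) = M by omega, Nat.mod_self]

theorem modAdd_neg' {M v : ℕ} (h : v < M) : modAdd M v ((M - v) % M) = 0 := by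
  rw [modAdd, if_pos (Nat.mod_lt _ (by omega)), Nat.mod_add_mod, show M - v + v = M by omega,
    Nat.mod_self]

/-- Content of the quantum memory during the evaluation of the hash function. -/
def qmem (a b c : ℕ) (g : ℕ → ℕ) (k : ℕ) : ℕ → ℕ := fun x =>
  if x = 0 then a else if x = 1 then b else if x = 2 then c else if x < 4 then 0
  else if x ≤ 4 + k then g (x - 4) else 0

namespace Prog

open SimParams

variable {σ : Type*} [Fintype σ] {B : BlackBox σ} {m : ℕ → ℕ} {β : ℕ}

theorem Step.cast {P : Prog} {m' m'' : ℕ → ℕ} {ψ ψ' ψ'' : JointState σ} {T : ℕ}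
    (h : Step B P m ψ m' ψ' T) (hm : m' = m'') (hψ : ψ' = ψ'') : Step B P m ψ m'' ψ'' T := by
  subst hm hψ; exact h

/-- Registers can only be added to a cell, never subtracted. So the negative of cell a is prepared
in the scratch cell 3 and added to cell a, which becomes 0; reading the register into cell 3 then
clears that cell too. -/
theorem step_unread (hβ : 1 ≤ β) (hm : ∀ a, m a < 2 ^ β) {r : Reg} (hr : r.Small (2 ^ β))
    (hn : r.nodes ≤ 200) {R a : ℕ} (hR : R < 2 ^ β) (ha : a < 2 ^ β) (ha3 : a ≠ 3)
    (h3 : 3 < 2 ^ β) (hRr : B.range m r = R) (hc : ∀ s, B.content m r s < R) (w : σ → ℕ → ℕ)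
    (hw : ∀ s, w s a = B.content m r s) (hw3 : ∀ s, w s 3 = 0) (φ : σ → ℂ) :
    Step B (unread r R a) m (emb w φ) m (emb (fun s => Function.update (w s) a 0) φ)
      (3 * tau β) := by
  -- Without basis states R could be 0 and the modular identities could fail, but then all states
  -- coincide.
  by_cases hσ : IsEmpty σ
  · have h0 : ∀ w w' : σ → ℕ → ℕ, emb w φ = emb w' φ := fun w w' => by
      rw [Subsingleton.elim w w']
    have s1 := step_addTo (B := B) (a := .lit 3) (M := .lit R) (f := negExpr (.lit R) (.cell (.lit a)))
      hβ hm h3 (by simp [CExpr.nodes]) hR (by simp [CExpr.nodes]) hR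
      (by simp only [QExpr.Small, CExpr.Small]; omega) (by simp [QExpr.nodes, CExpr.nodes]) w φ
    have s2 := step_addTo (B := B) (a := .lit a) (M := .lit R) (f := .cell (.lit 3))
      hβ hm ha (by simp [CExpr.nodes]) hR (by simp [CExpr.nodes]) hR
      h3 (by simp [QExpr.nodes, CExpr.nodes]) w φ
    have s3 := step_read (B := B) (r := r) (a := .lit 3) hβ hm h3 (by simp [CExpr.nodes])
      hr hn (by omega) w φ
    exact ((s1.cast rfl (h0 _ w)).seq ((s2.cast rfl (h0 _ w)).seq (s3.cast rfl (h0 _ _)))).mono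
      (by omega)
  rw [not_isEmpty_iff] at hσ
  obtain ⟨s0⟩ := hσ
  have hR0 : 0 < R := by have := hc s0; omega
  have s1 := step_addTo (B := B) (a := .lit 3) (M := .lit R) (f := negExpr (.lit R) (.cell (.lit a)))
    hβ hm h3 (by simp [CExpr.nodes]) hR (by simp [CExpr.nodes]) hR
    (by simp only [QExpr.Small, CExpr.Small]; omega) (by simp [QExpr.nodes, CExpr.nodes]) w φ
  have e1 : ∀ s, modAdd R ((negExpr (.lit R) (.cell (.lit a))).eval R m
      (Function.update (w s) 3 0)) (w s 3) = (R - w s a) % R := by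
    intro s
    rw [eval_negExpr (M := R) (R := .lit R) m _ rfl hR0, hw3, modAdd_zero (Nat.mod_lt _ hR0)]
    simp only [QExpr.eval, CExpr.eval, Function.update_of_ne ha3]
    rw [Nat.mod_eq_of_lt (a := w s a) (by rw [hw]; exact hc s)]
  simp only [CExpr.eval, e1] at s1
  have s2 := step_addTo (B := B) (a := .lit a) (M := .lit R) (f := .cell (.lit 3))
    hβ hm ha (by simp [CExpr.nodes]) hR (by simp [CExpr.nodes]) hR
    h3 (by simp [QExpr.nodes, CExpr.nodes])
    (fun s => Function.update (w s) 3 ((R - w s a) % R)) φ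
  have e2 : ∀ s, modAdd R ((QExpr.cell (.lit 3)).eval R m
      (Function.update (Function.update (w s) 3 ((R - w s a) % R)) a 0))
      (Function.update (w s) 3 ((R - w s a) % R) a) = 0 := by
    intro s
    simp only [QExpr.eval, CExpr.eval, Function.update_of_ne ha3, Function.update_of_ne ha3.symm,
      Function.update_self, Nat.mod_mod]
    exact modAdd_neg (by rw [hw]; exact hc s)
  simp only [CExpr.eval, e2] at s2
  have s3 := step_read (B := B) (r := r) (a := .lit 3) hβ hm h3 (by simp [CExpr.nodes])
    hr hn (by omega)
    (fun s => Function.update (Function.update (w s) 3 ((R - w s a) % R)) a 0) φ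
  refine (s1.seq (s2.seq (s3.cast rfl ?_))).mono (by omega)
  congr 1
  ext s x
  simp only [CExpr.eval, Function.update_of_ne ha3.symm, Function.update_self, hRr]
  rw [hw, modAdd_neg' (hc s)]
  by_cases hx3 : x = 3
  · subst hx3; simp [ha3.symm, hw3]
  · by_cases hxa : x = a
    · subst hxa; simp [ha3]
    · simp [hx3, hxa]

section Grab

variable {r : Reg} {R a : ℕ}

/-- Restriction to the basis states where register `r` has content `v`. -/
noncomputable def restr (B : BlackBox σ) (m : ℕ → ℕ) (r : Reg) (v : ℕ) (φ : σ → ℂ) : σ → ℂ :=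
  fun s => if B.content m r s = v then φ s else 0

theorem step_read_zero (hβ : 1 ≤ β) (hm : ∀ a, m a < 2 ^ β) (hr : r.Small (2 ^ β))
    (hn : r.nodes ≤ 200) (hR : R < 2 ^ β) (hRr : B.range m r = R)
    (hc : ∀ s, B.content m r s < R) (h4 : 4 < 2 ^ β) (φ : σ → ℂ) :
    Step B (read r (.lit 1)) m (emb (fun _ => 0) φ) m
      (emb (fun s => Function.update 0 1 (B.content m r s)) φ) (tau β) := by
  refine (step_read hβ hm (by simp only [CExpr.Small]; omega) (by simp [CExpr.nodes]) hr hn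
    (by omega) _ φ).cast rfl ?_
  simp only [CExpr.eval, Pi.zero_apply, hRr, modAdd_zero (hc _)]

theorem step_unread_grab (hβ : 1 ≤ β) (hm : ∀ a, m a < 2 ^ β) (hr : r.Small (2 ^ β))
    (hn : r.nodes ≤ 200) (hR : R < 2 ^ β) (hRr : ∀ v, B.range (Function.update m a v) r = R)
    (hcc : ∀ v s, B.content (Function.update m a v) r s = B.content m r s)
    (hc : ∀ s, B.content m r s < R) (h4 : 4 < 2 ^ β) (φ : σ → ℂ) (v : ℕ) (hv : v < 2 ^ β) :
    Step B (unread r R 1) (Function.update m a v)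
      (emb (fun s => Function.update 0 1 (B.content m r s))
        (fun s => if Function.update (0 : ℕ → ℕ) 1 (B.content m r s)
          ((CExpr.lit 1).eval m) = v then φ s else 0))
      (Function.update m a v) (emb (fun _ => 0) (restr B m r v φ)) (3 * tau β) := by
  refine (step_unread hβ ?_ hr hn hR (by omega) (by omega) (by omega) (hRr v) ?_ _ ?_ ?_ _).cast
    rfl ?_
  · intro b
    by_cases hb : b = a
    · subst hb; simpa using hv
    · simpa [hb] using hm b
  · intro s; rw [hcc]; exact hc s
  · intro s; rw [hcc]; simp
  · intro s; simp
  · congr 1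
    · ext s x
      simp only [Function.update_idem]
      by_cases hx : x = 1 <;> simp [hx]

theorem all_grab (hβ : 1 ≤ β) (hm : ∀ a, m a < 2 ^ β) (hr : r.Small (2 ^ β))
    (hn : r.nodes ≤ 200) (hR : R < 2 ^ β) (hRr : B.range m r = R)
    (hRr' : ∀ v, B.range (Function.update m a v) r = R)
    (hcc : ∀ v s, B.content (Function.update m a v) r s = B.content m r s)
    (hc : ∀ s, B.content m r s < R) (h4 : 4 < 2 ^ β) (ha : a < 2 ^ β) (φ : σ → ℂ) :
    All B (grab r R a) m (emb (fun _ => 0) φ) (5 * tau β) fun m' ψ' => ∃ v < R,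
      m' = Function.update m a v ∧ ∃ φ', ψ' = emb (fun _ => 0) φ' := by
  have h1 := (step_read_zero hβ hm hr hn hR hRr hc h4 φ)
  refine All.mono (All.seq (h1.all (post := fun m' ψ' => m' = m ∧ ψ' = _) ⟨rfl, rfl⟩) ?_
    (T' := 4 * tau β)) (by omega) (fun _ _ h => h)
  rintro _ _ ⟨rfl, rfl⟩
  refine All.mono (All.seq (all_measure (a := .lit a) (b := .lit 1) hβ hm ha (by simp [CExpr.nodes])
    (by simp only [CExpr.Small]; omega)
    (by simp [CExpr.nodes]) _ φ hR.le (fun s => by simpa [CExpr.eval] using hc s)) ?_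
    (T' := 3 * tau β)) (by omega) (fun _ _ h => h)
  rintro _ _ ⟨v, hv, rfl, rfl⟩
  exact (step_unread_grab hβ hm hr hn hR hRr' hcc hc h4 φ v (hv.trans hR)).all
    ⟨v, hv, rfl, _, rfl⟩

/-- Copying the register, measuring the copy and uncomputing it amounts to projecting the black box,
with an empty memory before and after. -/
theorem lb_grab {K : Branch σ → ℝ} (hK : ∀ c, 0 ≤ K c) (hβ : 1 ≤ β) (hm : ∀ a, m a < 2 ^ β)
    (hr : r.Small (2 ^ β))
    (hn : r.nodes ≤ 200) (hR : R < 2 ^ β) (hRr : B.range m r = R)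
    (hRr' : ∀ v, B.range (Function.update m a v) r = R)
    (hcc : ∀ v s, B.content (Function.update m a v) r s = B.content m r s)
    (hc : ∀ s, B.content m r s < R) (h4 : 4 < 2 ^ β) (φ : σ → ℂ) (v : ℕ)
    (hv : v < 2 ^ β) {z : ℝ}
    (h : LB K (Function.update m a v) (emb (fun _ => 0) (restr B m r v φ)) z)
    (h0 : restr B m r v φ = 0 → z ≤ 0) :
    LB (val B K (grab r R a)) m (emb (fun _ => 0) φ) z := by
  refine LB.seq ((step_read_zero hβ hm hr hn hR hRr hc h4 φ).lb (LB.seq ?_))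
  refine lb_measure (fun c => val_nonneg hK c) _ _ v ?_ ?_
  · exact (step_unread_grab hβ hm hr hn hR hRr' hcc hc h4 φ v hv).lb h
  · intro hs
    apply h0
    ext s
    simp only [restr, Pi.zero_apply]
    split_ifs with h1
    · exact hs s (by simpa [CExpr.eval] using h1)
    · rfl

end Grab

end Prog

theorem qmem_fwd (a b c : ℕ) (g : ℕ → ℕ) (k : ℕ) :
    Function.update (qmem a b c g k) (5 + k) (g (k + 1)) = qmem a b c g (k + 1) := by
  ext x
  simp only [Function.update_apply, qmem]
  split_ifs <;> first | rfl | omega | skip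
  congr 1; omega

theorem qmem_bwd (a b c : ℕ) (g : ℕ → ℕ) (k : ℕ) :
    Function.update (qmem a b c g (k + 1)) (5 + k) 0 = qmem a b c g k := by
  ext x
  simp only [Function.update_apply, qmem]
  split_ifs <;> first | rfl | omega

theorem qmem_out (a b c : ℕ) (g : ℕ → ℕ) (k : ℕ) : qmem a b c g k (5 + k) = 0 := by
  simp only [qmem]
  split_ifs <;> first | rfl | omega

theorem qmem_top (a b c : ℕ) (g : ℕ → ℕ) (k : ℕ) : qmem a b c g k (4 + k) = g k := by
  simp only [qmem]
  split_ifs <;> first | omega | skip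
  congr 1; omega

namespace SimParams

/-- The memory allows the evaluation of the hash function. -/
structure Ready (P : SimParams) (β : ℕ) (m : ℕ → ℕ) : Prop where
  one_le : 1 ≤ β
  fits : P.Fits (2 ^ β)
  bd : ∀ a, m a < 2 ^ β
  two_le : 2 ≤ m 4
  num_lt : P.cL * P.cX ≤ m 4
  cY_lt : P.cY < m 4
  cY_pos : 0 < P.cY
  len : 2 * m 3 + m 6 + 8 < 2 ^ β

/-- Only the query number (cell 3), the modulus (cell 4) and the number of recorded answers (cell 6)
enter the conditions other than the bit length. -/
theorem Ready.update {P : SimParams} {β : ℕ} {m : ℕ → ℕ} (h : P.Ready β m) {k v : ℕ}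
    (hv : v < 2 ^ β) (h3 : k ≠ 3) (h4 : k ≠ 4) (h6 : k ≠ 6) :
    P.Ready β (Function.update m k v) where
  one_le := h.one_le
  fits := h.fits
  bd a := by
    by_cases ha : a = k
    · subst ha; simpa using hv
    · simpa [ha] using h.bd a
  two_le := by rw [Function.update_of_ne h4.symm]; exact h.two_le
  num_lt := by rw [Function.update_of_ne h4.symm]; exact h.num_lt
  cY_lt := by rw [Function.update_of_ne h4.symm]; exact h.cY_lt
  cY_pos := h.cY_pos
  len := by
    rw [Function.update_of_ne h3.symm, Function.update_of_ne h6.symm]; exact h.len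

theorem chainVal_update (m : ℕ → ℕ) {k : ℕ} (hk : k < 16) (h3 : k ≠ 3) (h4 : k ≠ 4) (x v j : ℕ) :
    chainVal (Function.update m k x) v j = chainVal m v j := by
  refine chainVal_congr ?_ ?_ v j fun i _ k' _ => ?_
  · rw [Function.update_of_ne h3.symm]
  · rw [Function.update_of_ne h4.symm]
  · rw [Function.update_of_ne (by omega)]

theorem hashVal_update (P : SimParams) (m : ℕ → ℕ) {k : ℕ} (hk : k < 16) (h3 : k ≠ 3)
    (h4 : k ≠ 4) (h6 : k ≠ 6) (x v : ℕ) :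
    P.hashVal (Function.update m k x) v = P.hashVal m v := by
  rw [hashVal, hashVal, chainVal_update m hk h3 h4, Function.update_of_ne h3.symm,
    Function.update_of_ne h6.symm]

end SimParams

namespace Prog

open SimParams

variable {σ : Type*} [Fintype σ] {B : BlackBox σ} {m : ℕ → ℕ} {β : ℕ} {P : SimParams}

/-- Each new value of the evaluation goes to the fresh cell 5 + k and the old ones are kept, so the
evaluation is reversible. -/
theorem step_forward (h : P.Ready β m) {k : ℕ} (hk : k < 2 * m 3 + m 6) (c l r : σ → ℕ)
    (hv : ∀ s, l s * P.cX + r s < m 4) (φ : σ → ℂ) :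
    Step B P.forward (Function.update m 10 k)
      (emb (fun s => qmem (c s) (l s) (r s) (chainVal m (l s * P.cX + r s)) k) φ)
      (Function.update m 10 (k + 1))
      (emb (fun s => qmem (c s) (l s) (r s) (chainVal m (l s * P.cX + r s)) (k + 1)) φ)
      (2 * tau β) := by
  have hlen := h.len
  have hc := h.fits
  have hcX := hc.cX_lt
  have hcc := hc.const
  have h' := h.update (k := 10) (v := k) (by omega) (by omega) (by omega) (by omega)
  have s1 := step_addTo (B := B) (a := .bin .add (.lit 5) (var 10)) (M := var 4) (f := P.stepExpr)
    h.one_le h'.bd (by simp only [CExpr.Small]; omega) (by simp [CExpr.nodes])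
    (by simp only [CExpr.Small]; omega) (by simp [CExpr.nodes]) (h'.bd 4)
    (by simp only [QExpr.Small, CExpr.Small]; omega) (by simp [QExpr.nodes, CExpr.nodes])
    (fun s => qmem (c s) (l s) (r s) (chainVal m (l s * P.cX + r s)) k) φ
  have s2 := step_assign (B := B) (m := Function.update m 10 k) (a := .lit 10)
    (e := .bin .add (var 10) (.lit 1))
    (ψ := emb (fun s => qmem (c s) (l s) (r s) (chainVal m (l s * P.cX + r s)) (k + 1)) φ)
    h.one_le h'.bd (by simp only [CExpr.Small]; omega) (by simp [CExpr.nodes])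
    (by simp only [CExpr.Small]; omega) (by simp [CExpr.nodes])
  refine ((s1.cast rfl ?_).seq (s2.cast ?_ rfl)).mono (by omega)
  · congr 1
    ext1 s
    have e4 : (var 4).eval (Function.update m 10 k) = m 4 := by simp [CExpr.eval]
    have e10 : (CExpr.bin .add (.lit 5) (var 10)).eval (Function.update m 10 k) = 5 + k := by
      simp [CExpr.eval, ArithOp.apply]
    have e44 : Function.update m 10 k 4 = m 4 := by simp
    have hQ : 0 < m 4 := by have := h.two_le; omega
    rw [e4, e10, qmem_out]
    have := eval_stepExpr P (m := Function.update m 10 k) (j := k)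
      (w := Function.update (qmem (c s) (l s) (r s) (chainVal m (l s * P.cX + r s)) k) (5 + k) 0)
      (v := l s * P.cX + r s) (g := chainVal m (l s * P.cX + r s) k)
      (by rw [e44]; exact h.two_le) (by simp)
      (by rw [Function.update_of_ne (by omega), Function.update_of_ne (by omega)]; simp [qmem])
      (by rw [e44]; exact hv s)
      (by rw [Function.update_of_ne (by omega), qmem_top])
      (by rw [e44]; exact chainVal_lt hQ _ _)
    rw [e44] at this
    have e5 : stepVal (Function.update m 10 k) (l s * P.cX + r s) k
        (chainVal m (l s * P.cX + r s) k) = chainVal m (l s * P.cX + r s) (k + 1) := by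
      rw [← chainVal_update m (k := 10) (by omega) (by omega) (by omega) k, ← chainVal,
        chainVal_update m (by omega) (by omega) (by omega)]
    rw [this, e5, modAdd_zero (chainVal_lt hQ _ _), qmem_fwd]
  · simp [CExpr.eval, ArithOp.apply]

theorem step_backward (h : P.Ready β m) {k : ℕ} (hk : k < 2 * m 3 + m 6) (c l r : σ → ℕ)
    (hv : ∀ s, l s * P.cX + r s < m 4) (φ : σ → ℂ) :
    Step B P.backward (Function.update m 10 (k + 1))
      (emb (fun s => qmem (c s) (l s) (r s) (chainVal m (l s * P.cX + r s)) (k + 1)) φ)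
      (Function.update m 10 k)
      (emb (fun s => qmem (c s) (l s) (r s) (chainVal m (l s * P.cX + r s)) k) φ)
      (2 * tau β) := by
  have hlen := h.len
  have hc := h.fits
  have hcX := hc.cX_lt
  have hcc := hc.const
  have h' := h.update (k := 10) (v := k) (by omega) (by omega) (by omega) (by omega)
  have h'' := h.update (k := 10) (v := k + 1) (by omega) (by omega) (by omega) (by omega)
  have s1 := step_addTo (B := B) (a := .bin .add (.lit 5) (var 10)) (M := var 4)
    (f := negExpr (var 4) P.stepExpr)
    h.one_le h'.bd (by simp only [CExpr.Small]; omega) (by simp [CExpr.nodes])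
    (by simp only [CExpr.Small]; omega) (by simp [CExpr.nodes]) (h'.bd 4)
    (by simp only [QExpr.Small, CExpr.Small]; omega) (by simp [QExpr.nodes, CExpr.nodes])
    (fun s => qmem (c s) (l s) (r s) (chainVal m (l s * P.cX + r s)) (k + 1)) φ
  have s2 := step_assign (B := B) (m := Function.update m 10 (k + 1)) (a := .lit 10)
    (e := .bin .sub (var 10) (.lit 1))
    (ψ := emb (fun s => qmem (c s) (l s) (r s) (chainVal m (l s * P.cX + r s)) (k + 1)) φ)
    h.one_le h''.bd (by simp only [CExpr.Small]; omega) (by simp [CExpr.nodes])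
    (by simp only [CExpr.Small]; omega) (by simp [CExpr.nodes])
  refine ((s2.cast (m'' := Function.update m 10 k) ?_ rfl).seq (s1.cast rfl ?_)).mono (by omega)
  · simp [CExpr.eval, ArithOp.apply]
  · congr 1
    ext1 s
    have e4 : (var 4).eval (Function.update m 10 k) = m 4 := by simp [CExpr.eval]
    have e10 : (CExpr.bin .add (.lit 5) (var 10)).eval (Function.update m 10 k) = 5 + k := by
      simp [CExpr.eval, ArithOp.apply]
    have e44 : Function.update m 10 k 4 = m 4 := by simp
    have hQ : 0 < m 4 := by have := h.two_le; omega
    rw [e4, e10, qmem_bwd, eval_negExpr _ _ e4 hQ]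
    have := eval_stepExpr P (m := Function.update m 10 k) (j := k)
      (w := qmem (c s) (l s) (r s) (chainVal m (l s * P.cX + r s)) k)
      (v := l s * P.cX + r s) (g := chainVal m (l s * P.cX + r s) k)
      (by rw [e44]; exact h.two_le) (by simp) (by simp [qmem])
      (by rw [e44]; exact hv s) (by rw [qmem_top])
      (by rw [e44]; exact chainVal_lt hQ _ _)
    rw [e44] at this
    have e5 : stepVal (Function.update m 10 k) (l s * P.cX + r s) k
        (chainVal m (l s * P.cX + r s) k) = chainVal m (l s * P.cX + r s) (k + 1) := by
      rw [← chainVal_update m (k := 10) (by omega) (by omega) (by omega) k, ← chainVal,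
        chainVal_update m (by omega) (by omega) (by omega)]
    have e6 := qmem_top (c s) (l s) (r s) (chainVal m (l s * P.cX + r s)) (k + 1)
    rw [show 4 + (k + 1) = 5 + k by ring] at e6
    rw [this, e5, e6, modAdd_neg (chainVal_lt hQ _ _), qmem_bwd]

end Prog

/-! ### Answering the queries of the black box -/

section Box

open SimParams Prog

variable {U X : Type*} [DecidableEq U] [Fintype X] {X₀ Y : Finset U} {n : ℕ}
  (N : HashNumbering X X₀ Y)

/-- The number of a hash input. -/
def HashNumbering.num (d : ↥(X₀ ∪ Y) × X) : ℕ := N.left d.1 * Fintype.card X + N.right d.2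

theorem HashNumbering.num_lt (d : ↥(X₀ ∪ Y) × X) :
    N.num d < (X₀ ∪ Y).card * Fintype.card X := by
  have h1 : ((N.left d.1 : ℕ) + 1) * Fintype.card X ≤ (X₀ ∪ Y).card * Fintype.card X :=
    Nat.mul_le_mul_right _ (N.left d.1).2
  have h2 := (N.right d.2).2
  unfold num
  nlinarith

theorem HashNumbering.num_injective : Function.Injective N.num := by
  intro d d' h
  have hd := (N.right d.2).2
  have hd' := (N.right d'.2).2
  have hpos : 0 < Fintype.card X := by omega
  unfold num at h
  have h1 : (N.left d.1 : ℕ) = N.left d'.1 := by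
    have := congrArg (· / Fintype.card X) h
    simpa [mul_comm _ (Fintype.card X), Nat.mul_add_div hpos, Nat.div_eq_of_lt hd,
      Nat.div_eq_of_lt hd'] using this
  have h2 : (N.right d.2 : ℕ) = N.right d'.2 := by rw [h1] at h; omega
  exact Prod.ext (N.left.injective (Fin.ext h1)) (N.right.injective (Fin.ext h2))

theorem HashNumbering.ofY_lt (y : Y) : N.ofY y < Y.card := (N.left_lt _).2 y.2

theorem HashNumbering.ofY_injective : Function.Injective N.ofY := by
  intro y y' h
  have h1 := N.left.injective (Fin.ext h)
  ext
  simpa [leftOfY] using h1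

theorem HashNumbering.toY_ofY [Zero Y] (y : Y) : N.toY (N.ofY y) = y := by
  have h : ∃ y', N.ofY y' = N.ofY y := ⟨y, rfl⟩
  rw [toY, dif_pos h]
  exact N.ofY_injective h.choose_spec

variable {σ R Z E : Type*} [Fintype σ] [DecidableEq σ] {q : ℕ} [AddCommGroup Y]
  (A : OracleAlg (↥(X₀ ∪ Y) × X) Y (X₀ × (Fin n → X)) σ R Z E q)

/-- The parameters of the simulator belong to the sets. -/
structure HashNumbering.Params (_ : HashNumbering X X₀ Y) (P : SimParams) : Prop where
  cL_eq : P.cL = (X₀ ∪ Y).card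
  cX_eq : P.cX = Fintype.card X
  cY_eq : P.cY = Y.card

variable {N} {P : SimParams} {m : ℕ → ℕ} {β : ℕ}

/-- The hash function that the simulator uses when its memory is `m`. -/
noncomputable def HashNumbering.hashFun (N : HashNumbering X X₀ Y) (P : SimParams) (m : ℕ → ℕ)
    (d : ↥(X₀ ∪ Y) × X) : Y := N.toY (P.hashVal m (N.num d))

theorem HashNumbering.hashFun_update (m : ℕ → ℕ) {k : ℕ} (hk : k < 16) (h3 : k ≠ 3)
    (h4 : k ≠ 4) (h6 : k ≠ 6) (x : ℕ) :
    N.hashFun P (Function.update m k x) = N.hashFun P m := by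
  ext1 d
  rw [hashFun, hashFun, P.hashVal_update m hk h3 h4 h6]

/-- Compute the hash value reversibly, add it to the answer register under the control bit, and
uncompute. The memory ends empty, so the net effect is exactly a query to `hashFun`. -/
theorem step_query (hP : N.Params P) (h : P.Ready β m) (φ : σ → ℂ) :
    Step (A.blackBox N) P.query m (emb (fun _ => 0) φ) (Function.update m 10 0)
      (emb (fun _ => 0) ((A.query (N.hashFun P m)).mulVec φ))
      (20 * tau β + 2 * ((2 * m 3 + m 6) * (2 * tau β + 1))) := by
  have hlen := h.len
  have hfit := h.fits
  have hcX := hfit.cX_lt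
  have hcY := hfit.cY_lt
  have hcL := hfit.cL_lt
  have hcc := hfit.const
  have hβ := h.one_le
  have hQ : 0 < m 4 := by have := h.two_le; omega
  have h' := h.update (k := 10) (v := 0) (by omega) (by omega) (by omega) (by omega)
  set L := 2 * m 3 + m 6 with hL
  set c : σ → ℕ := fun s => (A.queryReg s).1.toNat with hc
  set l : σ → ℕ := fun s => N.left (A.queryReg s).2.1.1 with hl
  set r : σ → ℕ := fun s => N.right (A.queryReg s).2.1.2 with hr
  set g : σ → ℕ → ℕ := fun s => chainVal m (l s * P.cX + r s) with hg
  have hnum : ∀ s, l s * P.cX + r s = N.num (A.queryReg s).2.1 := fun s => by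
    rw [HashNumbering.num, hP.cX_eq]
  have hv : ∀ s, l s * P.cX + r s < m 4 := fun s => by
    rw [hnum]
    refine (N.num_lt _).trans_le ?_
    rw [← hP.cL_eq, ← hP.cX_eq]
    exact h.num_lt
  have hg0 : ∀ s, g s 0 = 0 := fun s => rfl
  have hc2 : ∀ s, c s < 2 := fun s => by simp only [hc]; cases (A.queryReg s).1 <;> simp
  have hl2 : ∀ s, l s < P.cL := fun s => by rw [hP.cL_eq]; exact Fin.is_lt _
  have hr2 : ∀ s, r s < P.cX := fun s => by rw [hP.cX_eq]; exact Fin.is_lt _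
  have rctrl : ∀ m, (A.blackBox N).range m .ctrl = 2 := fun _ => rfl
  have rleft : ∀ m, (A.blackBox N).range m .left = P.cL := fun _ => hP.cL_eq.symm
  have rright : ∀ m, (A.blackBox N).range m .right = P.cX := fun _ => hP.cX_eq.symm
  have cctrl : ∀ m s, (A.blackBox N).content m .ctrl s = c s := fun _ _ => rfl
  have cleft : ∀ m s, (A.blackBox N).content m .left s = l s := fun _ _ => rfl
  have cright : ∀ m s, (A.blackBox N).content m .right s = r s := fun _ _ => rfl
  have sctrl : Reg.ctrl.Small (2 ^ β) := trivial
  have sleft : Reg.left.Small (2 ^ β) := trivial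
  have sright : Reg.right.Small (2 ^ β) := trivial
  have lit_small : ∀ k < 65, (CExpr.lit k).Small (2 ^ β) := fun k hk => by
    simp only [CExpr.Small]; omega
  have lit_nodes : ∀ k, (CExpr.lit k).nodes ≤ 200 := fun k => by simp [CExpr.nodes]
  have s1 : Step (A.blackBox N) (.read .ctrl (.lit 0)) m (emb (fun _ => 0) φ) m
      (emb (fun s => qmem (c s) 0 0 (g s) 0) φ) (tau β) := by
    refine (step_read hβ h.bd (lit_small 0 (by omega)) (lit_nodes _) sctrl (by simp [Reg.nodes])
      (by rw [rctrl]; omega) _ φ).cast rfl ?_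
    congr 1
    ext s x
    simp only [CExpr.eval, rctrl, cctrl, Pi.zero_apply]
    rw [modAdd_zero (hc2 s)]
    simp only [Function.update_apply, qmem, Pi.zero_apply]
    split_ifs <;> first | rfl | omega | (rw [show x - 4 = 0 by omega, hg0])
  have s2 : Step (A.blackBox N) (.read .left (.lit 1)) m (emb (fun s => qmem (c s) 0 0 (g s) 0) φ) m
      (emb (fun s => qmem (c s) (l s) 0 (g s) 0) φ) (tau β) := by
    refine (step_read hβ h.bd (lit_small 1 (by omega)) (lit_nodes _) sleft (by simp [Reg.nodes])
      (by rw [rleft]; omega) _ φ).cast rfl ?_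
    congr 1
    ext s x
    simp only [CExpr.eval, rleft, cleft]
    rw [show qmem (c s) 0 0 (g s) 0 1 = 0 from rfl, modAdd_zero (hl2 s)]
    simp only [Function.update_apply, qmem]
    split_ifs <;> first | rfl | omega
  have s3 : Step (A.blackBox N) (.read .right (.lit 2)) m
      (emb (fun s => qmem (c s) (l s) 0 (g s) 0) φ) m
      (emb (fun s => qmem (c s) (l s) (r s) (g s) 0) φ) (tau β) := by
    refine (step_read hβ h.bd (lit_small 2 (by omega)) (lit_nodes _) sright (by simp [Reg.nodes])
      (by rw [rright]; omega) _ φ).cast rfl ?_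
    congr 1
    ext s x
    simp only [CExpr.eval, rright, cright]
    rw [show qmem (c s) (l s) 0 (g s) 0 2 = 0 from rfl, modAdd_zero (hr2 s)]
    simp only [Function.update_apply, qmem]
    split_ifs <;> first | rfl | omega
  have s4 : Step (A.blackBox N) (.assign (.lit 10) (.lit 0)) m
      (emb (fun s => qmem (c s) (l s) (r s) (g s) 0) φ) (Function.update m 10 0)
      (emb (fun s => qmem (c s) (l s) (r s) (g s) 0) φ) (tau β) :=
    step_assign hβ h.bd (lit_small 10 (by omega)) (lit_nodes _) (lit_small 0 (by omega))
      (lit_nodes _)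
  have elen : ∀ k, chainLen.eval (Function.update m 10 k) = L := fun k => by
    simp [CExpr.eval, ArithOp.apply, hL]
  have slen : chainLen.Small (2 ^ β) := by simp only [CExpr.Small]; omega
  have hbd : ∀ a, Function.update m 10 L a < 2 ^ β :=
    (h.update (k := 10) (v := L) (by omega) (by omega) (by omega) (by omega)).bd
  have s5 : Step (A.blackBox N) (.loop chainLen P.forward) (Function.update m 10 0)
      (emb (fun s => qmem (c s) (l s) (r s) (g s) 0) φ) (Function.update m 10 L)
      (emb (fun s => qmem (c s) (l s) (r s) (g s) L) φ) (tau β + L * (2 * tau β + 1)) :=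
    Step.loop hβ h'.bd slen (by simp [CExpr.nodes]) (fun k => Function.update m 10 k)
      (fun k => emb (fun s => qmem (c s) (l s) (r s) (g s) k) φ) L (elen 0) rfl rfl
      fun k hk => step_forward h hk c l r hv φ
  set a : σ → ℕ := fun s => g s L % P.cY with ha
  have haQ : ∀ s, a s < m 4 := fun s => (Nat.mod_lt _ h.cY_pos).trans h.cY_lt
  set w : σ → ℕ → ℕ := fun s => Function.update (qmem (c s) (l s) (r s) (g s) L) (5 + L) (a s)
    with hw
  have e5 : (CExpr.bin .add (.lit 5) chainLen).eval (Function.update m 10 L) = 5 + L := by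
    have := elen L
    simp only [CExpr.eval, ArithOp.apply] at this ⊢
    rw [this]
  have e4 : (var 4).eval (Function.update m 10 L) = m 4 := by simp [CExpr.eval]
  have eans : ∀ s, P.answerExpr.eval (m 4) (Function.update m 10 L)
      (qmem (c s) (l s) (r s) (g s) L) = a s := by
    intro s
    have := elen L
    simp only [QExpr.eval, CExpr.eval, ArithOp.apply] at this ⊢
    rw [this, qmem_top, Nat.mod_eq_of_lt (chainVal_lt hQ _ _), Nat.mod_eq_of_lt h.cY_lt,
      Nat.mod_eq_of_lt (haQ s)]
  have s6 : Step (A.blackBox N) (.addTo (.bin .add (.lit 5) chainLen) (var 4) P.answerExpr)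
      (Function.update m 10 L) (emb (fun s => qmem (c s) (l s) (r s) (g s) L) φ)
      (Function.update m 10 L) (emb w φ) (tau β) := by
    refine (step_addTo hβ hbd (by simp only [CExpr.Small]; omega) (by simp [CExpr.nodes])
      (by simp only [CExpr.Small]; omega) (by simp [CExpr.nodes]) (by rw [e4]; exact h.bd 4)
      (by simp only [QExpr.Small, CExpr.Small]; omega) (by simp [QExpr.nodes, CExpr.nodes])
      _ φ).cast rfl ?_
    congr 1
    ext1 s
    rw [e5, e4, qmem_out]
    have : Function.update (qmem (c s) (l s) (r s) (g s) L) (5 + L) 0 =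
        qmem (c s) (l s) (r s) (g s) L := by
      rw [Function.update_eq_self_iff, qmem_out]
    rw [this, eans, modAdd_zero (haQ s)]
  have hinp : ∀ s, (A.queryReg ((A.queryPerm (N.hashFun P m)).symm s)).2.1 =
      (A.queryReg s).2.1 := A.queryPerm_symm_input _
  -- The response permutes basis states by changing only the answer register, whereas the memory
  -- depends on control bit and input alone; hence `step_respond` applies.
  have s7 : Step (A.blackBox N) (.respond (.lit 0) (.bin .add (.lit 5) chainLen))
      (Function.update m 10 L) (emb w φ)
      (Function.update m 10 L) (emb w ((A.query (N.hashFun P m)).mulVec φ)) (tau β) := by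
    rw [A.query_mulVec]
    refine step_respond hβ hbd (by simp only [CExpr.Small]; omega) (by simp [CExpr.nodes])
      (lit_small 0 (by omega)) (lit_nodes _) ?_ w φ _ ?_ ?_
    · change Y.card < _
      rw [← hP.cY_eq]; exact hcY
    · intro s
      rw [e5]
      have h0 : w s ((CExpr.lit 0).eval (Function.update m 10 L)) = c s := by
        simp only [hw, CExpr.eval]
        rw [Function.update_of_ne (by omega)]; simp [qmem]
      have h1 : w s (5 + L) = P.hashVal m (N.num (A.queryReg s).2.1) := by
        simp only [hw, Function.update_self, ha, hg, hnum]
        rfl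
      rw [h0, h1]
      change A.addAnswer (if (A.queryReg s).1 then N.hashFun P m (A.queryReg s).2.1 else 0) s =
        if c s ≠ 0 then A.addAnswer (N.hashFun P m (A.queryReg s).2.1) s else s
      have hz : A.addAnswer 0 s = s := by simp [OracleAlg.addAnswer]
      cases hb : (A.queryReg s).1
      · have h2 : c s = 0 := by simp [hc, hb]
        rw [if_neg (by simp), if_neg (by simp [h2]), hz]
      · have h2 : c s = 1 := by simp [hc, hb]
        rw [if_pos rfl, if_pos (by simp [h2])]
    · intro s
      have h1 : l ((A.queryPerm (N.hashFun P m)).symm s) = l s := by simp only [hl, hinp]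
      have h2 : r ((A.queryPerm (N.hashFun P m)).symm s) = r s := by simp only [hr, hinp]
      have h3 : c ((A.queryPerm (N.hashFun P m)).symm s) = c s := by
        simp [hc, OracleAlg.queryPerm, OracleAlg.addAnswer]
      simp only [hw, ha, hg, h1, h2, h3]
  set φ' := (A.query (N.hashFun P m)).mulVec φ
  have s8 : Step (A.blackBox N)
      (.addTo (.bin .add (.lit 5) chainLen) (var 4) (negExpr (var 4) P.answerExpr))
      (Function.update m 10 L) (emb w φ')
      (Function.update m 10 L) (emb (fun s => qmem (c s) (l s) (r s) (g s) L) φ') (tau β) := by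
    refine (step_addTo hβ hbd (by simp only [CExpr.Small]; omega) (by simp [CExpr.nodes])
      (by simp only [CExpr.Small]; omega) (by simp [CExpr.nodes]) (by rw [e4]; exact h.bd 4)
      (by simp only [QExpr.Small, CExpr.Small]; omega) (by simp [QExpr.nodes, CExpr.nodes])
      _ φ').cast rfl ?_
    congr 1
    ext1 s
    rw [e5, e4, eval_negExpr _ _ e4 hQ]
    have : Function.update (w s) (5 + L) 0 = qmem (c s) (l s) (r s) (g s) L := by
      simp only [hw, Function.update_idem]
      rw [Function.update_eq_self_iff, qmem_out]
    rw [this, eans, show w s (5 + L) = a s by simp [hw], modAdd_neg (haQ s),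
      Function.update_idem, Function.update_eq_self_iff, qmem_out]
  have s9 : Step (A.blackBox N) (.loop chainLen P.backward) (Function.update m 10 L)
      (emb (fun s => qmem (c s) (l s) (r s) (g s) L) φ') (Function.update m 10 0)
      (emb (fun s => qmem (c s) (l s) (r s) (g s) 0) φ') (tau β + L * (2 * tau β + 1)) := by
    -- The cleaning loop runs backwards: after k iterations L - k values are left.
    refine (Step.loop hβ hbd slen (by simp [CExpr.nodes])
      (fun k => Function.update m 10 (L - k))
      (fun k => emb (fun s => qmem (c s) (l s) (r s) (g s) (L - k)) φ') L (elen L) rfl rfl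
      fun k hk => ?_).cast (by rw [Nat.sub_self]) (by rw [Nat.sub_self])
    obtain ⟨j, hj⟩ : ∃ j, L - k = j + 1 := ⟨L - k - 1, by omega⟩
    simp only [hj, show L - (k + 1) = j by omega]
    exact step_backward h (by omega) c l r hv φ'
  have s10 : Step (A.blackBox N) (unread .ctrl 2 0) (Function.update m 10 0)
      (emb (fun s => qmem (c s) (l s) (r s) (g s) 0) φ') (Function.update m 10 0)
      (emb (fun s => qmem 0 (l s) (r s) (g s) 0) φ') (3 * tau β) := by
    refine (step_unread hβ h'.bd sctrl (by simp [Reg.nodes]) (show 2 < 2 ^ β by omega) (by omega)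
      (by omega) (by omega) (rctrl _) hc2 _ (fun s => rfl) (fun s => rfl) φ').cast rfl ?_
    congr 1
    ext s x
    simp only [Function.update_apply, qmem]
    split_ifs <;> rfl
  have s11 : Step (A.blackBox N) (unread .left P.cL 1) (Function.update m 10 0)
      (emb (fun s => qmem 0 (l s) (r s) (g s) 0) φ') (Function.update m 10 0)
      (emb (fun s => qmem 0 0 (r s) (g s) 0) φ') (3 * tau β) := by
    refine (step_unread hβ h'.bd sleft (by simp [Reg.nodes]) (by omega) (by omega) (by omega)
      (by omega) (rleft _) hl2 _ (fun s => rfl) (fun s => rfl) φ').cast rfl ?_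
    congr 1
    ext s x
    simp only [Function.update_apply, qmem]
    split_ifs <;> rfl
  have s12 : Step (A.blackBox N) (unread .right P.cX 2) (Function.update m 10 0)
      (emb (fun s => qmem 0 0 (r s) (g s) 0) φ') (Function.update m 10 0)
      (emb (fun _ => 0) φ') (3 * tau β) := by
    refine (step_unread hβ h'.bd sright (by simp [Reg.nodes]) (by omega) (by omega) (by omega)
      (by omega) (rright _) hr2 _ (fun s => rfl) (fun s => rfl) φ').cast rfl ?_
    congr 1
    ext s x
    simp only [Function.update_apply, qmem, Pi.zero_apply]
    split_ifs <;> first | rfl | omega | (rw [show x - 4 = 0 by omega, hg0])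
  refine (s1.seq (s2.seq (s3.seq (s4.seq (s5.seq (s6.seq (s7.seq (s8.seq (s9.seq
    (s10.seq (s11.seq s12))))))))))).mono ?_
  omega

theorem step_advance (hP : N.Params P) (h : P.Ready β m) (φ : σ → ℂ) :
    Step (A.blackBox N) P.advance m (emb (fun _ => 0) φ)
      (Function.update (Function.update m 10 0) 5 (m 5 + 1))
      (emb (fun _ => 0) (A.adv (m 5) (N.hashFun P m) φ))
      (22 * tau β + 2 * ((2 * m 3 + m 6) * (2 * tau β + 1))) := by
  have hcc := h.fits.const
  have hβ := h.one_le
  have h' := h.update (k := 10) (v := 0) (by omega) (by omega) (by omega) (by omega)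
  have s1 := step_query A hP h φ
  have s2 := step_call (B := A.blackBox N) (e := var 5) hβ h'.bd (by simp only [CExpr.Small]; omega)
    (by simp [CExpr.nodes]) 0 ((A.query (N.hashFun P m)).mulVec φ)
  have e5 : (var 5).eval (Function.update m 10 0) = m 5 := by simp [CExpr.eval]
  rw [e5] at s2
  have s3 := step_assign (B := A.blackBox N) (m := Function.update m 10 0) (a := .lit 5)
    (e := .bin .add (var 5) (.lit 1))
    (ψ := emb (fun _ => 0) (A.adv (m 5) (N.hashFun P m) φ)) hβ h'.bd
    (by simp only [CExpr.Small]; omega) (by simp [CExpr.nodes])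
    (by simp only [CExpr.Small]; omega) (by simp [CExpr.nodes])
  refine (s1.seq (s2.seq (s3.cast ?_ rfl))).mono (by omega)
  simp [CExpr.eval, ArithOp.apply]

end Box

/-! ### The stages of the simulator and the memory invariant -/

namespace SimParams

/-- Number of answers that are still to be received. -/
abbrev needed (P : SimParams) : CExpr := .bin .sub (.lit P.n) (var 6)

/-- Number of remaining queries. -/
abbrev remaining : CExpr := .bin .sub (var 3) (var 5)

/-- Number of remaining slots. -/
abbrev slots (P : SimParams) : CExpr := .bin .add (.bin .mul (.lit 2) remaining) P.needed

/-- Number of pairs of slots that lead to an extraction of the first kind. -/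
abbrev weight (P : SimParams) : CExpr := .bin .mul P.needed (.bin .mul (.lit 2) remaining)

/-- The largest number of a pair of different slots. -/
abbrev maxPair (P : SimParams) : CExpr :=
  .bin .sub (.bin .mul P.slots (.bin .sub P.slots (.lit 1))) (.lit 1)

/-- Measure the query input. -/
def grabInput (P : SimParams) : Prog := .seq (grab .left P.cL 2) (grab .right P.cX 1)

/-- Handle the next query unless the stage is done. -/
def iteration (P : SimParams) : Prog :=
  .ite (var 8) .skip (.seq (.sample (.lit 9) P.maxPair)
    (.ite (ltExpr (var 9) P.weight)
      (.seq P.grabInput (.seq (.assign (.lit 8) (.lit 1)) (.assign (.lit 7) (.lit 1))))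
      (.ite (ltExpr (var 9) (.bin .mul (.lit 2) P.weight))
        (.seq P.grabInput (.seq (.assign (.lit 8) (.lit 1)) P.advance))
        P.advance)))

/-- Answer the query that was left open by the preceding stage. -/
def pending (P : SimParams) : Prog :=
  .ite (var 7) (.seq P.advance (.assign (.lit 7) (.lit 0))) .skip

/-- Run the black box up to the next extraction. -/
def search (P : SimParams) : Prog :=
  .seq P.pending (.seq (.assign (.lit 8) (.lit 0)) (.loop remaining P.iteration))

/-- If there was no extraction, read the output register. -/
def finish (P : SimParams) : Prog :=
  .ite (var 8) .skip (.seq (grab (.out (.bin .add (.lit 1) (var 6))) P.cX 1)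
    (.ite (var 6) .skip (grab (.out (.lit 0)) P.cL 2)))

/-- Record the extracted input and the received answer. -/
def record (P : SimParams) : Prog :=
  .seq (.assign (arrayAt 17 (var 6))
      (.bin .mod (.bin .add (.bin .mul (var 2) (.lit P.cX)) (var 1)) (var 4)))
    (.seq (.assign (arrayAt 18 (var 6)) (var 0)) (.assign (.lit 6) (.bin .add (var 6) (.lit 1))))

/-- Compute the modulus. -/
def initModulus (P : SimParams) : Prog :=
  .seq (.assign (.lit 4) (.lit 1))
    (.loop (.bin .add (var 3) (.lit (P.n + 3))) (.assign (.lit 4) (.bin .mul (var 4) (.lit P.p))))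

/-- Choose the coefficients of the polynomial. -/
def initCoeffs : Prog :=
  .seq (.assign (.lit 10) (.lit 0))
    (.loop numCoeffs (.seq (.sample (arrayAt 16 (var 10)) (.bin .sub (var 4) (.lit 1)))
      (.assign (.lit 10) (.bin .add (var 10) (.lit 1)))))

/-- The first stage. -/
def firstStage (P : SimParams) : Prog :=
  .seq (.assign (.lit 3) (var 0)) (.seq P.initModulus (.seq initCoeffs (.seq P.search P.finish)))

/-- The other stages but the last one. -/
def midStage (P : SimParams) : Prog := .seq P.record (.seq P.search P.finish)

/-- The last stage. -/
def lastStage (P : SimParams) : Prog := .seq P.record P.search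

/-- The numbers that the simulator uses with `q` queries have at most `β` bits. -/
structure Big (P : SimParams) (β q : ℕ) : Prop where
  sq : (2 * q + P.n) ^ 2 < 2 ^ β
  len : 2 * q + P.n + 16 < 2 ^ β

/-- Invariant of the memory: `s` answers have been recorded. -/
structure Inv (P : SimParams) (β q s : ℕ) (m : ℕ → ℕ) : Prop where
  ready : P.Ready β m
  three : m 3 = q
  six : m 6 = s
  five : m 5 + m 7 ≤ q
  seven : m 7 ≤ 1

/-- Time bound for `advance`. -/
def advTime (P : SimParams) (β q : ℕ) : ℕ :=
  22 * tau β + 2 * ((2 * q + P.n) * (2 * tau β + 1))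

variable {P : SimParams} {β q s : ℕ} {m : ℕ → ℕ}

/-- Layout of the classical memory: 0 message, 1 and 2 output or measured input, 3 number of
queries, 4 modulus, 5 calls made, 6 answers recorded, 7 flag for an open query, 8 flag for a
finished stage, 9 random choice, 10 counter, 16 and beyond the arrays. The invariant constrains
cells 3 to 7 and otherwise only sizes. -/
theorem Inv.update (h : P.Inv β q s m) {k v : ℕ} (hv : v < 2 ^ β)
    (hk : k ∉ ({3, 4, 5, 6, 7} : Finset ℕ)) : P.Inv β q s (Function.update m k v) := by
  simp only [Finset.mem_insert, Finset.mem_singleton, not_or] at hk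
  obtain ⟨h3, h4, h5, h6, h7⟩ := hk
  refine ⟨h.ready.update hv h3 h4 h6, ?_, ?_, ?_, ?_⟩
  · rw [Function.update_of_ne (Ne.symm h3)]; exact h.three
  · rw [Function.update_of_ne (Ne.symm h6)]; exact h.six
  · rw [Function.update_of_ne (Ne.symm h5), Function.update_of_ne (Ne.symm h7)]; exact h.five
  · rw [Function.update_of_ne (Ne.symm h7)]; exact h.seven

theorem Inv.update_six (h : P.Inv β q s m) {v : ℕ} (hb : P.Big β q) (hv : v ≤ P.n) :
    P.Inv β q v (Function.update m 6 v) := by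
  have hlen := hb.len
  refine ⟨⟨h.ready.one_le, h.ready.fits, fun a => ?_, ?_, ?_, ?_, h.ready.cY_pos, ?_⟩,
    ?_, by simp, ?_, ?_⟩
  · by_cases ha : a = 6
    · subst ha; simp; omega
    · simpa [ha] using h.ready.bd a
  · simpa using h.ready.two_le
  · simpa using h.ready.num_lt
  · simpa using h.ready.cY_lt
  · have := h.three
    simp only [Function.update_self, ne_eq, Nat.reduceEqDiff,
      not_false_eq_true, Function.update_of_ne]
    omega
  · simpa using h.three
  · simpa using h.five
  · simpa using h.seven

/-- The two cells are changed together because an open query counts as one whose call is still to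
come: their sum never exceeds q. -/
theorem Inv.update_five_seven (h : P.Inv β q s m) (hb : P.Big β q) {i p : ℕ} (hi : i + p ≤ q)
    (hp : p ≤ 1) : P.Inv β q s (Function.update (Function.update m 5 i) 7 p) := by
  have hlen := hb.len
  have h1 := h.ready.update (k := 5) (v := i) (by omega) (by omega) (by omega) (by omega)
  refine ⟨h1.update (by omega) (by omega) (by omega) (by omega), ?_, ?_, ?_, ?_⟩
  · simpa using h.three
  · simpa using h.six
  · simpa using hi
  · simpa using hp

end SimParams

section Box

open SimParams Prog

variable {U X : Type*} [DecidableEq U] [Fintype X] {X₀ Y : Finset U} {n : ℕ}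
  {N : HashNumbering X X₀ Y} {σ R Z E : Type*} [Fintype σ] [DecidableEq σ] {q : ℕ}
  [AddCommGroup Y] (A : OracleAlg (↥(X₀ ∪ Y) × X) Y (X₀ × (Fin n → X)) σ R Z E q)
  {P : SimParams} {m : ℕ → ℕ} {β s : ℕ}

theorem step_advance_of_inv (hP : N.Params P) (h : P.Inv β q s m) (hs : s ≤ P.n) (φ : σ → ℂ) :
    Step (A.blackBox N) P.advance m (emb (fun _ => 0) φ)
      (Function.update (Function.update m 10 0) 5 (m 5 + 1))
      (emb (fun _ => 0) (A.adv (m 5) (N.hashFun P m) φ)) (P.advTime β q) := by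
  refine (step_advance A hP h.ready φ).mono ?_
  have h1 : (2 * m 3 + m 6) * (2 * tau β + 1) ≤ (2 * q + P.n) * (2 * tau β + 1) := by
    refine Nat.mul_le_mul_right _ ?_
    rw [h.three, h.six]
    omega
  unfold advTime
  omega

theorem Inv.advance (hb : P.Big β q) (h : P.Inv β q s m) (h7 : m 7 = 0) (h5 : m 5 < q) :
    P.Inv β q s (Function.update (Function.update m 10 0) 5 (m 5 + 1)) := by
  have hlen := hb.len
  have h1 := h.update (k := 10) (v := 0) (by omega) (by simp)
  have h2 := h1.update_five_seven hb (i := m 5 + 1) (p := 0) (by omega) (by omega)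
  rwa [Function.update_eq_self_iff.2 (by simpa using h7.symm)] at h2

/-- Assertion that the memory satisfies `I` and that the quantum memory is empty. -/
def Clean (σ : Type*) [Fintype σ] (I : (ℕ → ℕ) → Prop) (m : ℕ → ℕ) (ψ : JointState σ) : Prop :=
  I m ∧ ∃ φ : σ → ℂ, ψ = emb (fun _ => 0) φ

theorem range_left (hP : N.Params P) (m : ℕ → ℕ) : (A.blackBox N).range m .left = P.cL :=
  hP.cL_eq.symm

theorem range_right (hP : N.Params P) (m : ℕ → ℕ) : (A.blackBox N).range m .right = P.cX :=
  hP.cX_eq.symm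

theorem content_left_lt (hP : N.Params P) (m : ℕ → ℕ) (s : σ) :
    (A.blackBox N).content m .left s < P.cL := by
  rw [hP.cL_eq]; exact Fin.is_lt _

theorem content_right_lt (hP : N.Params P) (m : ℕ → ℕ) (s : σ) :
    (A.blackBox N).content m .right s < P.cX := by
  rw [hP.cX_eq]; exact Fin.is_lt _

theorem all_grabInput (hP : N.Params P) (h : P.Inv β q s m) (φ : σ → ℂ) :
    All (A.blackBox N) P.grabInput m (emb (fun _ => 0) φ) (10 * tau β)
      (Clean σ fun m' => ∃ v w, v < 2 ^ β ∧ w < 2 ^ β ∧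
        m' = Function.update (Function.update m 2 v) 1 w) := by
  have hf := h.ready.fits
  have hL := hf.cL_lt
  have hX := hf.cX_lt
  have hc := hf.const
  refine (All.seq (all_grab (r := .left) h.ready.one_le h.ready.bd trivial (by simp [Reg.nodes])
    hL (range_left A hP m) (fun _ => range_left A hP _) (fun _ _ => rfl) (content_left_lt A hP m)
    (by omega) (by omega) φ) (T' := 5 * tau β) ?_).mono (by omega) (fun _ _ h => h)
  rintro _ _ ⟨v, hv, rfl, φ', rfl⟩
  have h' := h.update (k := 2) (v := v) (by omega) (by simp)
  refine (all_grab (r := .right) h.ready.one_le h'.ready.bd trivial (by simp [Reg.nodes])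
    hX (range_right A hP _) (fun _ => range_right A hP _) (fun _ _ => rfl)
    (content_right_lt A hP _) (by omega) (by omega) φ').mono (by omega) ?_
  rintro _ _ ⟨w, hw, rfl, hφ⟩
  exact ⟨⟨v, w, by omega, by omega, rfl⟩, hφ⟩

theorem eval_maxPair_lt (hb : P.Big β q) (h : P.Inv β q s m) : P.maxPair.eval m < 2 ^ β := by
  have h1 : P.slots.eval m ≤ 2 * q + P.n := by
    have := h.three
    simp only [CExpr.eval, ArithOp.apply]
    omega
  have h2 := hb.sq
  have h3 : P.maxPair.eval m = P.slots.eval m * (P.slots.eval m - 1) - 1 := rfl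
  have h4 : P.slots.eval m * (P.slots.eval m - 1) ≤ (2 * q + P.n) * (2 * q + P.n) :=
    Nat.mul_le_mul h1 (by omega)
  rw [h3]
  rw [sq] at h2
  omega

/-- Invariant of the main loop with `k` iterations left. -/
structure LoopInv (P : SimParams) (β q s k : ℕ) (m : ℕ → ℕ) : Prop where
  inv : P.Inv β q s m
  active : m 8 = 0 → m 5 + k = q ∧ m 7 = 0

/-- While the stage is active, the number of iterations left equals the number of queries left, so
the black box is never called too often. After an extraction the remaining iterations are idle and
nothing more is required. -/
theorem all_iteration (hP : N.Params P) (hb : P.Big β q) (hs : s ≤ P.n) {k : ℕ}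
    {ψ : JointState σ} (h : Clean σ (LoopInv P β q s (k + 1)) m ψ) :
    All (A.blackBox N) P.iteration m ψ (20 * tau β + P.advTime β q)
      (Clean σ (LoopInv P β q s k)) := by
  obtain ⟨h, φ, rfl⟩ := h
  have hlen := hb.len
  have hc := h.inv.ready.fits.const
  have hn := h.inv.ready.fits.n_lt
  have hβ := h.inv.ready.one_le
  have hτ : 1 ≤ tau β := by unfold tau; omega
  refine (All.ite (e := var 8) (T := 15 * tau β + P.advTime β q) hβ h.inv.ready.bd
    (by simp only [CExpr.Small]; omega)
    (by simp [CExpr.nodes]) (fun h8 => ?_) (fun h8 => ?_)).mono (by omega) (fun _ _ h => h)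
  · refine (step_skip.all (post := Clean σ (LoopInv P β q s k)) ⟨⟨h.inv, fun h0 => ?_⟩, φ, rfl⟩).mono
      (by omega) (fun _ _ h => h)
    exact absurd h0 h8
  have h8 : m 8 = 0 := h8
  obtain ⟨h5, h7⟩ := h.active h8
  refine (All.seq (all_sample (a := .lit 9) (e := P.maxPair) hβ h.inv.ready.bd
    (by simp only [CExpr.Small]; omega) (by simp [CExpr.nodes])
    (by simp only [CExpr.Small]; omega) (by simp [CExpr.nodes]) (fun _ => 0) φ)
    (T' := 14 * tau β + P.advTime β q) ?_).mono (by omega) (fun _ _ h => h)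
  rintro _ _ ⟨u, hu, rfl, φ1, rfl⟩
  simp only [CExpr.eval] at hu ⊢
  have hu' : u < 2 ^ β := lt_of_le_of_lt hu (eval_maxPair_lt hb h.inv)
  have h1 := h.inv.update (k := 9) hu' (by simp)
  set m1 := Function.update m 9 u with hm1
  have h15 : m1 5 + (k + 1) = q := by simpa [hm1] using h5
  have h17 : m1 7 = 0 := by simpa [hm1] using h7
  have h18 : m1 8 = 0 := by simpa [hm1] using h8
  have hassign : ∀ (m : ℕ → ℕ) ψ x, P.Inv β q s m → x < 65 →
      Step (A.blackBox N) (.assign (.lit x) (.lit 1)) m ψ (Function.update m x 1) ψ (tau β) :=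
    fun m ψ x hm hx => step_assign hβ hm.ready.bd (by simp only [CExpr.Small]; omega)
      (by simp [CExpr.nodes]) (by simp only [CExpr.Small]; omega) (by simp [CExpr.nodes])
  refine (All.ite (e := ltExpr (var 9) P.weight) (T := 13 * tau β + P.advTime β q) hβ h1.ready.bd
    (by simp only [CExpr.Small]; omega)
    (by simp [CExpr.nodes]) (fun _ => ?_) (fun _ => ?_)).mono (by omega) (fun _ _ h => h)
  · refine (All.seq (all_grabInput A hP h1 φ1) (T' := 2 * tau β) ?_).mono (by omega)
      (fun _ _ h => h)
    rintro _ _ ⟨⟨v, w, hv, hw, rfl⟩, φ2, rfl⟩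
    have h2 := ((h1.update (k := 2) hv (by simp)).update (k := 1) hw (by simp))
    set m2 := Function.update (Function.update m1 2 v) 1 w with hm2
    have h3 := h2.update (k := 8) (v := 1) (by omega) (by simp)
    have h25 : m2 5 + (k + 1) = q := by simpa [hm2] using h15
    refine (((hassign m2 _ 8 h2 (by omega)).seq (hassign _ _ 7 h3 (by omega))).all
      (post := Clean σ (LoopInv P β q s k)) ⟨⟨?_, ?_⟩, φ2, rfl⟩).mono (by omega) (fun _ _ h => h)
    · have h4 := h3.update_five_seven hb (i := m2 5) (p := 1) (by omega) (by omega)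
      have h5 : Function.update (Function.update m2 8 1) 5 (m2 5) = Function.update m2 8 1 := by
        rw [Function.update_eq_self_iff]; simp
      rwa [h5] at h4
    · intro h8; simp at h8
  · refine (All.ite (e := ltExpr (var 9) (.bin .mul (.lit 2) P.weight))
      (T := 12 * tau β + P.advTime β q) hβ h1.ready.bd
      (by simp only [CExpr.Small]; omega)
      (by simp [CExpr.nodes]) (fun _ => ?_) (fun _ => ?_)).mono (by omega) (fun _ _ h => h)
    · refine (All.seq (all_grabInput A hP h1 φ1) (T' := tau β + P.advTime β q) ?_).mono (by omega)
        (fun _ _ h => h)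
      rintro _ _ ⟨⟨v, w, hv, hw, rfl⟩, φ2, rfl⟩
      have h2 := ((h1.update (k := 2) hv (by simp)).update (k := 1) hw (by simp))
      set m2 := Function.update (Function.update m1 2 v) 1 w with hm2
      have h3 := h2.update (k := 8) (v := 1) (by omega) (by simp)
      have h35 : (Function.update m2 8 1) 5 + (k + 1) = q := by simpa [hm2] using h15
      have h37 : (Function.update m2 8 1) 7 = 0 := by simpa [hm2] using h17
      refine ((hassign m2 _ 8 h2 (by omega)).seq (step_advance_of_inv A hP h3 hs φ2)).all
        ⟨⟨Inv.advance hb h3 h37 (by omega), ?_⟩, _, rfl⟩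
      intro h8; simp at h8
    · refine ((step_advance_of_inv A hP h1 hs φ1).all
        (post := Clean σ (LoopInv P β q s k))
        ⟨⟨Inv.advance hb h1 h17 (by omega), fun _ => ?_⟩, _, rfl⟩).mono (by omega) (fun _ _ h => h)
      simp only [Function.update_self, ne_eq, Nat.reduceEqDiff,
        not_false_eq_true, Function.update_of_ne]
      omega

end Box

/-! ### Running time -/

theorem Prog.All.loop_desc {σ : Type*} [Fintype σ] {B : BlackBox σ} {β : ℕ} (hβ : 1 ≤ β)
    {m : ℕ → ℕ} {ψ : JointState σ} {P : Prog} {T k : ℕ} {e : CExpr}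
    (hm : ∀ a, m a < 2 ^ β) (hs : e.Small (2 ^ β)) (hn : e.nodes ≤ 200) (hk : e.eval m = k)
    (post : ℕ → (ℕ → ℕ) → JointState σ → Prop) (hi : post k m ψ)
    (h : ∀ j m ψ, post (j + 1) m ψ → All B P m ψ T (post j)) :
    All B (Prog.loop e P) m ψ (tau β + k * (T + 1)) (post 0) := by
  have key : ∀ j t m ψ, post j m ψ → ∀ d ∈ iter B P j ⟨t, m, ψ⟩,
      d.time ≤ t + j * (T + 1) ∧ post 0 d.mem d.state := by
    intro j
    induction j with
    | zero =>
      intro t m ψ hp d hd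
      simp only [iter, List.mem_singleton] at hd
      subst hd
      exact ⟨by simp, hp⟩
    | succ j ih =>
      intro t m ψ hp d hd
      simp only [iter, List.mem_flatMap, Branch.tick] at hd
      obtain ⟨⟨t1, m1, ψ1⟩, hc, hd⟩ := hd
      have h1 := h j m ψ hp (t + 1) _ hc
      have h2 := ih t1 m1 ψ1 h1.2 d hd
      refine ⟨?_, h2.2⟩
      simp only at h1
      rw [Nat.add_mul]
      omega
  intro t d hd
  rw [exec_loop, hk] at hd
  have h1 := CExpr.cost_le_of_nodes hβ hm hs hn
  have h2 := key _ _ _ _ hi d hd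
  refine ⟨?_, h2.2⟩
  have h4 := h2.1
  simp only at h4
  unfold tau
  omega

/-- A time bound for interactions with an invariant. -/
theorem interact_time_le {σ : Type*} [Fintype σ] {B : BlackBox σ} {last : Prog} {T : ℕ}
    (I : ℕ → (ℕ → ℕ) → JointState σ → Prop) (f : ℕ → Prog × ℕ) (k s : ℕ)
    (h : ∀ j < s + k, ∀ m ψ, I j m ψ → Prog.All B (f j).1 m ψ T fun m' ψ' =>
      I (j + 1) (Function.update m' 0 (f j).2) ψ')
    (hlast : ∀ m ψ, I (s + k) m ψ → Prog.All B last m ψ T fun _ _ => True)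
    (c : Branch σ) (hc : I s c.mem c.state) :
    ∀ r ∈ interact B last ((List.range' s k).map f) c, r.2.time ≤ c.time + (k + 1) * T := by
  induction k generalizing s c with
  | zero =>
    intro r hr
    simp only [List.range'_zero, List.map_nil, interact, List.mem_map] at hr
    obtain ⟨d, hd, rfl⟩ := hr
    have := (hlast _ _ hc c.time d hd).1
    simpa using this
  | succ k ih =>
    intro r hr
    simp only [List.range'_succ, List.map_cons, interact, List.mem_flatMap, List.mem_map] at hr
    obtain ⟨d, hd, r', hr', rfl⟩ := hr
    have h1 := h s (by omega) _ _ hc c.time d hd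
    have h2 := ih (s + 1) (fun j hj => h j (by omega))
      (fun m ψ hI => hlast m ψ (by rwa [show s + (k + 1) = s + 1 + k by omega]))
      { d with mem := Function.update d.mem 0 (f s).2 } h1.2 r' hr'
    simp only at h2 ⊢
    have h3 := h1.1
    rw [show (k + 1 + 1) * T = (k + 1) * T + T by ring]
    omega

namespace SimParams

/-- Time bound for `search`. -/
def searchTime (P : SimParams) (β q : ℕ) : ℕ :=
  5 * tau β + P.advTime β q + q * (20 * tau β + P.advTime β q + 1)

/-- Time bound for the initialization. -/
def initTime (P : SimParams) (β q : ℕ) : ℕ :=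
  6 * tau β + (3 * q + P.n + 3) * (2 * tau β + 1)

/-- Time bound for a stage. -/
def stageTime (P : SimParams) (β q : ℕ) : ℕ :=
  16 * tau β + P.searchTime β q + P.initTime β q

/-- The parameters of the simulator are large enough for `q` queries. -/
structure Fine (P : SimParams) (β q : ℕ) : Prop where
  one_le : 1 ≤ β
  fits : P.Fits (2 ^ β)
  big : P.Big β q
  pow_lt : P.p ^ (q + P.n + 3) < 2 ^ β
  two_le : 2 ≤ P.p ^ (q + P.n + 3)
  num_lt : P.cL * P.cX ≤ P.p ^ (q + P.n + 3)
  cY_lt : P.cY < P.p ^ (q + P.n + 3)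
  cY_pos : 0 < P.cY
  len : 2 * q + P.n + 16 < 2 ^ β

/-- Invariant during the choice of the coefficients, with `k` coefficients to be chosen. -/
structure InitInv (P : SimParams) (β q k : ℕ) (m : ℕ → ℕ) : Prop where
  bd : ∀ a, m a < 2 ^ β
  three : m 3 = q
  four : m 4 = P.p ^ (q + P.n + 3)
  five : m 5 = 0
  six : m 6 = 0
  seven : m 7 = 0
  ten : m 10 + k = 2 * q

theorem InitInv.step {P : SimParams} {β q k : ℕ} {m : ℕ → ℕ} (hP : P.Fine β q)
    (h : P.InitInv β q (k + 1) m) {a v : ℕ} (ha : 16 ≤ a) (hv : v < 2 ^ β) :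
    P.InitInv β q k (Function.update (Function.update m a v) 10 (m 10 + 1)) := by
  have hlen := hP.len
  have h10 := h.ten
  refine ⟨fun b => ?_, ?_, ?_, ?_, ?_, ?_, ?_⟩
  · rw [Function.update_apply, Function.update_apply]
    split_ifs
    · omega
    · exact hv
    · exact h.bd b
  all_goals
    first
    | rw [Function.update_of_ne (by omega), Function.update_of_ne (by omega)]
    | rw [Function.update_self]
  · exact h.three
  · exact h.four
  · exact h.five
  · exact h.six
  · exact h.seven
  · omega

theorem InitInv.inv {P : SimParams} {β q : ℕ} {m : ℕ → ℕ} (hP : P.Fine β q)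
    (h : P.InitInv β q 0 m) : P.Inv β q 0 m := by
  have hlen := hP.len
  have h4 := h.four
  have h3 := h.three
  have h6 := h.six
  refine ⟨⟨hP.one_le, hP.fits, h.bd, ?_, ?_, ?_, hP.cY_pos, ?_⟩, h3, h6, ?_, ?_⟩
  · rw [h4]; exact hP.two_le
  · rw [h4]; exact hP.num_lt
  · rw [h4]; exact hP.cY_lt
  · omega
  · rw [h.five, h.seven]; omega
  · rw [h.seven]; omega

theorem initInv_start {P : SimParams} {β q : ℕ} (hP : P.Fine β q) :
    P.InitInv β q (2 * q) (Function.update (Function.update (Function.update (Function.update 0 0 q)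
      3 q) 4 (P.p ^ (q + P.n + 3))) 10 0) := by
  have hlen := hP.len
  have hpow := hP.pow_lt
  refine ⟨fun b => ?_, ?_, ?_, ?_, ?_, ?_, ?_⟩
  · simp only [Function.update_apply, Pi.zero_apply]
    split_ifs <;> omega
  all_goals simp

/-- The memory after the choice of the modulus. -/
theorem step_initModulus {σ : Type*} [Fintype σ] {B : BlackBox σ} {P : SimParams} {β q : ℕ}
    (hP : P.Fine β q) (ψ : JointState σ) :
    Prog.Step B P.initModulus (Function.update (Function.update 0 0 q) 3 q) ψ
      (Function.update (Function.update (Function.update 0 0 q) 3 q) 4 (P.p ^ (q + P.n + 3))) ψ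
      (2 * tau β + (q + P.n + 3) * (tau β + 1)) := by
  have hlen := hP.len
  have hβ := hP.one_le
  have hn := hP.fits.n_lt
  have hp := hP.fits.p_lt
  have hp0 : 0 < P.p := by
    rcases Nat.eq_zero_or_pos P.p with h | h
    · have := hP.two_le; rw [h, zero_pow (by omega)] at this; omega
    · exact h
  have hbd : ∀ i ≤ q + P.n + 3, ∀ a, Function.update (Function.update (Function.update (0 : ℕ → ℕ) 0 q) 3 q)
      4 (P.p ^ i) a < 2 ^ β := by
    intro i hi a
    have := (Nat.pow_le_pow_right hp0 hi).trans_lt hP.pow_lt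
    simp only [Function.update_apply, Pi.zero_apply]
    split_ifs <;> omega
  have hbd0 : ∀ a, Function.update (Function.update (0 : ℕ → ℕ) 0 q) 3 q a < 2 ^ β := by
    intro a
    simp only [Function.update_apply, Pi.zero_apply]
    split_ifs <;> omega
  refine ((Prog.step_assign hβ hbd0 (by simp only [CExpr.Small]; omega) (by simp [CExpr.nodes])
    (by simp only [CExpr.Small]; omega) (by simp [CExpr.nodes])).seq
    (Prog.Step.loop (T := tau β) (k := q + P.n + 3) hβ (hbd 0 (by omega))
      (by simp only [CExpr.Small]; omega)
      (by simp [CExpr.nodes])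
      (fun i => Function.update (Function.update (Function.update 0 0 q) 3 q) 4 (P.p ^ i))
      (fun _ => ψ) ?_ ?_ rfl ?_)).mono (by omega)
  · simp [CExpr.eval, ArithOp.apply, add_assoc]
  · simp
  · intro i hi
    refine (Prog.step_assign hβ (hbd i hi.le) (by simp only [CExpr.Small]; omega)
      (by simp [CExpr.nodes]) (by simp only [CExpr.Small]; omega) (by simp [CExpr.nodes])).cast
      ?_ rfl
    simp [CExpr.eval, ArithOp.apply, pow_succ]

end SimParams

theorem Clean.mono {σ : Type*} [Fintype σ] {m : ℕ → ℕ} {ψ : JointState σ} {I J : (ℕ → ℕ) → Prop} (h : Clean σ I m ψ) (hIJ : I m → J m) :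
    Clean σ J m ψ := ⟨hIJ h.1, h.2⟩

section Box

open SimParams Prog

variable {U X : Type*} [DecidableEq U] [Fintype X] {X₀ Y : Finset U} {n : ℕ}
  {N : HashNumbering X X₀ Y} {σ R Z E : Type*} [Fintype σ] [DecidableEq σ] {q : ℕ}
  [AddCommGroup Y] (A : OracleAlg (↥(X₀ ∪ Y) × X) Y (X₀ × (Fin n → X)) σ R Z E q)
  {P : SimParams} {m : ℕ → ℕ} {β s : ℕ} {ψ : JointState σ}

theorem Inv.answer_pending (hb : P.Big β q) (h : P.Inv β q s m) (h7 : m 7 ≠ 0) :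
    P.Inv β q s (Function.update
      (Function.update (Function.update m 10 0) 5 (m 5 + 1)) 7 0) := by
  have hlen := hb.len
  have := h.seven
  have := h.five
  exact (h.update (k := 10) (v := 0) (by omega) (by simp)).update_five_seven hb (by omega)
    (by omega)

theorem step_pending (hP : N.Params P) (hb : P.Big β q) (hs : s ≤ P.n) (h : P.Inv β q s m)
    (h7 : m 7 ≠ 0) (φ : σ → ℂ) :
    Step (A.blackBox N) P.pending m (emb (fun _ => 0) φ)
      (Function.update (Function.update (Function.update m 10 0) 5 (m 5 + 1)) 7 0)
      (emb (fun _ => 0) (A.adv (m 5) (N.hashFun P m) φ)) (2 * tau β + P.advTime β q) := by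
  have hlen := hb.len
  have hc := h.ready.fits.const
  have hβ := h.ready.one_le
  have h5 := h.five
  have h1 := (h.ready.update (k := 10) (v := 0) (by omega) (by omega) (by omega) (by omega)).update
    (k := 5) (v := m 5 + 1) (by omega) (by omega) (by omega) (by omega)
  exact (Step.ite_pos (e := var 7) hβ h.ready.bd (by simp only [CExpr.Small]; omega) (by simp [CExpr.nodes]) h7
    ((step_advance_of_inv A hP h hs φ).seq (step_assign hβ h1.bd (by simp only [CExpr.Small]; omega)
      (by simp [CExpr.nodes]) (by simp only [CExpr.Small]; omega) (by simp [CExpr.nodes])))).mono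
    (by omega)

theorem all_pending (hP : N.Params P) (hb : P.Big β q) (hs : s ≤ P.n)
    (h : Clean σ (P.Inv β q s) m ψ) :
    All (A.blackBox N) P.pending m ψ (2 * tau β + P.advTime β q)
      (Clean σ fun m => P.Inv β q s m ∧ m 7 = 0) := by
  obtain ⟨h, φ, rfl⟩ := h
  have hlen := hb.len
  have hβ := h.ready.one_le
  have hτ : 1 ≤ tau β := by unfold tau; omega
  by_cases h7 : m 7 = 0
  · exact ((Step.ite_neg (e := var 7) hβ h.ready.bd (by simp only [CExpr.Small]; omega) (by simp [CExpr.nodes])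
      h7 step_skip).all ⟨⟨h, h7⟩, φ, rfl⟩).mono (by omega) fun _ _ h => h
  · exact (step_pending A hP hb hs h h7 φ).all
      ⟨⟨Inv.answer_pending hb h h7, by simp⟩, _, rfl⟩

theorem all_search (hP : N.Params P) (hb : P.Big β q) (hs : s ≤ P.n)
    (h : Clean σ (P.Inv β q s) m ψ) :
    All (A.blackBox N) P.search m ψ (P.searchTime β q) (Clean σ (P.Inv β q s)) := by
  have hlen := hb.len
  have hβ := h.1.ready.one_le
  refine (All.seq (all_pending A hP hb hs h)
    (T' := 2 * tau β + q * (20 * tau β + P.advTime β q + 1)) ?_).mono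
    (by unfold searchTime; omega) (fun _ _ h => h)
  rintro m1 _ ⟨⟨h1, h7⟩, φ, rfl⟩
  have h2 := h1.update (k := 8) (v := 0) (by omega) (by simp)
  refine (All.seq ((step_assign (a := .lit 8) (e := .lit 0) hβ h1.ready.bd
    (by simp only [CExpr.Small]; omega)
    (by simp [CExpr.nodes]) (by simp only [CExpr.Small]; omega) (by simp [CExpr.nodes])).all
    (post := fun m' ψ' => m' = Function.update m1 8 0 ∧ ψ' = emb (fun _ => 0) φ) ⟨rfl, rfl⟩)
    (T' := tau β + q * (20 * tau β + P.advTime β q + 1)) ?_).mono (by omega) (fun _ _ h => h)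
  rintro _ _ ⟨rfl, rfl⟩
  have h3 := h2.three
  have h5 := h2.five
  refine (All.loop_desc hβ h2.ready.bd (by simp only [CExpr.Small]; omega) (by simp [CExpr.nodes])
    (k := q - m1 5) (by simpa [CExpr.eval, ArithOp.apply] using congrArg (· - m1 5) h3)
    (fun k => Clean σ (LoopInv P β q s k)) ⟨⟨h2, fun _ => ⟨?_, ?_⟩⟩, φ, rfl⟩
    (fun k m ψ h => all_iteration A hP hb hs h)).mono ?_ (fun _ _ h => ⟨h.1.inv, h.2⟩)
  · simp only [Function.update_of_ne (show (5 : ℕ) ≠ 8 by omega)] at h5 ⊢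
    omega
  · simpa using h7
  · have := Nat.mul_le_mul_right (20 * tau β + P.advTime β q + 1) (Nat.sub_le q (m1 5))
    omega

theorem content_out_succ (h6 : m 6 = s) (hs : s < n) (φ : σ) :
    (A.blackBox N).content m (.out (.bin .add (.lit 1) (var 6))) φ =
      N.right ((A.outReg φ).1.2 ⟨s, hs⟩) := by
  have : (CExpr.bin .add (.lit 1) (var 6)).eval m = s + 1 := by
    simp [CExpr.eval, ArithOp.apply, h6, add_comm]
  simp only [OracleAlg.blackBox, this, hs, dif_pos]

theorem range_out_succ (hP : N.Params P) (m : ℕ → ℕ) :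
    (A.blackBox N).range m (.out (.bin .add (.lit 1) (var 6))) = P.cX := by
  have : (CExpr.bin .add (.lit 1) (var 6)).eval m ≠ 0 := by
    simp [CExpr.eval, ArithOp.apply]
  simp only [OracleAlg.blackBox, if_neg this, hP.cX_eq]

theorem all_finish (hP : N.Params P) (hb : P.Big β q) (hs : s < n)
    (h : Clean σ (P.Inv β q s) m ψ) :
    All (A.blackBox N) P.finish m ψ (12 * tau β) (Clean σ (P.Inv β q s)) := by
  obtain ⟨h, φ, rfl⟩ := h
  have hlen := hb.len
  have hβ := h.ready.one_le
  have hX := h.ready.fits.cX_lt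
  have hL := h.ready.fits.cL_lt
  have hτ : 1 ≤ tau β := by unfold tau; omega
  refine (All.ite (e := var 8) (T := 11 * tau β) hβ h.ready.bd (by simp only [CExpr.Small]; omega)
    (by simp [CExpr.nodes]) (fun h8 => ?_) (fun h8 => ?_)).mono (by omega) (fun _ _ h => h)
  · exact (step_skip.all (post := Clean σ (P.Inv β q s)) ⟨h, φ, rfl⟩).mono (by omega)
      fun _ _ h => h
  have h6 : ∀ v, Function.update m 1 v 6 = s := fun v => by simpa using h.six
  refine (All.seq (all_grab hβ h.ready.bd (by simp only [Reg.Small, CExpr.Small]; omega)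
    (by simp [Reg.nodes, CExpr.nodes]) hX (range_out_succ A hP m) (fun _ => range_out_succ A hP _)
    (fun v t => ?_) (fun t => ?_) (by omega) (by omega) φ) (T' := 6 * tau β) ?_).mono (by omega)
    (fun _ _ h => h)
  · rw [content_out_succ A (h6 v) hs, content_out_succ A h.six hs]
  · rw [content_out_succ A h.six hs, hP.cX_eq]; exact Fin.is_lt _
  rintro _ _ ⟨v, hv, rfl, φ1, rfl⟩
  have h1 := h.update (k := 1) (v := v) (by omega) (by simp)
  refine (All.ite (e := var 6) (T := 5 * tau β) hβ h1.ready.bd (by simp only [CExpr.Small]; omega)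
    (by simp [CExpr.nodes]) (fun h6 => ?_) (fun h6 => ?_)).mono (by omega) (fun _ _ h => h)
  · exact (step_skip.all (post := Clean σ (P.Inv β q s)) ⟨h1, φ1, rfl⟩).mono (by omega)
      fun _ _ h => h
  refine (all_grab (r := .out (.lit 0)) hβ h1.ready.bd (by simp only [Reg.Small, CExpr.Small]; omega)
    (by simp [Reg.nodes, CExpr.nodes]) hL hP.cL_eq.symm (fun _ => hP.cL_eq.symm)
    (fun v t => rfl) (fun t => ?_) (by omega) (by omega) φ1).mono (by omega) ?_
  · rw [hP.cL_eq]; exact Fin.is_lt _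
  rintro _ _ ⟨w, hw, rfl, hφ⟩
  exact ⟨h1.update (by omega) (by simp), hφ⟩

/-- The memory after recording an answer. -/
def recordMem (P : SimParams) (s : ℕ) (m : ℕ → ℕ) : ℕ → ℕ :=
  Function.update (Function.update (Function.update m (17 + 4 * s) ((m 2 * P.cX + m 1) % m 4))
    (18 + 4 * s) (m 0)) 6 (s + 1)

theorem step_record (hb : P.Big β q) (h : P.Inv β q s m) (hs : s < P.n) :
    Step (A.blackBox N) P.record m ψ (recordMem P s m) ψ (3 * tau β) ∧
      P.Inv β q (s + 1) (recordMem P s m) := by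
  have hlen := hb.len
  have hβ := h.ready.one_le
  have hX := h.ready.fits.cX_lt
  have hc := h.ready.fits.const
  have h4 := h.ready.two_le
  have h017 : (0 : ℕ) ≠ 17 + 4 * s := by omega
  have h1 := h.update (k := 17 + 4 * s) (v := (m 2 * P.cX + m 1) % m 4)
    ((Nat.mod_lt _ (by omega)).trans (h.ready.bd 4))
    (by simp only [Finset.mem_insert, Finset.mem_singleton]; omega)
  have h2 := h1.update (k := 18 + 4 * s) (v := m 0) (h.ready.bd 0)
    (by simp only [Finset.mem_insert, Finset.mem_singleton]; omega)
  refine ⟨((step_assign hβ h.ready.bd (by simp only [CExpr.Small]; omega)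
      (by simp [CExpr.nodes]) (by simp only [CExpr.Small]; omega) (by simp [CExpr.nodes])).seq
    (Step.seq (step_assign hβ ?_ (by simp only [CExpr.Small]; omega)
      (by simp [CExpr.nodes]) (by simp only [CExpr.Small]; omega) (by simp [CExpr.nodes]))
      (Step.cast (step_assign hβ ?_ (by simp only [CExpr.Small]; omega)
      (by simp [CExpr.nodes]) (by simp only [CExpr.Small]; omega) (by simp [CExpr.nodes])) ?_ rfl)
      )).mono (by omega), h2.update_six hb (by omega)⟩
  · simpa [CExpr.eval, ArithOp.apply, h.six] using h1.ready.bd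
  · have : (6 : ℕ) ≠ 17 + 4 * s := by omega
    simpa [CExpr.eval, ArithOp.apply, h.six, Function.update_of_ne this,
      Function.update_of_ne h017] using h2.ready.bd
  · have h17 : (6 : ℕ) ≠ 17 + 4 * s := by omega
    have h18 : (6 : ℕ) ≠ 18 + 4 * s := by omega
    simp [CExpr.eval, ArithOp.apply, h.six, Function.update_of_ne h17, Function.update_of_ne h18,
      Function.update_of_ne h017, recordMem]

theorem all_initCoeffs (hP : P.Fine β q) (φ : σ → ℂ) (hm : P.InitInv β q (2 * q) m) :
    All (A.blackBox N) (.loop numCoeffs (.seq (.sample (arrayAt 16 (var 10)) (.bin .sub (var 4) (.lit 1)))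
      (.assign (.lit 10) (.bin .add (var 10) (.lit 1))))) m (emb (fun _ => 0) φ)
      (tau β + 2 * q * (2 * tau β + 1)) (Clean σ (P.Inv β q 0)) := by
  have hlen := hP.len
  have hβ := hP.one_le
  have hc := hP.fits.const
  have h2 := hP.two_le
  refine (All.loop_desc hβ hm.bd (by simp only [CExpr.Small]; omega) (by simp [CExpr.nodes])
    (by simp [CExpr.eval, ArithOp.apply, hm.three]) (fun k => Clean σ (P.InitInv β q k))
    ⟨hm, φ, rfl⟩ ?_).mono le_rfl (fun _ _ h => h.mono fun h => h.inv hP)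
  rintro k m _ ⟨h, φ, rfl⟩
  refine (All.seq (all_sample hβ h.bd (by simp only [CExpr.Small]; omega) (by simp [CExpr.nodes])
    (by simp only [CExpr.Small]; omega) (by simp [CExpr.nodes]) _ φ) (T' := tau β) ?_).mono
    (by omega) (fun _ _ h => h)
  rintro _ _ ⟨v, hv, rfl, φ', rfl⟩
  have ha : (arrayAt 16 (var 10)).eval m = 16 + 4 * m 10 := by simp [CExpr.eval, ArithOp.apply]
  have hv' : v < 2 ^ β := by
    have h4 := h.four
    have : (CExpr.bin .sub (var 4) (.lit 1)).eval m = m 4 - 1 := by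
      simp [CExpr.eval, ArithOp.apply]
    have := hP.pow_lt
    omega
  have h3 := h.step hP (a := 16 + 4 * m 10) (by omega) hv'
  rw [ha]
  refine ((step_assign hβ (fun a => ?_) (by simp only [CExpr.Small]; omega)
    (by simp [CExpr.nodes]) (by simp only [CExpr.Small]; omega) (by simp [CExpr.nodes])).cast
    (m'' := Function.update (Function.update m (16 + 4 * m 10) v) 10 (m 10 + 1)) ?_ rfl).all
    ⟨h3, φ', rfl⟩
  · rw [Function.update_apply]; split_ifs
    · exact hv'
    · exact h.bd a
  · have : (10 : ℕ) ≠ 16 + 4 * m 10 := by omega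
    simp [CExpr.eval, ArithOp.apply, Function.update_of_ne this]

end Box

/-- The stages of the simulator. -/
def SimParams.stage (P : SimParams) (i : ℕ) : Prog :=
  if i = 0 then P.firstStage else if i < P.n then P.midStage else P.lastStage

/-- The simulator. -/
def SimParams.simulator (P : SimParams) (n : ℕ) : Simulator n := fun i => P.stage i

section Box

open SimParams Prog

variable {U X : Type*} [DecidableEq U] [Fintype X] {X₀ Y : Finset U} {n : ℕ}
  {N : HashNumbering X X₀ Y} {σ R Z E : Type*} [Fintype σ] [DecidableEq σ] {q : ℕ}
  [AddCommGroup Y] (A : OracleAlg (↥(X₀ ∪ Y) × X) Y (X₀ × (Fin n → X)) σ R Z E q)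
  {P : SimParams} {m : ℕ → ℕ} {β s : ℕ} {ψ : JointState σ}

theorem all_firstStage (hP : N.Params P) (hF : P.Fine β q) (hn : 0 < n) (φ : σ → ℂ) :
    All (A.blackBox N) P.firstStage (Function.update 0 0 q) (emb (fun _ => 0) φ)
      (P.stageTime β q) (Clean σ (P.Inv β q 0)) := by
  have hlen := hF.len
  have hβ := hF.one_le
  have hc := hF.fits.const
  have hpow := hF.pow_lt
  refine (All.seq ((step_assign (a := .lit 3) (e := var 0) (m := Function.update 0 0 q) hβ
    (fun a => ?_) (by simp only [CExpr.Small]; omega)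
    (by simp [CExpr.nodes]) (by simp only [CExpr.Small]; omega) (by simp [CExpr.nodes])).all
    (post := fun m ψ => m = Function.update (Function.update (0 : ℕ → ℕ) 0 q) 3 q ∧ ψ = emb (fun _ => 0) φ)
    ⟨by simp [CExpr.eval], rfl⟩) (T' := 15 * tau β + P.searchTime β q + P.initTime β q) ?_).mono
    (by unfold stageTime; omega) (fun _ _ h => h)
  · simp only [Function.update_apply, Pi.zero_apply]
    split_ifs <;> omega
  rintro _ _ ⟨rfl, rfl⟩
  refine (All.seq ((step_initModulus hF _).all (post := fun m ψ =>
    m = Function.update (Function.update (Function.update (0 : ℕ → ℕ) 0 q) 3 q) 4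
      (P.p ^ (q + P.n + 3)) ∧
      ψ = emb (fun _ => 0) φ) ⟨rfl, rfl⟩)
    (T' := tau β + (tau β + 2 * q * (2 * tau β + 1)) + P.searchTime β q + 12 * tau β) ?_).mono
    ?_ (fun _ _ h => h)
  · rintro _ _ ⟨rfl, rfl⟩
    refine (All.seq (T := tau β + (tau β + 2 * q * (2 * tau β + 1)))
      (post := Clean σ (P.Inv β q 0)) (All.seq
      ((step_assign (a := .lit 10) (e := .lit 0) hβ
      (fun a => ?_) (by simp only [CExpr.Small]; omega)
      (by simp [CExpr.nodes]) (by simp only [CExpr.Small]; omega) (by simp [CExpr.nodes])).all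
      (post := fun m ψ => P.InitInv β q (2 * q) m ∧ ψ = emb (fun _ => 0) φ)
      ⟨initInv_start hF, rfl⟩) ?_) (T' := P.searchTime β q + 12 * tau β) ?_).mono (by omega)
      (fun _ _ h => h)
    · simp only [Function.update_apply, Pi.zero_apply]
      split_ifs <;> omega
    · rintro m _ ⟨h, rfl⟩
      exact all_initCoeffs A hF φ h
    · intro m ψ h
      exact All.seq (all_search A hP hF.big (by omega) h) fun m ψ h => all_finish A hP hF.big hn h
  · unfold initTime
    nlinarith [Nat.zero_le (q * tau β), Nat.zero_le (P.n * tau β)]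

theorem all_record_search (hP : N.Params P) (hb : P.Big β q) (hs : s < P.n)
    (h : Clean σ (P.Inv β q s) m ψ) :
    All (A.blackBox N) (.seq P.record P.search) m ψ (3 * tau β + P.searchTime β q)
      (Clean σ (P.Inv β q (s + 1))) := by
  obtain ⟨h, φ, rfl⟩ := h
  have h1 := step_record (N := N) (ψ := emb (fun _ => 0) φ) A hb h hs
  exact All.seq (h1.1.all (post := Clean σ (P.Inv β q (s + 1))) ⟨h1.2, φ, rfl⟩)
    fun m ψ h => all_search A hP hb (by omega) h

theorem all_midStage (hP : N.Params P) (hb : P.Big β q) (hn : P.n = n) (hs : s + 1 < n)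
    (h : Clean σ (P.Inv β q s) m ψ) :
    All (A.blackBox N) P.midStage m ψ (P.stageTime β q) (Clean σ (P.Inv β q (s + 1))) := by
  obtain ⟨h, φ, rfl⟩ := h
  have h1 := step_record (N := N) (ψ := emb (fun _ => 0) φ) A hb h (by omega)
  refine (All.seq (h1.1.all (post := Clean σ (P.Inv β q (s + 1))) ⟨h1.2, φ, rfl⟩)
    (T' := P.searchTime β q + 12 * tau β) fun m ψ h => All.seq (all_search A hP hb (by omega) h)
      fun m ψ h => all_finish A hP hb hs h).mono ?_ fun _ _ h => h
  unfold stageTime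
  omega

/-- The interaction with the simulator in terms of natural numbers. -/
theorem run_eq (hn : P.n = n) (hn0 : 0 < n) (Θ : Fin n → Y) (f : ℕ → Prog × ℕ)
    (hf : ∀ i (h : i < n), f i = (P.stage i, N.ofY (Θ ⟨i, h⟩))) :
    (P.simulator n).run N A Θ = interact (A.blackBox N) P.lastStage ((List.range' 0 n).map f)
      ⟨0, Function.update 0 0 q, emb (fun _ => 0) A.start⟩ := by
  have h1 : (P.simulator n) (Fin.last n) = P.lastStage := by
    simp only [simulator, stage, Fin.val_last]
    rw [if_neg (by omega), if_neg (by omega)]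
  have h2 : List.ofFn (fun i : Fin n => ((P.simulator n) i.castSucc, N.ofY (Θ i))) =
      (List.range' 0 n).map f := by
    refine List.ext_getElem (by simp) fun i hi hi' => ?_
    have hi0 : i < n := by simpa using hi
    simp [hf i hi0, simulator]
  rw [Simulator.run, h1, h2]
  rfl

theorem run_time_le (hP : N.Params P) (hF : P.Fine β q) (hn : P.n = n) (hn0 : 0 < n)
    (Θ : Fin n → Y) : ∀ r ∈ (P.simulator n).run N A Θ,
      r.2.time ≤ (n + 1) * P.stageTime β q := by
  have hcY := hF.fits.cY_lt
  have hf : ∀ i (h : i < n), (fun i : ℕ => (P.stage i, if h : i < n then N.ofY (Θ ⟨i, h⟩) else 0)) i =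
      (P.stage i, N.ofY (Θ ⟨i, h⟩)) := fun i h => by simp [h]
  rw [run_eq A hn hn0 Θ _ hf]
  intro r hr
  -- Before stage 0 there is no modulus yet, so the invariant cannot hold. Before stage j > 0 only j
  -- - 1 answers are recorded; the newest one still waits in cell 0.
  refine (interact_time_le (T := P.stageTime β q) (fun j m ψ => (j = 0 ∧ m = Function.update (0 : ℕ → ℕ) 0 q ∧
    ∃ φ, ψ = emb (fun _ => 0) φ) ∨ (0 < j ∧ Clean σ (P.Inv β q (j - 1)) m ψ)) _ n 0 ?_ ?_ _
    (.inl ⟨rfl, rfl, _, rfl⟩) r hr).trans (by simp)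
  · intro j hj m ψ hI
    have key : All (A.blackBox N) (P.stage j) m ψ (P.stageTime β q) (Clean σ (P.Inv β q j)) := by
      rcases hI with ⟨rfl, rfl, φ, rfl⟩ | ⟨hj0, hI⟩
      · exact all_firstStage A hP hF hn0 φ
      · rw [stage, if_neg (by omega), if_pos (by omega)]
        have := all_midStage A hP hF.big hn (s := j - 1) (by omega) hI
        rwa [Nat.sub_add_cancel hj0] at this
    refine key.mono le_rfl fun m' ψ' h => .inr ⟨by omega, h.1.update ?_ (by simp), h.2⟩
    simp only [show j < n by omega, dif_pos]
    exact (N.ofY_lt _).trans (by rw [← hP.cY_eq]; exact hcY)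
  · intro m ψ hI
    rcases hI with ⟨h0, _⟩ | ⟨hj0, hI⟩
    · omega
    · exact (all_record_search A hP hF.big (s := 0 + n - 1) (by omega) hI).mono
        (by unfold stageTime; omega) fun _ _ _ => trivial

end Box

/-! ### Memory contents along a branch -/

namespace SimParams

/-- The new pair sits at array index s, which is consulted only by step 2q + s. -/
theorem chainVal_recordMem (P : SimParams) {m : ℕ → ℕ} (s v : ℕ) {j : ℕ}
    (hj : j ≤ 2 * m 3 + s) : chainVal (recordMem P s m) v j = chainVal m v j := by
  have key : ∀ a, a ≠ 17 + 4 * s → a ≠ 18 + 4 * s → a ≠ 6 → recordMem P s m a = m a := by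
    intro a h1 h2 h3
    simp [recordMem, h1, h2, h3]
  induction j with
  | zero => rfl
  | succ j ih =>
    have h3 := key 3 (by omega) (by omega) (by omega)
    have h4 := key 4 (by omega) (by omega) (by omega)
    rw [chainVal, chainVal, ih (by omega), stepVal, stepVal, h3, h4,
      key (16 + 4 * j) (by omega) (by omega) (by omega)]
    by_cases h : j < 2 * m 3
    · rw [if_pos h, if_pos h]
    · rw [if_neg h, if_neg h, key (17 + 4 * (j - 2 * m 3)) (by omega) (by omega) (by omega),
        key (18 + 4 * (j - 2 * m 3)) (by omega) (by omega) (by omega)]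

end SimParams

theorem SimParams.Inv.step_assign_lit {σ : Type*} [Fintype σ] {B : BlackBox σ} {P : SimParams}
    {β q s : ℕ} {m : ℕ → ℕ} {ψ : JointState σ} (h : P.Inv β q s m) {x v : ℕ} (hx : x < 65)
    (hv : v < 65) :
    Prog.Step B (.assign (.lit x) (.lit v)) m ψ (Function.update m x v) ψ (tau β) := by
  have hc := h.ready.fits.const
  exact Prog.step_assign h.ready.one_le h.ready.bd (by simp only [CExpr.Small]; omega)
    (by simp [CExpr.nodes]) (by simp only [CExpr.Small]; omega) (by simp [CExpr.nodes])

section Box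

open SimParams Prog

variable {U X : Type*} [DecidableEq U] [Fintype X] {X₀ Y : Finset U} {n : ℕ}
  {N : HashNumbering X X₀ Y} {σ R Z E : Type*} [Fintype σ] [DecidableEq σ] {q : ℕ}
  [AddCommGroup Y] (A : OracleAlg (↥(X₀ ∪ Y) × X) Y (X₀ × (Fin n → X)) σ R Z E q)
  {P : SimParams} {m : ℕ → ℕ} {β s i p d : ℕ} {ψ : JointState σ}
  {H : ↥(X₀ ∪ Y) × X → Y} {K : Branch σ → ℝ} {z : ℝ}

/-- Recording lengthens the evaluation by one final step, which overrides the value at the new point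
and keeps all others. In this way the memory realizes the updates in the recursion of `rightV`. -/
theorem hashFun_recordMem [DecidableEq X] (hP : N.Params P) (h : P.Inv β q s m)
    {v : ↥(X₀ ∪ Y) × X} {θ : Y} (h2 : m 2 = N.left v.1) (h1 : m 1 = N.right v.2)
    (h0 : m 0 = N.ofY θ) :
    N.hashFun P (recordMem P s m) = Function.update (N.hashFun P m) v θ := by
  have hnum : ∀ d, N.num d < m 4 := fun d =>
    (N.num_lt d).trans_le (by rw [← hP.cL_eq, ← hP.cX_eq]; exact h.ready.num_lt)
  have hY : N.ofY θ < P.cY := by rw [hP.cY_eq]; exact N.ofY_lt θ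
  have e3 : recordMem P s m 3 = m 3 := by
    simp [recordMem, show (3 : ℕ) ≠ 17 + 4 * s by omega, show (3 : ℕ) ≠ 18 + 4 * s by omega]
  have e4 : recordMem P s m 4 = m 4 := by
    simp [recordMem, show (4 : ℕ) ≠ 17 + 4 * s by omega, show (4 : ℕ) ≠ 18 + 4 * s by omega]
  have e6 : recordMem P s m 6 = s + 1 := by simp [recordMem]
  have e17 : recordMem P s m (17 + 4 * s) = N.num v := by
    have : (m 2 * P.cX + m 1) % m 4 = N.num v := by
      rw [h2, h1, hP.cX_eq]; exact Nat.mod_eq_of_lt (hnum v)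
    simp [recordMem, show 17 + 4 * s ≠ 6 by omega, this]
  have e18 : recordMem P s m (18 + 4 * s) = N.ofY θ := by
    simp [recordMem, show 18 + 4 * s ≠ 6 by omega, h0]
  ext1 d
  rw [HashNumbering.hashFun, hashVal, e6, e3, ← add_assoc, chainVal,
    chainVal_recordMem P s _ le_rfl, stepVal, e3, if_neg (by omega), Nat.add_sub_cancel_left,
    e17, e18, e4, Nat.mod_eq_of_lt (hnum v), Nat.mod_eq_of_lt (hY.trans h.ready.cY_lt),
    Function.update_apply]
  by_cases hd : d = v
  · rw [if_pos hd, if_pos (by rw [hd]), Nat.mod_eq_of_lt hY, N.toY_ofY]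
  · rw [if_neg hd, if_neg fun h => hd (N.num_injective h), HashNumbering.hashFun, hashVal, h.six]

/-- Memory contents: `s` answers are recorded, the hash function is `H`, `i` operations of the black
box have been called, `p` tells if a query is left open and `d` if the stage is done. -/
structure MemAt (N : HashNumbering X X₀ Y) (P : SimParams) (β q s : ℕ) (H : ↥(X₀ ∪ Y) × X → Y)
    (i p d : ℕ) (m : ℕ → ℕ) : Prop where
  inv : P.Inv β q s m
  hash : N.hashFun P m = H
  five : m 5 = i
  seven : m 7 = p
  eight : m 8 = d

theorem MemAt.update (h : MemAt N P β q s H i p d m) {k v : ℕ} (hv : v < 2 ^ β)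
    (hk : k ∉ ({3, 4, 5, 6, 7, 8} : Finset ℕ)) (hk16 : k < 16) :
    MemAt N P β q s H i p d (Function.update m k v) := by
  simp only [Finset.mem_insert, Finset.mem_singleton, not_or] at hk
  obtain ⟨h3, h4, h5, h6, h7, h8⟩ := hk
  refine ⟨h.inv.update hv (by simp [h3, h4, h5, h6, h7]), ?_, ?_, ?_, ?_⟩
  · rw [N.hashFun_update m hk16 h3 h4 h6, h.hash]
  · rw [Function.update_of_ne (Ne.symm h5), h.five]
  · rw [Function.update_of_ne (Ne.symm h7), h.seven]
  · rw [Function.update_of_ne (Ne.symm h8), h.eight]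

theorem MemAt.update_eight (h : MemAt N P β q s H i p d m) (hb : P.Big β q) {v : ℕ} (hv : v < 2) :
    MemAt N P β q s H i p v (Function.update m 8 v) := by
  have := hb.len
  refine ⟨h.inv.update (by omega) (by simp), ?_, ?_, ?_, by simp⟩
  · rw [N.hashFun_update m (by omega) (by omega) (by omega) (by omega), h.hash]
  · simpa using h.five
  · simpa using h.seven

theorem MemAt.update_seven (h : MemAt N P β q s H i p d m) (hb : P.Big β q) {v : ℕ}
    (hv : v < 2) (hi : i + v ≤ q) : MemAt N P β q s H i v d (Function.update m 7 v) := by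
  have h1 := h.inv.update_five_seven hb (i := i) (p := v) hi (by omega)
  rw [(Function.update_eq_self_iff (f := m) (a := 5)).2 h.five.symm] at h1
  refine ⟨h1, ?_, ?_, by simp, ?_⟩
  · rw [N.hashFun_update m (by omega) (by omega) (by omega) (by omega), h.hash]
  · simpa using h.five
  · simpa using h.eight

theorem MemAt.advance (h : MemAt N P β q s H i 0 d m) (hb : P.Big β q) (hi : i < q) :
    MemAt N P β q s H (i + 1) 0 d
      (Function.update (Function.update m 10 0) 5 (m 5 + 1)) := by
  refine ⟨Inv.advance hb h.inv h.seven (by rw [h.five]; exact hi), ?_, ?_, ?_, ?_⟩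
  · rw [N.hashFun_update _ (by omega) (by omega) (by omega) (by omega),
      N.hashFun_update _ (by omega) (by omega) (by omega) (by omega), h.hash]
  · simp [h.five]
  · simpa using h.seven
  · simpa using h.eight

theorem restr_left_right [DecidableEq X] (m m' : ℕ → ℕ) (v : ↥(X₀ ∪ Y) × X) (φ : σ → ℂ) :
    restr (A.blackBox N) m' .right (N.right v.2) (restr (A.blackBox N) m .left (N.left v.1) φ) =
      A.proj v φ := by
  ext t
  rw [A.proj_apply]
  change (if (N.right (A.queryReg t).2.1.2 : ℕ) = N.right v.2 then
    if (N.left (A.queryReg t).2.1.1 : ℕ) = N.left v.1 then φ t else 0 else 0) = _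
  by_cases h : (A.queryReg t).2.1 = v
  · rw [if_pos h, if_pos (by rw [h]), if_pos (by rw [h])]
  · rw [if_neg h]
    split_ifs with h1 h2
    · exact absurd (Prod.ext (N.left.injective (Fin.ext h2)) (N.right.injective (Fin.ext h1))) h
    all_goals rfl

theorem lb_grabInput [DecidableEq X] (hK : ∀ c, 0 ≤ K c) (hP : N.Params P)
    (h : MemAt N P β q s H i p d m) (v : ↥(X₀ ∪ Y) × X) (φ : σ → ℂ)
    (hz : ∀ m', MemAt N P β q s H i p d m' → m' 2 = N.left v.1 → m' 1 = N.right v.2 →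
      LB K m' (emb (fun _ => 0) (A.proj v φ)) z)
    (h0 : A.proj v φ = 0 → z ≤ 0) :
    LB (val (A.blackBox N) K P.grabInput) m (emb (fun _ => 0) φ) z := by
  have hf := h.inv.ready.fits
  have hL := hf.cL_lt
  have hX := hf.cX_lt
  have hc := hf.const
  have hl : (N.left v.1 : ℕ) < 2 ^ β := by
    refine lt_trans ?_ hL; rw [hP.cL_eq]; exact Fin.is_lt _
  have hr : (N.right v.2 : ℕ) < 2 ^ β := by
    refine lt_trans ?_ hX; rw [hP.cX_eq]; exact Fin.is_lt _
  have h' := h.update (k := 2) hl (by simp) (by omega)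
  refine LB.seq (lb_grab (r := .left) (fun c => val_nonneg hK c) h.inv.ready.one_le
    h.inv.ready.bd trivial (by simp [Reg.nodes]) hL (range_left A hP m)
    (fun _ => range_left A hP _) (fun _ _ => rfl) (content_left_lt A hP m) (by omega) φ
    (N.left v.1) hl (lb_grab (r := .right) hK h.inv.ready.one_le
    h'.inv.ready.bd trivial (by simp [Reg.nodes]) hX (range_right A hP _)
    (fun _ => range_right A hP _) (fun _ _ => rfl) (content_right_lt A hP _) (by omega) _
    (N.right v.2) hr ?_ ?_) ?_)
  · rw [restr_left_right]
    exact hz _ (h'.update hr (by simp) (by omega)) (by simp) (by simp)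
  · rw [restr_left_right]
    exact h0
  · intro hr0
    apply h0
    rw [← restr_left_right (N := N) A m m, hr0]
    ext t
    simp [restr]

/-- The random number u selects one of the three terms of the recursion: `z₀` when the input is
measured and the query stays open until the new answer arrives, `z₁` when it is measured and
answered by the old function, `z₂` when there is no extraction. The state φ' carries the square root
of the probability of u. -/
theorem lb_iteration [DecidableEq X] (hK : ∀ c, 0 ≤ K c) (hP : N.Params P) (hb : P.Big β q)
    {k κ : ℕ} (hs : s + k = P.n) (h : MemAt N P β q s H i 0 0 m) (hi : i + (κ + 1) = q)
    (v : ↥(X₀ ∪ Y) × X) (φ : σ → ℂ) {z₀ z₁ z₂ : ℝ} {M : ℕ}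
    (hM : M = (2 * (κ + 1) + k) * (2 * (κ + 1) + k - 1))
    {φ' : σ → ℂ} (hφ' : φ' = ((1 / Real.sqrt M : ℝ) : ℂ) • φ)
    (hz₀ : 0 < k → ∀ m', MemAt N P β q s H i 1 1 m' → m' 2 = N.left v.1 → m' 1 = N.right v.2 →
      LB K m' (emb (fun _ => 0) (A.proj v φ')) z₀)
    (hz₁ : 0 < k → ∀ m', MemAt N P β q s H (i + 1) 0 1 m' → m' 2 = N.left v.1 →
      m' 1 = N.right v.2 → LB K m' (emb (fun _ => 0) (A.adv i H (A.proj v φ'))) z₁)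
    (hz₂ : ∀ m', MemAt N P β q s H (i + 1) 0 0 m' →
      LB K m' (emb (fun _ => 0) (A.adv i H φ')) z₂)
    (h0₀ : A.proj v φ' = 0 → z₀ ≤ 0) (h0₁ : A.proj v φ' = 0 → z₁ ≤ 0) :
    LB (val (A.blackBox N) K P.iteration) m (emb (fun _ => 0) φ)
      (∑ u ∈ Finset.range M, if u < k * (2 * (κ + 1)) then z₀ else
        if u < 2 * (k * (2 * (κ + 1))) then z₁ else z₂) := by
  have hlen := hb.len
  have e3 := h.inv.three
  have e5 := h.five
  have e6 := h.inv.six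
  have hM0 : 1 ≤ M := by
    rw [hM, show 2 * (κ + 1) + k - 1 = 2 * κ + k + 1 by omega]; exact Nat.succ_le_of_lt (by positivity)
  have hmax : P.maxPair.eval m + 1 = M := by
    have : P.slots.eval m = 2 * (κ + 1) + k := by
      simp only [CExpr.eval, ArithOp.apply, e3, e5, e6]; omega
    change P.slots.eval m * (P.slots.eval m - 1) - 1 + 1 = M
    rw [this, ← hM]
    omega
  refine LB.ite_neg (e := var 8) h.eight (LB.seq ?_)
  have hs := lb_sample (B := A.blackBox N) (K := val (A.blackBox N) K
    (.ite (ltExpr (var 9) P.weight)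
      (.seq P.grabInput (.seq (.assign (.lit 8) (.lit 1)) (.assign (.lit 7) (.lit 1))))
      (.ite (ltExpr (var 9) (.bin .mul (.lit 2) P.weight))
        (.seq P.grabInput (.seq (.assign (.lit 8) (.lit 1)) P.advance))
        P.advance))) (a := .lit 9) (e := P.maxPair) (m := m) (fun _ => 0) φ
    (fun u => if u < k * (2 * (κ + 1)) then z₀ else
        if u < 2 * (k * (2 * (κ + 1))) then z₁ else z₂) fun u hu => ?_
  · rwa [hmax] at hs
  have hu' : u < 2 ^ β := lt_of_le_of_lt hu (eval_maxPair_lt hb h.inv)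
  have h1 := h.update (k := 9) hu' (by simp) (by omega)
  have hst : ((1 / Real.sqrt ((P.maxPair.eval m : ℕ) + 1) : ℝ) : ℂ) • φ = φ' := by
    rw [hφ', ← hmax]; push_cast; rfl
  rw [hst]
  simp only [CExpr.eval]
  set m1 := Function.update m 9 u with hm1
  have ew : P.weight.eval m1 = k * (2 * (κ + 1)) := by
    have h3 := h1.inv.three
    have h5 := h1.five
    have h6 := h1.inv.six
    simp only [CExpr.eval, ArithOp.apply, h3, h5, h6]
    congr 1
    · omega
    · congr 1; omega
  have ew2 : (CExpr.bin .mul (.lit 2) P.weight).eval m1 = 2 * (k * (2 * (κ + 1))) := by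
    rw [← ew]; rfl
  have eu : (var 9).eval m1 = u := by simp [CExpr.eval, hm1]
  have hadv : ∀ {m d φ}, MemAt N P β q s H i 0 d m →
      Step (A.blackBox N) P.advance m (emb (fun _ => 0) φ)
      (Function.update (Function.update m 10 0) 5 (m 5 + 1))
      (emb (fun _ => 0) (A.adv i H φ)) (P.advTime β q) := fun {m d φ} h => by
    have := step_advance_of_inv A hP h.inv (by omega) φ
    rw [h.five] at this ⊢
    rwa [h.hash] at this
  by_cases hw : u < k * (2 * (κ + 1))
  · have hk : 0 < k := by
      rcases Nat.eq_zero_or_pos k with rfl | h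
      · simp at hw
      · exact h
    rw [if_pos hw]
    refine LB.ite_pos ?_ (LB.seq (lb_grabInput A (fun c => val_nonneg hK c) hP h1 v φ'
      (fun m' hm' h2' h1' => ?_) h0₀))
    · rw [eval_ltExpr, ew, eu, if_pos hw]; omega
    have h8 := hm'.update_eight hb (v := 1) (by omega)
    refine ((hm'.inv.step_assign_lit (by omega) (by omega)).seq (h8.inv.step_assign_lit (by omega)
      (by omega))).lb (hz₀ hk _ (h8.update_seven hb (by omega) (by omega)) ?_ ?_)
    · simpa using h2'
    · simpa using h1'
  · rw [if_neg hw]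
    refine LB.ite_neg ?_ ?_
    · rw [eval_ltExpr, ew, eu, if_neg hw]
    by_cases hw2 : u < 2 * (k * (2 * (κ + 1)))
    · have hk : 0 < k := by
        rcases Nat.eq_zero_or_pos k with rfl | h
        · simp at hw2
        · exact h
      rw [if_pos hw2]
      refine LB.ite_pos ?_ (LB.seq (lb_grabInput A (fun c => val_nonneg hK c) hP h1 v φ'
        (fun m' hm' h2' h1' => ?_) h0₁))
      · rw [eval_ltExpr, ew2, eu, if_pos hw2]; omega
      have h8 := hm'.update_eight hb (v := 1) (by omega)
      refine ((hm'.inv.step_assign_lit (by omega) (by omega)).seq (hadv h8)).lb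
        (hz₁ hk _ (h8.advance hb (by omega)) ?_ ?_)
      · simpa using h2'
      · simpa using h1'
    · rw [if_neg hw2]
      refine LB.ite_neg ?_ ((hadv h1).lb (hz₂ _ (h1.advance hb (by omega))))
      rw [eval_ltExpr, ew2, eu, if_neg hw2]

end Box

theorem Prog.LB.trans {σ : Type*} {K : Branch σ → ℝ} {m : ℕ → ℕ} {ψ : JointState σ} {z z' : ℝ}
    (h : LB K m ψ z) (hz : z' ≤ z) : LB K m ψ z' := fun t => hz.trans (h t)

/-! ### Expected values of the remaining execution -/

section Value

open Prog

variable {σ : Type*} [Fintype σ]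

/-- The expected value of `leaf` after `k` further stages, from stage `s` on, and the last one, if
the outputs of the stages are right. -/
noncomputable def stageVal (B : BlackBox σ) (stg : ℕ → Prog) (last : Prog) (msg : ℕ → ℕ)
    (ok : ℕ → ℕ × ℕ → Prop) [∀ s o, Decidable (ok s o)] (leaf : Branch σ → ℝ) :
    ℕ → ℕ → Branch σ → ℝ
  | 0, _ => val B leaf last
  | k + 1, s => val B (fun d => if ok s (d.mem 1, d.mem 2) then
      stageVal B stg last msg ok leaf k (s + 1)
        { d with mem := Function.update d.mem 0 (msg s) } else 0) (stg s)

/-- The outputs from stage `s` on are right. -/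
def OutputsOk (ok : ℕ → ℕ × ℕ → Prop) : ℕ → List (ℕ × ℕ) → Prop
  | _, [] => True
  | s, o :: os => ok s o ∧ OutputsOk ok (s + 1) os

-- The interaction is unfolded from the front: a branch with a wrong output contributes 0 as soon as
-- that output is made, which gives a backward recursion over the stages.
open Classical in
theorem sum_interact (B : BlackBox σ) (stg : ℕ → Prog) (last : Prog) (msg : ℕ → ℕ)
    (ok : ℕ → ℕ × ℕ → Prop) (leaf : Branch σ → ℝ) (k s : ℕ) (c : Branch σ) :
    ((interact B last ((List.range' s k).map fun i => (stg i, msg i)) c).map fun r =>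
      if OutputsOk ok s r.1 then leaf r.2 else 0).sum =
      stageVal B stg last msg ok leaf k s c := by
  induction k generalizing s c with
  | zero => simp [interact, stageVal, val, OutputsOk, Function.comp_def]
  | succ k ih =>
    simp only [List.range'_succ, List.map_cons, interact, sum_flatMap, stageVal, val]
    congr 2
    ext d
    rw [List.map_map]
    split_ifs with h
    · rw [← ih]
      congr 2
      ext r
      simp [OutputsOk, h]
    · refine List.sum_eq_zero fun x hx => ?_
      obtain ⟨r, _, rfl⟩ := List.mem_map.1 hx
      simp [OutputsOk, h]

theorem stageVal_nonneg (B : BlackBox σ) (stg : ℕ → Prog) (last : Prog) (msg : ℕ → ℕ)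
    (ok : ℕ → ℕ × ℕ → Prop) [∀ s o, Decidable (ok s o)] {leaf : Branch σ → ℝ}
    (hl : ∀ c, 0 ≤ leaf c) (k s : ℕ) (c : Branch σ) :
    0 ≤ stageVal B stg last msg ok leaf k s c := by
  induction k generalizing s c with
  | zero => exact val_nonneg hl c
  | succ k ih =>
    refine val_nonneg (fun d => ?_) c
    split_ifs
    · exact ih _ _
    · exact le_rfl

/-- The value of the iterations of a loop. -/
noncomputable def iterVal (B : BlackBox σ) (K : Branch σ → ℝ) (P : Prog) (k : ℕ) (c : Branch σ) :
    ℝ := ((iter B P k c).map K).sum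

theorem iterVal_nonneg {B : BlackBox σ} {K : Branch σ → ℝ} (hK : ∀ c, 0 ≤ K c) (P : Prog) (k : ℕ)
    (c : Branch σ) : 0 ≤ iterVal B K P k c :=
  List.sum_nonneg fun x hx => by
    obtain ⟨d, _, rfl⟩ := List.mem_map.1 hx
    exact hK d

variable {B : BlackBox σ} {K : Branch σ → ℝ} {P : Prog} {m : ℕ → ℕ} {ψ : JointState σ} {z : ℝ}

theorem lb_iterVal_zero (h : LB K m ψ z) : LB (iterVal B K P 0) m ψ z := by
  intro t
  simpa [iterVal, iter] using h t

theorem lb_iterVal_succ {k : ℕ} (h : LB (val B (iterVal B K P k) P) m ψ z) :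
    LB (iterVal B K P (k + 1)) m ψ z := by
  intro t
  rw [iterVal, iter, sum_flatMap]
  exact h (t + 1)

theorem lb_loop {k : ℕ} {e : CExpr} (hk : e.eval m = k) (h : LB (iterVal B K P k) m ψ z) :
    LB (val B K (.loop e P)) m ψ z := by
  intro t
  rw [val, exec_loop, hk]
  exact h _

end Value

/-! ### Sampling a branch query by query -/

section Binomial

theorem choose_two_steps (k b : ℕ) :
    (b + 2 + k) * (b + 1 + k) * (b + k).choose k = (b + 2 + k).choose k * ((b + 2) * (b + 1)) := by
  have h1 := Nat.choose_mul_succ_eq (b + k) k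
  have h2 := Nat.choose_mul_succ_eq (b + k + 1) k
  rw [show b + k + 1 - k = b + 1 by omega] at h1
  rw [show b + k + 1 + 1 - k = b + 2 by omega] at h2
  rw [show b + 2 + k = b + k + 1 + 1 by ring, show b + 1 + k = b + k + 1 by ring]
  calc _ = (b + k + 1 + 1) * ((b + k).choose k * (b + k + 1)) := by ring
    _ = (b + 1) * ((b + k + 1).choose k * (b + k + 1 + 1)) := by rw [h1]; ring
    _ = _ := by rw [h2]; ring

theorem choose_two_steps' (k b : ℕ) :
    (b + 3 + k) * (b + 2 + k) * (b + 1 + k).choose k =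
      (b + 3 + k).choose (k + 1) * ((k + 1) * (b + 2)) := by
  have h1 := Nat.choose_mul_succ_eq (b + 1 + k) k
  have h2 := Nat.add_one_mul_choose_eq (b + 2 + k) k
  rw [show b + 1 + k + 1 - k = b + 2 by omega] at h1
  rw [show b + 3 + k = b + 2 + k + 1 by ring, show b + 2 + k = b + 1 + k + 1 by ring] at *
  calc _ = (b + 1 + k + 1 + 1) * ((b + 1 + k).choose k * (b + 1 + k + 1)) := by ring
    _ = (b + 2) * ((b + 1 + k + 1 + 1) * (b + 1 + k + 1).choose k) := by rw [h1]; ring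
    _ = _ := by rw [h2]; ring

/-- The step of the recursion for the weights of the leaves. -/
theorem div_choose_le_sum (κ k : ℕ) {r₀ r₁ r₂ : ℝ} (h0 : 0 ≤ r₀) (h1 : 0 ≤ r₁) (h2 : 0 ≤ r₂)
    (hk : k = 0 → r₀ = 0 ∧ r₁ = 0) {M : ℕ}
    (hM : M = (2 * (κ + 1) + k) * (2 * (κ + 1) + k - 1)) :
    (r₂ + (r₀ + r₁)) / (2 * (κ + 1) + k).choose k ≤
      ∑ u ∈ Finset.range M, (if u < k * (2 * (κ + 1)) then
        r₀ / (2 * κ + (k - 1)).choose (k - 1) / M else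
        if u < 2 * (k * (2 * (κ + 1))) then r₁ / (2 * κ + (k - 1)).choose (k - 1) / M else
          r₂ / (2 * κ + k).choose k / M) := by
  set w := k * (2 * (κ + 1)) with hw
  have hM' : M = (2 * κ + 2 + k) * (2 * κ + 1 + k) := by
    rw [hM]; congr 1; omega
  -- The difference of the two sides is k² - k. So passing on without extraction is at least as
  -- likely as for a uniformly random set of k among 2(κ+1) + k slots that avoids two given slots.
  have hwM : (2 * κ + 2) * (2 * κ + 1) + 2 * w ≤ M := by
    rw [hM', hw]
    have : k ≤ k * k := Nat.le_mul_self k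
    nlinarith
  obtain ⟨r, hr⟩ : ∃ r, M = 2 * w + r := ⟨M - 2 * w, by omega⟩
  have hsum : ∀ a b c : ℝ, ∑ u ∈ Finset.range M, (if u < w then a else if u < 2 * w then b else c) =
      w * a + w * b + r * c := by
    intro a b c
    rw [hr, two_mul, Finset.sum_range_add, Finset.sum_range_add]
    congr 1
    · congr 1
      · rw [Finset.sum_congr rfl fun u hu => if_pos (Finset.mem_range.1 hu)]; simp
      · rw [Finset.sum_congr rfl (g := fun _ => b)]
        · simp
        · intro u hu
          have := Finset.mem_range.1 hu
          rw [if_neg (by omega), if_pos (by omega)]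
    · rw [Finset.sum_congr rfl (g := fun _ => c)]
      · simp
      · intro u hu
        rw [if_neg (by omega), if_neg (by omega)]
  rw [hsum]
  have hMpos : (0 : ℝ) < M := by
    have : 0 < M := by rw [hM']; positivity
    exact_mod_cast this
  have hC0 : (0 : ℝ) < (2 * (κ + 1) + k).choose k := by
    exact_mod_cast Nat.choose_pos (by omega)
  have hC1 : (0 : ℝ) < (2 * κ + k).choose k := by exact_mod_cast Nat.choose_pos (by omega)
  have hC2 : (0 : ℝ) < (2 * κ + (k - 1)).choose (k - 1) := by
    exact_mod_cast Nat.choose_pos (by omega)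
  -- The number r of values of u without extraction is at least (2κ+2)(2κ+1), and for that number
  -- `choose_two_steps` would give equality.
  have e2 : r₂ / (2 * (κ + 1) + k).choose k ≤ r * (r₂ / (2 * κ + k).choose k / M) := by
    have h := choose_two_steps k (2 * κ)
    have hr' : (2 * κ + 2) * (2 * κ + 1) ≤ r := by omega
    have h3 : M * (2 * κ + k).choose k ≤ (2 * (κ + 1) + k).choose k * r := by
      rw [hM', h, show 2 * (κ + 1) + k = 2 * κ + 2 + k by ring]
      exact Nat.mul_le_mul_left _ hr'
    have h3' : (M * (2 * κ + k).choose k : ℝ) ≤ (2 * (κ + 1) + k).choose k * r := by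
      exact_mod_cast h3
    rw [div_div, mul_div_assoc', div_le_div_iff₀ hC0 (by positivity)]
    nlinarith
  -- `choose_two_steps'` is an identity with 2κ + 1 free slots; only 2κ are needed after an
  -- extraction, which just makes the coefficient smaller.
  have e01 : ∀ x : ℝ, 0 ≤ x → (k = 0 → x = 0) → x / (2 * (κ + 1) + k).choose k ≤
      w * (x / (2 * κ + (k - 1)).choose (k - 1) / M) := by
    intro x hx hxk
    rcases Nat.eq_zero_or_pos k with h | h
    · rw [hxk h]; simp
    obtain ⟨j, rfl⟩ : ∃ j, k = j + 1 := ⟨k - 1, by omega⟩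
    have h3 : M * (2 * κ + j).choose j ≤ (2 * (κ + 1) + (j + 1)).choose (j + 1) * w := by
      have h4 := choose_two_steps' j (2 * κ)
      have h5 : (2 * κ + j).choose j ≤ (2 * κ + 1 + j).choose j :=
        Nat.choose_le_choose _ (by omega)
      rw [hM', hw, show 2 * (κ + 1) + (j + 1) = 2 * κ + 3 + j by ring,
        show 2 * (κ + 1) = 2 * κ + 2 by ring, ← h4,
        show 2 * κ + 2 + (j + 1) = 2 * κ + 3 + j by ring,
        show 2 * κ + 1 + (j + 1) = 2 * κ + 2 + j by ring]
      exact Nat.mul_le_mul_left _ h5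
    rw [Nat.add_sub_cancel] at hC2 ⊢
    have h3' : (M * (2 * κ + j).choose j : ℝ) ≤ (2 * (κ + 1) + (j + 1)).choose (j + 1) * w := by
      exact_mod_cast h3
    rw [div_div, mul_div_assoc', div_le_div_iff₀ hC0 (by positivity)]
    nlinarith
  have e0 := e01 r₀ h0 fun h => (hk h).1
  have e1 := e01 r₁ h1 fun h => (hk h).2
  rw [add_div, add_div]
  linarith

end Binomial

/-- The output of stage `s` belongs to `x`. -/
def HashNumbering.StageOk {U X : Type*} [DecidableEq U] [Fintype X] {X₀ Y : Finset U} {n : ℕ}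
    (N : HashNumbering X X₀ Y) (x : X₀ × (Fin n → X)) (s : ℕ) (o : ℕ × ℕ) : Prop :=
  (∀ h : s < n, o.1 = N.right (x.2 ⟨s, h⟩)) ∧ (s = 0 → o.2 = N.left (leftOfX x.1))

theorem lb_iterVal_done {σ : Type*} [Fintype σ] {P : SimParams} {m : ℕ → ℕ} {ψ : JointState σ}
    {z : ℝ} {K : Branch σ → ℝ} {B : BlackBox σ} (h8 : m 8 ≠ 0) (κ : ℕ)
    (h : Prog.LB K m ψ z) : Prog.LB (iterVal B K P.iteration κ) m ψ z := by
  induction κ with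
  | zero => exact lb_iterVal_zero h
  | succ κ ih => exact lb_iterVal_succ (Prog.LB.ite_pos (e := var 8) h8 (Prog.step_skip.lb ih))

theorem JointState.normSq_nonneg {σ : Type*} (ψ : JointState σ) : 0 ≤ ψ.normSq :=
  Finset.sum_nonneg fun _ _ => sq_nonneg _

/-! ### The simulator realizes the branches in the right order -/

section Box

open SimParams Prog

variable {U X : Type*} [DecidableEq U] [Fintype X] {X₀ Y : Finset U} {n : ℕ}
  (N : HashNumbering X X₀ Y) {σ R Z E : Type*} [Fintype σ] [DecidableEq σ] {q : ℕ}
  [AddCommGroup Y] (A : OracleAlg (↥(X₀ ∪ Y) × X) Y (X₀ × (Fin n → X)) σ R Z E q)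
  (P : SimParams) (x : X₀ × (Fin n → X)) (Q : Matrix Z Z ℂ) (msg : ℕ → ℕ)

/-- The probability that register `Z` passes the test `Q`. -/
noncomputable def leafVal (d : Branch σ) : ℝ := (d.state.applyBox (A.liftZ Q)).normSq

open Classical in
/-- The expected value of the remaining stages. -/
noncomputable def restVal : ℕ → ℕ → Branch σ → ℝ :=
  stageVal (A.blackBox N) P.stage P.lastStage msg (N.StageOk x) (leafVal A Q)

open Classical in
/-- The expected value after stage `s`. -/
noncomputable def okVal (k s : ℕ) (d : Branch σ) : ℝ :=
  if N.StageOk x s (d.mem 1, d.mem 2) then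
    restVal N A P x Q msg k (s + 1) { d with mem := Function.update d.mem 0 (msg s) } else 0

/-- The expected value after the search in stage `s`. -/
noncomputable def afterVal : ℕ → ℕ → Branch σ → ℝ
  | 0, _ => leafVal A Q
  | k + 1, s => val (A.blackBox N) (okVal N A P x Q msg k s) P.finish

theorem restVal_nonneg (k s : ℕ) (c : Branch σ) : 0 ≤ restVal N A P x Q msg k s c := by
  classical
  exact stageVal_nonneg _ _ _ _ _ (fun _ => JointState.normSq_nonneg _) _ _ _

theorem okVal_nonneg (k s : ℕ) (c : Branch σ) : 0 ≤ okVal N A P x Q msg k s c := by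
  unfold okVal
  split_ifs
  · exact restVal_nonneg ..
  · exact le_rfl

theorem afterVal_nonneg (k s : ℕ) (c : Branch σ) : 0 ≤ afterVal N A P x Q msg k s c := by
  cases k with
  | zero => exact JointState.normSq_nonneg _
  | succ k => exact val_nonneg (okVal_nonneg N A P x Q msg k s) c

/-- Middle and last stages both record and then search; what differs afterwards is hidden in
`afterVal`, so later arguments need not distinguish them. -/
theorem restVal_eq {k s : ℕ} (hs : s + 1 + k = P.n) (c : Branch σ) :
    restVal N A P x Q msg k (s + 1) c =
      val (A.blackBox N) (val (A.blackBox N) (afterVal N A P x Q msg k (s + 1)) P.search)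
        P.record c := by
  classical
  cases k with
  | zero => exact val_seq c
  | succ k =>
    have h1 : P.stage (s + 1) = P.midStage := by
      rw [stage, if_neg (by omega), if_pos (by omega)]
    change val _ (okVal N A P x Q msg k (s + 1)) (P.stage (s + 1)) c = _
    rw [h1, midStage, val_seq]
    congr 1
    ext d
    exact val_seq d

variable {N A P x Q msg} {m : ℕ → ℕ} {β s k i p d : ℕ} {ψ : JointState σ}
  {H : ↥(X₀ ∪ Y) × X → Y} {z : ℝ}

theorem lb_okVal (hb : P.Big β q) (hs : s + 1 + k = P.n) (h : P.Inv β q s m)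
    (hmsg : msg s < 2 ^ β)
    (hok : N.StageOk x s (m 1, m 2))
    (hz : LB (val (A.blackBox N) (afterVal N A P x Q msg k (s + 1)) P.search)
      (recordMem P s (Function.update m 0 (msg s))) ψ z) :
    LB (okVal N A P x Q msg k s) m ψ z := by
  intro t
  rw [okVal, if_pos hok, restVal_eq N A P x Q msg hs]
  exact (step_record A hb (h.update hmsg (by simp)) (by omega)).1.lb hz t

theorem lb_search {K : Branch σ → ℝ} (hb : P.Big β q)
    {κ : ℕ} {φ : σ → ℂ} (hJ : ∀ m, MemAt N P β q s H i 0 0 m →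
      LB (iterVal (A.blackBox N) K P.iteration κ) m (emb (fun _ => 0) φ) z)
    (h : MemAt N P β q s H i 0 d m) (hi : i + κ = q) :
    LB (val (A.blackBox N) K P.search) m (emb (fun _ => 0) φ) z := by
  refine LB.seq (LB.ite_neg (e := var 7) h.seven (step_skip.lb (LB.seq
    ((h.inv.step_assign_lit (by omega) (by omega)).lb ?_))))
  have h8 := h.update_eight hb (v := 0) (by omega)
  refine lb_loop ?_ (hJ _ h8)
  have h3 := h8.inv.three
  have h5 := h8.five
  simp only [CExpr.eval, ArithOp.apply, h3, h5]
  omega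

theorem lb_search_pending {K : Branch σ → ℝ} (hP : N.Params P) (hb : P.Big β q) (hs : s ≤ P.n)
    {κ : ℕ} {φ : σ → ℂ} (hJ : ∀ m, MemAt N P β q s H (i + 1) 0 0 m →
      LB (iterVal (A.blackBox N) K P.iteration κ) m (emb (fun _ => 0) (A.adv i H φ)) z)
    (h : MemAt N P β q s H i 1 d m) (hi : i + (κ + 1) = q) :
    LB (val (A.blackBox N) K P.search) m (emb (fun _ => 0) φ) z := by
  have hlen := hb.len
  have h7 : m 7 ≠ 0 := by rw [h.seven]; omega
  have h1 := step_pending A hP hb hs h.inv h7 φ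
  rw [h.hash, h.five] at h1
  have hm : MemAt N P β q s H (i + 1) 0 d
      (Function.update (Function.update (Function.update m 10 0) 5 (i + 1)) 7 0) := by
    have h2 := Inv.answer_pending hb h.inv h7
    rw [h.five] at h2
    refine ⟨h2, ?_, by simp, by simp, by simpa using h.eight⟩
    rw [N.hashFun_update _ (by omega) (by omega) (by omega) (by omega),
      N.hashFun_update _ (by omega) (by omega) (by omega) (by omega),
      N.hashFun_update _ (by omega) (by omega) (by omega) (by omega), h.hash]
  refine LB.seq (h1.lb (LB.seq ((hm.inv.step_assign_lit (by omega) (by omega)).lb ?_)))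
  have h8 := hm.update_eight hb (v := 0) (by omega)
  refine lb_loop ?_ (hJ _ h8)
  have h3 := h8.inv.three
  have h5 := h8.five
  simp only [CExpr.eval, ArithOp.apply, h3, h5]
  omega

/-- The value of the main loop in terms of the values in case of an extraction and in case there is
none. -/
theorem lb_iterVal [DecidableEq X] {K : Branch σ → ℝ} (hK : ∀ c, 0 ≤ K c) (hP : N.Params P)
    (hb : P.Big β q) (hn : P.n = n) (hn0 : 0 < n) (hs : s + k = n)
    {leaf : (σ → ℂ) → ℝ} (hl : ∀ φ, 0 ≤ leaf φ) (hla : ∀ (a : ℂ) φ, leaf (a • φ) = ‖a‖ ^ 2 * leaf φ)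
    (v : Fin n → ↥(X₀ ∪ Y) × X) (Θ : Fin n → Y)
    (hbase : ∀ H m φ, MemAt N P β q s H q 0 0 m → LB K m (emb (fun _ => 0) φ) (leaf φ))
    (hdone : ∀ (h : s < n) H m φ κ i, MemAt N P β q s H i 0 1 m → i + κ = q →
      m 2 = N.left (v ⟨s, h⟩).1 → m 1 = N.right (v ⟨s, h⟩).2 →
      LB K m (emb (fun _ => 0) φ) (A.rightV leaf v Θ κ (s + 1)
        (Function.update H (v ⟨s, h⟩) (Θ ⟨s, h⟩)) φ / (2 * κ + (k - 1)).choose (k - 1)))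
    (hpend : ∀ (h : s < n) H m φ κ i, MemAt N P β q s H i 1 1 m → i + (κ + 1) = q →
      m 2 = N.left (v ⟨s, h⟩).1 → m 1 = N.right (v ⟨s, h⟩).2 →
      LB K m (emb (fun _ => 0) φ) (A.rightV leaf v Θ κ (s + 1)
        (Function.update H (v ⟨s, h⟩) (Θ ⟨s, h⟩))
        (A.adv i (Function.update H (v ⟨s, h⟩) (Θ ⟨s, h⟩)) φ) /
          (2 * κ + (k - 1)).choose (k - 1)))
    (κ : ℕ) : ∀ i H m φ, MemAt N P β q s H i 0 0 m → i + κ = q →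
      LB (iterVal (A.blackBox N) K P.iteration κ) m (emb (fun _ => 0) φ)
        (A.rightV leaf v Θ κ s H φ / (2 * κ + k).choose k) := by
  induction κ with
  | zero =>
    intro i H m φ h hi
    have := hbase H m φ (by rwa [show i = q by omega] at h)
    refine lb_iterVal_zero ?_
    simpa [OracleAlg.rightV] using this
  | succ κ ih =>
    intro i H m φ h hi
    -- When all points are extracted there is no next one; any point will do, because then k = 0 and
    -- the simulator never measures.
    obtain ⟨w, hw⟩ : ∃ w, ∀ h : s < n, w = v ⟨s, h⟩ := by
      by_cases h : s < n
      · exact ⟨v ⟨s, h⟩, fun _ => rfl⟩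
      · exact ⟨v ⟨0, hn0⟩, fun h' => absurd h' h⟩
    obtain ⟨θ, hθ⟩ : ∃ θ, ∀ h : s < n, θ = Θ ⟨s, h⟩ := by
      by_cases h : s < n
      · exact ⟨Θ ⟨s, h⟩, fun _ => rfl⟩
      · exact ⟨0, fun h' => absurd h' h⟩
    set M := (2 * (κ + 1) + k) * (2 * (κ + 1) + k - 1) with hM
    set H' := Function.update H w θ with hH'
    set φ' := ((1 / Real.sqrt M : ℝ) : ℂ) • φ with hφ'
    -- The amplitude 1/√M of a random choice becomes a factor 1/M in every value that follows.
    have hscale : ∀ κ s H (L : (σ → ℂ) →ₗ[ℂ] (σ → ℂ)), A.rightV leaf v Θ κ s H (L φ') =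
        A.rightV leaf v Θ κ s H (L φ) / M := by
      intro κ s H L
      rw [hφ', map_smul, A.rightV_smul hla]
      rw [Complex.norm_real, Real.norm_eq_abs, sq_abs, div_pow, Real.sq_sqrt (by positivity)]
      ring
    -- In `r₀` the query is answered after the update, hence left open until the next stage; in `r₁`
    -- it is answered before.
    set r₀ := if s < n then A.rightV leaf v Θ κ (s + 1) H' (A.adv i H' (A.proj w φ)) else 0
    set r₁ := if s < n then A.rightV leaf v Θ κ (s + 1) H' (A.adv i H (A.proj w φ)) else 0
    set r₂ := A.rightV leaf v Θ κ s H (A.adv i H φ)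
    have hR : A.rightV leaf v Θ (κ + 1) s H φ = r₂ + (r₀ + r₁) := by
      rw [OracleAlg.rightV, show q - (κ + 1) = i by omega]
      congr 1
      by_cases hsn : s < n
      · rw [dif_pos hsn, ← hw hsn, ← hθ hsn]
        simp only [r₀, r₁, if_pos hsn]
        rfl
      · simp [r₀, r₁, hsn]
    have hr : ∀ s H φ, 0 ≤ A.rightV leaf v Θ κ s H φ := fun s H φ => A.rightV_nonneg hl ..
    have hr₀ : 0 ≤ r₀ := by simp only [r₀]; split_ifs <;> simp [hr]
    have hr₁ : 0 ≤ r₁ := by simp only [r₁]; split_ifs <;> simp [hr]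
    -- If the wanted outcome has amplitude zero, the measurement has no such branch, and the bounds
    -- have to vanish as well.
    have hproj : A.proj w φ' = 0 → r₀ / M = 0 ∧ r₁ / M = 0 := by
      intro h0
      have e0 := hscale κ (s + 1) H' ((A.adv i H').comp (A.proj w))
      have e1 := hscale κ (s + 1) H' ((A.adv i H).comp (A.proj w))
      have hz : A.rightV leaf v Θ κ (s + 1) H' 0 = 0 := by
        have := A.rightV_smul hla v Θ κ (s + 1) H' 0 0
        simpa using this
      simp only [LinearMap.comp_apply, h0, map_zero, hz] at e0 e1
      constructor
      · simp only [r₀]; split_ifs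
        · exact e0.symm
        · simp
      · simp only [r₁]; split_ifs
        · exact e1.symm
        · simp
    refine lb_iterVal_succ (LB.trans (lb_iteration A (fun c => iterVal_nonneg hK _ _ c) hP hb
      (by omega) h hi w φ hM hφ' (z₀ := r₀ / (2 * κ + (k - 1)).choose (k - 1) / M)
      (z₁ := r₁ / (2 * κ + (k - 1)).choose (k - 1) / M)
      (z₂ := r₂ / (2 * κ + k).choose k / M) ?_ ?_ ?_ ?_ ?_) ?_)
    · intro hk m' hm' h2 h1
      have hsn : s < n := by omega
      refine lb_iterVal_done (by rw [hm'.eight]; omega) κ ?_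
      rw [hw hsn] at h1 h2
      have := hpend hsn H m' (A.proj w φ') κ i hm' hi h2 h1
      rw [← hw hsn, ← hθ hsn] at this
      have e0 := hscale κ (s + 1) H' ((A.adv i H').comp (A.proj w))
      simp only [LinearMap.comp_apply] at e0
      rw [e0] at this
      simp only [r₀, if_pos hsn]
      rwa [div_right_comm]
    · intro hk m' hm' h2 h1
      have hsn : s < n := by omega
      refine lb_iterVal_done (by rw [hm'.eight]; omega) κ ?_
      rw [hw hsn] at h1 h2
      have := hdone hsn H m' (A.adv i H (A.proj w φ')) κ (i + 1) hm' (by omega) h2 h1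
      rw [← hw hsn, ← hθ hsn] at this
      have e0 := hscale κ (s + 1) H' ((A.adv i H).comp (A.proj w))
      simp only [LinearMap.comp_apply] at e0
      rw [e0] at this
      simp only [r₁, if_pos hsn]
      rwa [div_right_comm]
    · intro m' hm'
      have := ih (i + 1) H m' (A.adv i H φ') hm' (by omega)
      rw [hscale] at this
      rwa [div_right_comm]
    · intro h0
      rw [div_right_comm, (hproj h0).1, zero_div]
    · intro h0
      rw [div_right_comm, (hproj h0).2, zero_div]
    · rw [hR]
      refine div_choose_le_sum κ k hr₀ hr₁ (hr ..) (fun hk => ?_) hM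
      have hsn : ¬ s < n := by omega
      simp [r₀, r₁, hsn]

end Box

/-- The points of the hash chain of `x` if the hashes are `Θ`. -/
def chainPt {U X : Type*} [DecidableEq U] {X₀ Y : Finset U} {n : ℕ} (x : X₀ × (Fin n → X))
    (Θ : Fin n → Y) (j : Fin n) : ↥(X₀ ∪ Y) × X :=
  (if (j : ℕ) = 0 then leftOfX x.1 else leftOfY (Θ ⟨j - 1, by omega⟩), x.2 j)

namespace OracleAlg

variable {D Y O σ R Z E : Type*} [Fintype σ] [DecidableEq σ] {q : ℕ}

theorem outNsq_le (A : OracleAlg D Y O σ R Z E q) (x : O) (φ : σ → ℂ) : A.outNsq x φ ≤ nsq φ :=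
  Finset.sum_le_sum fun s _ => by
    split_ifs
    · exact le_rfl
    · positivity

/-- The predicate acts on register `Z` only and commutes with the projection onto output x. Hence
reading components of x off the output register does not change the success value. -/
theorem test_congr [Fintype Z] (A : OracleAlg D Y O σ R Z E q) {x : O} (Q : Matrix Z Z ℂ)
    {φ ψ : σ → ℂ} (h : ∀ s, (A.outReg s).1 = x → φ s = ψ s) : A.test x Q φ = A.test x Q ψ := by
  have h1 : A.outProj x φ = A.outProj x ψ := by
    ext s
    simp only [outProj, LinearMap.coe_mk, AddHom.coe_mk]
    split_ifs with hs
    · exact h s hs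
    · rfl
  simp only [test, LinearMap.comp_apply, Matrix.mulVecLin_apply]
  rw [← liftZ_outProj, ← liftZ_outProj, h1]

end OracleAlg

theorem HashNumbering.stageOk_chainPt {U X : Type*} [DecidableEq U] [Fintype X] {X₀ Y : Finset U}
    {n s : ℕ} {N : HashNumbering X X₀ Y} {m : ℕ → ℕ} {x : X₀ × (Fin n → X)} {Θ : Fin n → Y} (hs : s < n)
    (h2 : m 2 = N.left (chainPt x Θ ⟨s, hs⟩).1) (h1 : m 1 = N.right (chainPt x Θ ⟨s, hs⟩).2) :
    N.StageOk x s (m 1, m 2) := by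
  refine ⟨fun _ => h1, fun h0 => ?_⟩
  subst h0
  simpa [chainPt] using h2

section Box

open SimParams Prog

variable {U X : Type*} [DecidableEq U] [Fintype X] {X₀ Y : Finset U} {n : ℕ}
  {N : HashNumbering X X₀ Y} {σ R Z E : Type*} [Fintype σ] [DecidableEq σ] {q : ℕ}
  [AddCommGroup Y] {A : OracleAlg (↥(X₀ ∪ Y) × X) Y (X₀ × (Fin n → X)) σ R Z E q}
  {P : SimParams} {x : X₀ × (Fin n → X)} {Q : Matrix Z Z ℂ} {msg : ℕ → ℕ}
  {m : ℕ → ℕ} {β s k i p d : ℕ} {H : ↥(X₀ ∪ Y) × X → Y} {z : ℝ}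

theorem MemAt.record (h : MemAt N P β q s H i p d m) (hb : P.Big β q) (hs : s < P.n) {b : ℕ}
    (hmsg : b < 2 ^ β) :
    MemAt N P β q (s + 1) (N.hashFun P (recordMem P s (Function.update m 0 b))) i p d
      (recordMem P s (Function.update m 0 b)) := by
  have h0 := h.update (k := 0) hmsg (by simp) (by omega)
  have e : ∀ a, a < 16 → a ≠ 6 → recordMem P s (Function.update m 0 b) a =
      Function.update m 0 b a := by
    intro a ha ha6
    simp [recordMem, ha6, show a ≠ 17 + 4 * s by omega, show a ≠ 18 + 4 * s by omega]
  have hst : P.Inv β q (s + 1) (recordMem P s (Function.update m 0 b)) := by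
    have h4 := h.inv.ready.two_le
    have h1 := h0.inv.update (k := 17 + 4 * s)
      (v := (Function.update m 0 b 2 * P.cX + Function.update m 0 b 1) % Function.update m 0 b 4)
      ((Nat.mod_lt _ (by simp; omega)).trans (h0.inv.ready.bd 4))
      (by simp only [Finset.mem_insert, Finset.mem_singleton]; omega)
    exact (h1.update (k := 18 + 4 * s) (v := Function.update m 0 b 0) (h0.inv.ready.bd 0)
      (by simp only [Finset.mem_insert, Finset.mem_singleton]; omega)).update_six hb (by omega)
  refine ⟨hst, rfl, ?_, ?_, ?_⟩
  · rw [e 5 (by omega) (by omega), h0.five]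
  · rw [e 7 (by omega) (by omega), h0.seven]
  · rw [e 8 (by omega) (by omega), h0.eight]

theorem MemAt.record_hash [DecidableEq X] (h : MemAt N P β q s H i p d m) (hP : N.Params P)
    (hb : P.Big β q) (hs : s < P.n)
    {v : ↥(X₀ ∪ Y) × X} {θ : Y} (h2 : m 2 = N.left v.1) (h1 : m 1 = N.right v.2) :
    MemAt N P β q (s + 1) (Function.update H v θ) i p d
      (recordMem P s (Function.update m 0 (N.ofY θ))) := by
  have hY : N.ofY θ < 2 ^ β := by
    refine lt_trans ?_ h.inv.ready.fits.cY_lt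
    rw [hP.cY_eq]; exact N.ofY_lt θ
  have h0 := h.update (k := 0) hY (by simp) (by omega)
  have h3 := h.record hb hs hY
  rwa [hashFun_recordMem hP h0.inv (v := v) (θ := θ) (by simpa using h2) (by simpa using h1)
    (by simp), h0.hash] at h3

theorem lb_finish_done {K : Branch σ → ℝ} {ψ : JointState σ}
    (h : MemAt N P β q s H i p 1 m) (hK : LB K m ψ z) :
    LB (val (A.blackBox N) K P.finish) m ψ z :=
  LB.ite_pos (e := var 8) (by simp [CExpr.eval, h.eight]) (step_skip.lb hK)

theorem lb_finish [Fintype Z] {K : Branch σ → ℝ} (hK : ∀ c, 0 ≤ K c) (hP : N.Params P)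
    (hb : P.Big β q) (hs : s < n) (h : MemAt N P β q s H q 0 0 m) (φ : σ → ℂ)
    (hz : ∀ m' φ', MemAt N P β q s H q 0 0 m' → N.StageOk x s (m' 1, m' 2) →
      A.test x Q φ' = A.test x Q φ →
      LB K m' (emb (fun _ => 0) φ') (nsq (A.test x Q φ'))) :
    LB (val (A.blackBox N) K P.finish) m (emb (fun _ => 0) φ) (nsq (A.test x Q φ)) := by
  have hlen := hb.len
  have hf := h.inv.ready.fits
  have hX := hf.cX_lt
  have hL := hf.cL_lt
  have hβ := h.inv.ready.one_le
  have hr : (N.right (x.2 ⟨s, hs⟩) : ℕ) < 2 ^ β := by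
    refine lt_trans ?_ hX; rw [hP.cX_eq]; exact Fin.is_lt _
  have hl : (N.left (leftOfX x.1) : ℕ) < 2 ^ β := by
    refine lt_trans ?_ hL; rw [hP.cL_eq]; exact Fin.is_lt _
  have h6 : ∀ v, Function.update m 1 v 6 = s := fun v => by simpa using h.inv.six
  set φ1 := restr (A.blackBox N) m (.out (.bin .add (.lit 1) (var 6))) (N.right (x.2 ⟨s, hs⟩)) φ
    with hφ1
  have ht1 : A.test x Q φ1 = A.test x Q φ := by
    refine A.test_congr Q fun t ht => ?_
    rw [hφ1, restr, content_out_succ A h.inv.six hs, if_pos (by rw [ht])]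
  have hzero : ∀ φ' : σ → ℂ, A.test x Q φ' = A.test x Q φ → φ' = 0 → nsq (A.test x Q φ) ≤ 0 := by
    rintro _ h rfl
    rw [← h, map_zero, nsq_zero]
  refine LB.ite_neg (e := var 8) h.eight (LB.seq (lb_grab (fun c => val_nonneg hK c) hβ
    h.inv.ready.bd (by simp only [Reg.Small, CExpr.Small]; omega) (by simp [Reg.nodes, CExpr.nodes])
    hX (range_out_succ A hP m) (fun _ => range_out_succ A hP _) (fun v t => ?_) (fun t => ?_)
    (by omega) φ _ hr ?_ (hzero _ ht1)))
  · rw [content_out_succ A (h6 v) hs, content_out_succ A h.inv.six hs]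
  · rw [content_out_succ A h.inv.six hs, hP.cX_eq]; exact Fin.is_lt _
  have h1 := h.update (k := 1) hr (by simp) (by omega)
  have hs6 := h1.inv.six
  by_cases hs0 : s = 0
  · refine LB.ite_neg (e := var 6) (hs6.trans hs0) ?_
    have ht2 : A.test x Q (restr (A.blackBox N) (Function.update m 1 (N.right (x.2 ⟨s, hs⟩) : ℕ))
        (.out (.lit 0)) (N.left (leftOfX x.1)) φ1) = A.test x Q φ := by
      refine (A.test_congr Q fun t ht => ?_).trans ht1
      refine if_pos ?_
      change (N.left (leftOfX (A.outReg t).1.1) : ℕ) = _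
      rw [ht]
    refine lb_grab hK hβ h1.inv.ready.bd (by simp only [Reg.Small, CExpr.Small]; omega)
      (by simp [Reg.nodes, CExpr.nodes]) hL hP.cL_eq.symm (fun _ => hP.cL_eq.symm)
      (fun v t => rfl) (fun t => ?_) (by omega) φ1 (N.left (leftOfX x.1)) hl ?_ (hzero _ ht2)
    · rw [hP.cL_eq]; exact Fin.is_lt _
    · rw [← ht2]
      refine hz _ _ (h1.update (k := 2) hl (by simp) (by omega)) ⟨fun _ => by simp, fun _ => by simp⟩ ht2
  · refine LB.ite_pos (e := var 6) (fun h => hs0 (hs6.symm.trans h)) (step_skip.lb ?_)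
    rw [← ht1]
    exact hz _ _ h1 ⟨fun _ => by simp, fun h => absurd h hs0⟩ ht1

/-- The heart of the simulation, by induction on the number k of points still to be output.
`lb_iterVal` treats one stage; its extraction cases hand over to the next stage, where the query is
either already answered or still open. Both situations must therefore be carried through the
induction. -/
theorem lb_afterVal_search [DecidableEq X] [Fintype Z] (hP : N.Params P) (hb : P.Big β q)
    (hn : P.n = n) (hn0 : 0 < n) {Θ : Fin n → Y} (hmsg : ∀ s h, msg s = N.ofY (Θ ⟨s, h⟩)) (k : ℕ) :
    ∀ s, s + k = n →
      (∀ κ i d H m φ, MemAt N P β q s H i 0 d m → i + κ = q →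
        LB (val (A.blackBox N) (afterVal N A P x Q msg k s) P.search) m (emb (fun _ => 0) φ)
          (A.rightV (fun φ => nsq (A.test x Q φ)) (chainPt x Θ) Θ κ s H φ /
            (2 * κ + k).choose k)) ∧
      (∀ κ i d H m φ, MemAt N P β q s H i 1 d m → i + (κ + 1) = q →
        LB (val (A.blackBox N) (afterVal N A P x Q msg k s) P.search) m (emb (fun _ => 0) φ)
          (A.rightV (fun φ => nsq (A.test x Q φ)) (chainPt x Θ) Θ κ s H (A.adv i H φ) /
            (2 * κ + k).choose k)) := by
  set leaf : (σ → ℂ) → ℝ := fun φ => nsq (A.test x Q φ) with hleaf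
  have hl : ∀ φ, 0 ≤ leaf φ := fun φ => nsq_nonneg _
  have hla : ∀ (a : ℂ) φ, leaf (a • φ) = ‖a‖ ^ 2 * leaf φ := fun a φ => by
    simp only [hleaf, map_smul, nsq_smul]
  have main : ∀ s k, s + k = n → (∀ κ i H m φ, MemAt N P β q s H i 0 0 m → i + κ = q →
      LB (iterVal (A.blackBox N) (afterVal N A P x Q msg k s) P.iteration κ) m (emb (fun _ => 0) φ)
        (A.rightV leaf (chainPt x Θ) Θ κ s H φ / (2 * κ + k).choose k)) →
      (∀ κ i d H m φ, MemAt N P β q s H i 0 d m → i + κ = q →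
        LB (val (A.blackBox N) (afterVal N A P x Q msg k s) P.search) m (emb (fun _ => 0) φ)
          (A.rightV leaf (chainPt x Θ) Θ κ s H φ / (2 * κ + k).choose k)) ∧
      (∀ κ i d H m φ, MemAt N P β q s H i 1 d m → i + (κ + 1) = q →
        LB (val (A.blackBox N) (afterVal N A P x Q msg k s) P.search) m (emb (fun _ => 0) φ)
          (A.rightV leaf (chainPt x Θ) Θ κ s H (A.adv i H φ) / (2 * κ + k).choose k)) :=
    fun s k hs hJ => ⟨fun κ i d H m φ h hi => lb_search hb (fun m h => hJ κ i H m φ h hi) h hi,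
      fun κ i d H m φ h hi => lb_search_pending hP hb (by omega)
        (fun m h => hJ κ (i + 1) H m _ h (by omega)) h hi⟩
  induction k with
  | zero =>
    intro s hs
    refine main s 0 hs fun κ => lb_iterVal (A := A) (afterVal_nonneg N A P x Q msg 0 s) hP hb hn hn0 hs
      hl hla (chainPt x Θ) Θ ?_ (fun h => absurd h (by omega)) (fun h => absurd h (by omega)) κ
    -- In the last stage every output has already been accepted. Testing only `Z` is weaker than
    -- also requiring that the output register hold x, which gives the inequality.
    intro H m φ h t
    simp only [hleaf, afterVal, leafVal]
    rw [applyBox_emb, normSq_emb, A.nsq_test]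
    exact A.outNsq_le _ _
  | succ k ih =>
    intro s hs
    have hsn : s < n := by omega
    obtain ⟨ih0, ih1⟩ := ih (s + 1) (by omega)
    refine main s (k + 1) hs fun κ => lb_iterVal (A := A) (afterVal_nonneg N A P x Q msg (k + 1) s) hP
      hb hn hn0 hs hl hla (chainPt x Θ) Θ ?_ ?_ ?_ κ
    · intro H m φ h
      refine lb_finish (okVal_nonneg N A P x Q msg k s) hP hb hsn h φ fun m' φ' h' hok ht => ?_
      have hmlt : msg s < 2 ^ β := by
        rw [hmsg s hsn]
        refine lt_trans ?_ h.inv.ready.fits.cY_lt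
        rw [hP.cY_eq]; exact N.ofY_lt _
      refine lb_okVal hb (by omega) h'.inv hmlt hok ?_
      -- All q queries are used up and the point came from the output register. With κ = 0 the
      -- binomial coefficient is 1 and the recorded function no longer matters.
      have := ih0 0 q 0 _ _ φ' (h'.record hb (by omega) hmlt) (by omega)
      simpa [OracleAlg.rightV] using this
    · intro h H m φ κ i hm hi h2 h1
      have hmlt : msg s < 2 ^ β := by
        rw [hmsg s hsn]
        refine lt_trans ?_ hm.inv.ready.fits.cY_lt
        rw [hP.cY_eq]; exact N.ofY_lt _
      refine lb_finish_done hm (lb_okVal hb (by omega) hm.inv hmlt (HashNumbering.stageOk_chainPt h h2 h1) ?_)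
      have := ih0 κ i 1 _ _ φ (hm.record_hash hP hb (by omega) (θ := Θ ⟨s, h⟩) h2 h1) hi
      rwa [← hmsg s h] at this
    · intro h H m φ κ i hm hi h2 h1
      have hmlt : msg s < 2 ^ β := by
        rw [hmsg s hsn]
        refine lt_trans ?_ hm.inv.ready.fits.cY_lt
        rw [hP.cY_eq]; exact N.ofY_lt _
      refine lb_finish_done hm (lb_okVal hb (by omega) hm.inv hmlt (HashNumbering.stageOk_chainPt h h2 h1) ?_)
      have := ih1 κ i 1 _ _ φ (hm.record_hash hP hb (by omega) (θ := Θ ⟨s, h⟩) h2 h1) hi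
      rwa [← hmsg s h] at this

end Box

/-! ### The random polynomial in the first stage -/

/-- The memory after choosing the coefficients `c`. -/
def coeffMem {Q : ℕ} : (k : ℕ) → (Fin k → ZMod Q) → (ℕ → ℕ) → ℕ → ℕ
  | 0, _, m => m
  | k + 1, c, m => coeffMem k (Fin.tail c)
      (Function.update (Function.update m (16 + 4 * m 10) (c 0).val) 10 (m 10 + 1))

theorem coeffMem_of_ne {Q k : ℕ} (c : Fin k → ZMod Q) (m : ℕ → ℕ) {a : ℕ} (ha : a ≠ 10)
    (h : ∀ i < k, a ≠ 16 + 4 * (m 10 + i)) : coeffMem k c m a = m a := by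
  induction k generalizing m with
  | zero => rfl
  | succ k ih =>
    rw [coeffMem, ih]
    · rw [Function.update_of_ne ha, Function.update_of_ne]
      simpa using h 0 (by omega)
    · intro i hi
      have := h (i + 1) (by omega)
      rw [Function.update_self]
      omega

theorem coeffMem_apply {Q k : ℕ} (c : Fin k → ZMod Q) (m : ℕ → ℕ) (i : Fin k) :
    coeffMem k c m (16 + 4 * (m 10 + i)) = (c i).val := by
  induction k generalizing m with
  | zero => exact i.elim0
  | succ k ih =>
    rw [coeffMem]
    set m' := Function.update (Function.update m (16 + 4 * m 10) (c 0).val) 10 (m 10 + 1) with hm'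
    have h10 : m' 10 = m 10 + 1 := by simp [hm']
    refine Fin.cases ?_ (fun j => ?_) i
    · rw [Fin.val_zero, coeffMem_of_ne _ _ (by omega)]
      · simp only [hm', add_zero]
        rw [Function.update_of_ne (by omega), Function.update_self]
      · intro i _
        rw [h10]; omega
    · have := ih (Fin.tail c) m' j
      rw [h10] at this
      rw [Fin.val_succ, show m 10 + ((j : ℕ) + 1) = m 10 + 1 + j by ring, this]
      rfl

namespace SimParams

/-- Horner's scheme: the j-th coefficient is multiplied by the input in each of the t - 1 - j later
steps. -/
theorem chainVal_coeff {Q t : ℕ} [NeZero Q] {m : ℕ → ℕ} (h3 : 2 * m 3 = t) (h4 : m 4 = Q)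
    (c : Fin t → ZMod Q) (hc : ∀ i : Fin t, m (16 + 4 * i) = (c i).val) (v : ℕ) :
    chainVal m v t = (∑ j : Fin t, c j * (v : ZMod Q) ^ (t - 1 - j)).val := by
  have key : ∀ j ≤ t, (chainVal m v j : ZMod Q) =
      ∑ i ∈ Finset.range j, (m (16 + 4 * i) : ZMod Q) * (v : ZMod Q) ^ (j - 1 - i) := by
    intro j hj
    induction j with
    | zero => simp [chainVal]
    | succ j ih =>
      rw [chainVal, stepVal, if_pos (by omega), h4, ZMod.natCast_mod, Nat.cast_add, Nat.cast_mul,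
        ih (by omega), Finset.sum_range_succ, Finset.sum_mul]
      congr 1
      · refine Finset.sum_congr rfl fun i hi => ?_
        have := Finset.mem_range.1 hi
        rw [mul_assoc, ← pow_succ]
        congr 2
        omega
      · simp
  have hlt : chainVal m v t < Q := by
    have := chainVal_lt (m := m) (by rw [h4]; exact Nat.pos_of_neZero Q) v t
    rwa [h4] at this
  rw [← ZMod.val_cast_of_lt hlt, key t le_rfl, Finset.sum_range]
  congr 1
  refine Finset.sum_congr rfl fun j _ => ?_
  rw [hc, ZMod.natCast_zmod_val]

end SimParams

section Box

open SimParams Prog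

variable {U X : Type*} [DecidableEq U] [Fintype X] {X₀ Y : Finset U} {n : ℕ}
  {N : HashNumbering X X₀ Y} {σ R Z E : Type*} [Fintype σ] [DecidableEq σ] {q : ℕ}
  [AddCommGroup Y] {A : OracleAlg (↥(X₀ ∪ Y) × X) Y (X₀ × (Fin n → X)) σ R Z E q}
  {P : SimParams} {m : ℕ → ℕ} {β : ℕ}

/-- Every sampled coefficient scales the state by 1/√Q; quadratic homogeneity of G turns the k
samples into a uniform average over coefficient vectors. -/
theorem lb_coeffs {K : Branch σ → ℝ} (hF : P.Fine β q) {Q : ℕ} [NeZero Q]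
    (hQ : Q = P.p ^ (q + P.n + 3)) {G : (ℕ → ℕ) → (σ → ℂ) → ℝ}
    (hG : ∀ m (a : ℂ) φ, G m (a • φ) = ‖a‖ ^ 2 * G m φ)
    (hK : ∀ m φ, P.InitInv β q 0 m → LB K m (emb (fun _ => 0) φ) (G m φ)) (k : ℕ) :
    ∀ m φ, P.InitInv β q k m →
      LB (iterVal (A.blackBox N) K (.seq (.sample (arrayAt 16 (var 10))
        (.bin .sub (var 4) (.lit 1))) (.assign (.lit 10) (.bin .add (var 10) (.lit 1)))) k) m
        (emb (fun _ => 0) φ) ((∑ c : Fin k → ZMod Q, G (coeffMem k c m) φ) / Q ^ k) := by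
  have hlen := hF.len
  have hβ := hF.one_le
  have hc := hF.fits.const
  have hQ0 : 0 < Q := Nat.pos_of_neZero Q
  have hpow := hF.pow_lt
  induction k with
  | zero =>
    intro m φ h
    refine lb_iterVal_zero ?_
    simpa [coeffMem] using hK m φ h
  | succ k ih =>
    intro m φ h
    have ha : (arrayAt 16 (var 10)).eval m = 16 + 4 * m 10 := by simp [CExpr.eval, ArithOp.apply]
    have he : (CExpr.bin .sub (var 4) (.lit 1)).eval m + 1 = Q := by
      have : (CExpr.bin .sub (var 4) (.lit 1)).eval m = m 4 - 1 := by
        simp [CExpr.eval, ArithOp.apply]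
      rw [this, h.four, ← hQ]
      omega
    set a : ℂ := ((1 / Real.sqrt Q : ℝ) : ℂ) with had
    have ha2 : ‖a‖ ^ 2 = 1 / Q := by
      rw [had, Complex.norm_real, Real.norm_eq_abs, sq_abs, div_pow, Real.sq_sqrt (by positivity),
        one_pow]
    set m' : ℕ → ℕ → ℕ := fun v =>
      Function.update (Function.update m (16 + 4 * m 10) v) 10 (m 10 + 1) with hm'
    have hs := lb_sample (B := A.blackBox N) (K := val (A.blackBox N) (iterVal (A.blackBox N) K
      (.seq (.sample (arrayAt 16 (var 10))
        (.bin .sub (var 4) (.lit 1))) (.assign (.lit 10) (.bin .add (var 10) (.lit 1)))) k)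
      (.assign (.lit 10) (.bin .add (var 10) (.lit 1)))) (a := arrayAt 16 (var 10))
      (e := .bin .sub (var 4) (.lit 1)) (m := m) (fun _ => 0) φ
      (fun v => (∑ c : Fin k → ZMod Q, G (coeffMem k c (m' v)) (a • φ)) / Q ^ k) fun v hv => ?_
    · rw [he] at hs
      refine lb_iterVal_succ (LB.seq (hs.trans (le_of_eq ?_)))
      rw [← (Fin.consEquiv fun _ => ZMod Q).sum_comp, Fintype.sum_prod_type, Finset.sum_div]
      have e1 : ∀ f : ℕ → ℝ, ∑ v ∈ Finset.range Q, f v = ∑ v : ZMod Q, f v.val := by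
        intro f
        rw [Finset.sum_range]
        refine Fintype.sum_equiv (ZMod.finEquiv Q).toEquiv _ _ fun j => ?_
        congr 1
        cases Q with
        | zero => exact j.elim0
        | succ Q => rfl
      rw [e1]
      refine Finset.sum_congr rfl fun v _ => ?_
      simp only [hG, ha2, ← Finset.mul_sum]
      have e2 : ∀ c : Fin k → ZMod Q, coeffMem (k + 1) ((Fin.consEquiv fun _ => ZMod Q) (v, c)) m =
          coeffMem k c (m' v.val) := fun c => rfl
      simp only [e2, pow_succ]
      field_simp
    · have hv' : v < 2 ^ β := by omega
      have h1 := h.step hF (a := 16 + 4 * m 10) (by omega) hv'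
      have hst : ((1 / Real.sqrt (((CExpr.bin .sub (var 4) (.lit 1)).eval m : ℕ) + 1) : ℝ) : ℂ) = a := by
        rw [had, ← he]; push_cast; rfl
      rw [hst, ha]
      refine Step.lb ((step_assign hβ (fun a => ?_) (by simp only [CExpr.Small]; omega)
        (by simp [CExpr.nodes]) (by simp only [CExpr.Small]; omega) (by simp [CExpr.nodes])).cast
        (m'' := m' v) ?_ rfl) (ih (m' v) _ h1)
      · rw [Function.update_apply]; split_ifs
        · exact hv'
        · exact h.bd a
      · have : (10 : ℕ) ≠ 16 + 4 * m 10 := by omega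
        simp [CExpr.eval, ArithOp.apply, Function.update_of_ne this, hm']

theorem hashFun_coeffMem {Q : ℕ} [NeZero Q] (hQ : Q = P.p ^ (q + P.n + 3))
    (h : P.InitInv β q (2 * q) m) (c : Fin (2 * q) → ZMod Q) (d : ↥(X₀ ∪ Y) × X) :
    N.hashFun P (coeffMem (2 * q) c m) d =
      N.toY ((polyHash (fun d => (N.num d : ZMod Q)) c d).val % P.cY) := by
  have h10 : m 10 = 0 := by have := h.ten; omega
  have e : ∀ a < 10, coeffMem (2 * q) c m a = m a := fun a ha =>
    coeffMem_of_ne c m (by omega) fun i _ => by omega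
  rw [HashNumbering.hashFun, hashVal, e 3 (by omega), e 6 (by omega), h.three, h.six, add_zero,
    chainVal_coeff (Q := Q) (by rw [e 3 (by omega), h.three])
      (by rw [e 4 (by omega), h.four, hQ]) c]
  · rfl
  · intro i
    have := coeffMem_apply c m i
    rwa [h10, zero_add] at this

/-- For fixed answers Θ the whole run is worth at least the polynomial average of the right
branches, divided by the number of slot patterns. -/
theorem lb_restVal [DecidableEq X] [Fintype Z] (hP : N.Params P) (hF : P.Fine β q)
    (hn : P.n = n) (hn0 : 0 < n) {Q : ℕ} [NeZero Q] (hQ : Q = P.p ^ (q + P.n + 3))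
    {x : X₀ × (Fin n → X)} {V : Matrix Z Z ℂ} {msg : ℕ → ℕ}
    {Θ : Fin n → Y} (hmsg : ∀ s h, msg s = N.ofY (Θ ⟨s, h⟩)) (φ : σ → ℂ) :
    LB (restVal N A P x V msg n 0) (Function.update 0 0 q) (emb (fun _ => 0) φ)
      ((∑ c : Fin (2 * q) → ZMod Q, A.rightV (fun φ => nsq (A.test x V φ)) (chainPt x Θ) Θ q 0
        (fun d => N.toY ((polyHash (fun d => (N.num d : ZMod Q)) c d).val % P.cY)) φ) /
          Q ^ (2 * q) / (2 * q + n).choose n) := by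
  classical
  have hlen := hF.len
  have hβ := hF.one_le
  have hc := hF.fits.const
  have hpow := hF.pow_lt
  obtain ⟨k, rfl⟩ : ∃ k, n = k + 1 := ⟨n - 1, by omega⟩
  have e0 : restVal N A P x V msg (k + 1) 0 =
      val (A.blackBox N) (okVal N A P x V msg k 0) P.firstStage := rfl
  rw [e0]
  refine LB.seq (Step.lb (m' := Function.update (Function.update 0 0 q) 3 q)
    ((step_assign (a := .lit 3) (e := var 0) hβ (fun a => ?_)
      (by simp only [CExpr.Small]; omega) (by simp [CExpr.nodes])
      (by simp only [CExpr.Small]; omega) (by simp [CExpr.nodes])).cast (by simp [CExpr.eval]) rfl)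
      (LB.seq ((step_initModulus hF _).lb (LB.seq (LB.seq (Step.lb (step_assign (a := .lit 10)
        (e := .lit 0) hβ (fun a => ?_) (by simp only [CExpr.Small]; omega) (by simp [CExpr.nodes])
      (by simp only [CExpr.Small]; omega) (by simp [CExpr.nodes])) ?_))))))
  · simp only [Function.update_apply, Pi.zero_apply]
    split_ifs <;> omega
  · simp only [Function.update_apply, Pi.zero_apply]
    split_ifs <;> omega
  have hI := initInv_start hF
  simp only [CExpr.eval]
  set m₀ := Function.update (Function.update (Function.update (Function.update (0 : ℕ → ℕ) 0 q)
      3 q) 4 (P.p ^ (q + P.n + 3))) 10 0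
  have hla : ∀ (a : ℂ) φ, nsq (A.test x V (a • φ)) = ‖a‖ ^ 2 * nsq (A.test x V φ) := fun a φ => by
    simp only [map_smul, nsq_smul]
  have key := lb_coeffs (N := N) (A := A) (K := val (A.blackBox N)
    (okVal N A P x V msg k 0) (.seq P.search P.finish)) hF hQ
    (G := fun m φ => A.rightV (fun φ => nsq (A.test x V φ)) (chainPt x Θ) Θ q 0 (N.hashFun P m) φ /
      (2 * q + (k + 1)).choose (k + 1)) (fun m a φ => by
        rw [A.rightV_smul hla, mul_div_assoc]) (fun m φ h => ?_) (2 * q) m₀ φ hI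
  · refine lb_loop ?_ (key.trans (le_of_eq ?_))
    · simp [CExpr.eval, ArithOp.apply, m₀]
    · rw [← Finset.sum_div, div_right_comm]
      congr 2
      refine Finset.sum_congr rfl fun c _ => ?_
      congr 1
      ext1 d
      exact (hashFun_coeffMem hQ hI c d).symm
  · have hi := h.inv hF
    exact LB.seq (((lb_afterVal_search hP hF.big hn hn0 hmsg (k + 1)) 0 (by omega)).1 q 0 (m 8)
      (N.hashFun P m) m φ ⟨hi, rfl, h.five, h.seven, rfl⟩ (by omega))

end Box

/-! ### From stage outputs to the success probability -/

section Outputs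

theorem outputsOk_iff (ok : ℕ → ℕ × ℕ → Prop) (s : ℕ) (os : List (ℕ × ℕ)) :
    OutputsOk ok s os ↔ ∀ i (h : i < os.length), ok (s + i) os[i] := by
  induction os generalizing s with
  | nil => simp [OutputsOk]
  | cons o os ih =>
    rw [OutputsOk, ih]
    constructor
    · rintro ⟨h0, h⟩ i hi
      cases i with
      | zero => exact h0
      | succ i =>
        have := h i (by simpa using hi)
        rwa [add_right_comm] at this
    · intro h
      refine ⟨h 0 (by simp), fun i hi => ?_⟩
      have := h (i + 1) (by simpa using hi)
      rwa [← add_assoc, add_right_comm] at this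

theorem length_of_mem_interact {σ : Type*} [Fintype σ] {B : BlackBox σ} {last : Prog}
    {l : List (Prog × ℕ)} {c : Branch σ} {r : List (ℕ × ℕ) × Branch σ}
    (hr : r ∈ interact B last l c) : r.1.length = l.length := by
  induction l generalizing c r with
  | nil =>
    simp only [interact, List.mem_map] at hr
    obtain ⟨d, _, rfl⟩ := hr
    rfl
  | cons p l ih =>
    simp only [interact, List.mem_flatMap, List.mem_map] at hr
    obtain ⟨d, _, r', hr', rfl⟩ := hr
    simp [ih hr']

variable {U X : Type*} [DecidableEq U] [Fintype X] {X₀ Y : Finset U} {n : ℕ}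
  {N : HashNumbering X X₀ Y}

theorem HashNumbering.isOutput_of_outputsOk {x : X₀ × (Fin n → X)} (hn0 : 0 < n)
    {os : List (ℕ × ℕ)} (hl : os.length = n) (h : OutputsOk (N.StageOk x) 0 os) :
    N.IsOutput x os := by
  rw [outputsOk_iff] at h
  constructor
  · refine List.ext_getElem (by simpa using hl) fun i hi _ => ?_
    have hi' : i < os.length := by simpa using hi
    have := (h i hi').1 (by omega)
    simpa using this
  · cases os with
    | nil => simp at hl; omega
    | cons o os =>
      have : o.2 = N.left (leftOfX x.1) := (h 0 (by simp)).2 rfl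
      simp [this]

variable {σ R Z E : Type*} [Fintype σ] [DecidableEq σ] {q : ℕ}
  [AddCommGroup Y] {A : OracleAlg (↥(X₀ ∪ Y) × X) Y (X₀ × (Fin n → X)) σ R Z E q}
  {P : SimParams}

/-- The message after stage `i`. -/
def HashNumbering.message (N : HashNumbering X X₀ Y) (Θ : Fin n → Y) (i : ℕ) : ℕ :=
  if h : i < n then N.ofY (Θ ⟨i, h⟩) else 0

/-- Passing the checks of all stages implies the required output, and dropping any further branches
only loses nonnegative terms. -/
theorem sum_restVal_le_prob (hn : P.n = n) (hn0 : 0 < n) (x : X₀ × (Fin n → X))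
    (V : (Fin n → Y) → Matrix Z Z ℂ) :
    (∑ Θ, restVal N A P x (V Θ) (N.message Θ) n 0
      ⟨0, Function.update 0 0 q, emb (fun _ => 0) A.start⟩) / (Y.card : ℝ) ^ n ≤
      (P.simulator n).prob N A x V := by
  classical
  unfold Simulator.prob
  gcongr with Θ
  rw [run_eq A hn hn0 Θ (fun i => (P.stage i, N.message Θ i))
    fun i h => by simp [HashNumbering.message, h], restVal, ← sum_interact]
  refine List.sum_le_sum fun r hr => ?_
  have hl := length_of_mem_interact hr
  simp only [List.length_map, List.length_range'] at hl
  split_ifs with h1 h2 h2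
  · exact le_rfl
  · exact absurd (HashNumbering.isOutput_of_outputsOk hn0 hl h1) h2
  · exact JointState.normSq_nonneg _
  · exact le_rfl

end Outputs

/-- The difference is nonzero and smaller than p in absolute value, hence coprime to p. This is why
all hash inputs are numbered below the prime. -/
theorem isUnit_natCast_sub {p r a b : ℕ} (hp : p.Prime) (ha : a < p) (hb : b < p) (h : a ≠ b) :
    IsUnit ((a : ZMod (p ^ r)) - b) := by
  wlog hab : b < a generalizing a b
  · rw [← neg_sub]
    exact (this hb ha h.symm (by omega)).neg
  rw [← Nat.cast_sub hab.le, ZMod.isUnit_iff_coprime]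
  refine Nat.Coprime.pow_right _ ((Nat.Prime.coprime_iff_not_dvd hp).2 fun hd => ?_).symm
  exact absurd (Nat.le_of_dvd (by omega) hd) (by omega)

/-! ### Reprogramming a random function along its chain -/

section Reprogram

variable {U X : Type*} [DecidableEq U] {X₀ Y : Finset U} {n : ℕ} {x : X₀ × (Fin n → X)}

theorem chainPt_injective (hx : Function.Injective x.2) (Θ : Fin n → Y) :
    Function.Injective (chainPt x Θ) := fun _ _ h => hx (congrArg Prod.snd h)

/-- Inductively, if the preceding hash is the preceding entry of Θ, then the next input is the next
chain point, where the function was overwritten. -/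
theorem hashChain_extend (hx : Function.Injective x.2) (Θ : Fin n → Y)
    (H : ↥(X₀ ∪ Y) × X → Y) : hashChain (Function.extend (chainPt x Θ) Θ H) x = Θ := by
  have key : ∀ i (h : i < n),
      hashChainAux (Function.extend (chainPt x Θ) Θ H) x i h = Θ ⟨i, h⟩ := by
    intro i
    induction i with
    | zero =>
      intro h
      rw [hashChainAux, ← (chainPt_injective hx Θ).extend_apply Θ H ⟨0, h⟩]
      rfl
    | succ i ih =>
      intro h
      rw [hashChainAux, ih, ← (chainPt_injective hx Θ).extend_apply Θ H ⟨i + 1, h⟩]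
      rfl
  ext1 i
  exact key i i.2

/-- Reprogramming loses only the old values at the chain points. Kept alongside, they make it a
bijection, since Θ can be recovered as the hash chain of the new function. -/
theorem sum_extend [Fintype X] [DecidableEq X] (hx : Function.Injective x.2)
    (Ψ : (↥(X₀ ∪ Y) × X → Y) → (Fin n → Y) → ℝ) :
    ∑ Θ : Fin n → Y, ∑ H : ↥(X₀ ∪ Y) × X → Y, Ψ (Function.extend (chainPt x Θ) Θ H) Θ =
      (Y.card : ℝ) ^ n * ∑ H, Ψ H (hashChain H x) := by
  let e : (Fin n → Y) × (↥(X₀ ∪ Y) × X → Y) → (Fin n → Y) × (↥(X₀ ∪ Y) × X → Y) := fun p =>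
    (p.2 ∘ chainPt x p.1, Function.extend (chainPt x p.1) p.1 p.2)
  have he : Function.Injective e := by
    rintro ⟨Θ, H⟩ ⟨Θ', H'⟩ h
    have h1 := congrArg Prod.fst h
    have h2 : Function.extend (chainPt x Θ) Θ H = Function.extend (chainPt x Θ') Θ' H' :=
      congrArg Prod.snd h
    have h3 : Θ = Θ' := by
      rw [← hashChain_extend hx Θ H, ← hashChain_extend hx Θ' H', h2]
    subst h3
    refine Prod.ext rfl (funext fun d => ?_)
    by_cases hd : ∃ j, chainPt x Θ j = d
    · obtain ⟨j, rfl⟩ := hd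
      exact congrFun h1 j
    · have := congrFun h2 d
      rwa [Function.extend_apply' _ _ _ hd, Function.extend_apply' _ _ _ hd] at this
  have he' : Function.Bijective e := (Fintype.bijective_iff_injective_and_card e).2 ⟨he, rfl⟩
  rw [← Fintype.sum_prod_type' (f := fun Θ H => Ψ (Function.extend (chainPt x Θ) Θ H) Θ),
    Fintype.sum_bijective e he' _ (fun p => Ψ p.2 (hashChain p.2 x)) (fun p => by
      simp only [e, hashChain_extend hx]), Fintype.sum_prod_type]
  simp

end Reprogram

/-! ### Averages over the oracle and the answers -/

section Average

open SimParams

variable {U X : Type*} [DecidableEq U] [Fintype X] {X₀ Y : Finset U} {n : ℕ}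
  {N : HashNumbering X X₀ Y} {σ R Z E : Type*} [Fintype σ] [DecidableEq σ] {q : ℕ}
  [AddCommGroup Y] {A : OracleAlg (↥(X₀ ∪ Y) × X) Y (X₀ × (Fin n → X)) σ R Z E q}
  {P : SimParams}

/-- Three averages are compared: over functions into Y, over functions into `ZMod Q` reduced modulo
|Y|, and over polynomials. The first step loses the factor 1 - 1/N', the second is exact by the
degree bound. -/
theorem sum_rightV_le_sum_polyHash [DecidableEq X] {Q : ℕ} [NeZero Q]
    (hnum : ∀ v w : ↥(X₀ ∪ Y) × X, v ≠ w → IsUnit ((N.num v : ZMod Q) - N.num w))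
    (hY : Y.Nonempty) {N' : ℕ} (hN' : 0 < N')
    (hQ : Fintype.card (↥(X₀ ∪ Y) × X) * Y.card * N' ≤ Q)
    (L : (σ → ℂ) →ₗ[ℂ] (σ → ℂ)) (v : Fin n → ↥(X₀ ∪ Y) × X) (Θ : Fin n → Y) (φ : σ → ℂ) :
    (1 - 1 / (N' : ℝ)) * ((∑ H : ↥(X₀ ∪ Y) × X → Y, A.rightV (fun φ => nsq (L φ)) v Θ q 0 H φ) /
        (Y.card : ℝ) ^ Fintype.card (↥(X₀ ∪ Y) × X)) ≤
      (∑ c : Fin (2 * q) → ZMod Q, A.rightV (fun φ => nsq (L φ)) v Θ q 0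
        (fun d => N.toY ((polyHash (fun d => (N.num d : ZMod Q)) c d).val % Y.card)) φ) /
          Q ^ (2 * q) := by
  set d := Fintype.card (↥(X₀ ∪ Y) × X) with hd
  have hM : 0 < Y.card := hY.card_pos
  have hM' : (0 : ℝ) < Y.card := by exact_mod_cast hM
  have hQ0 : 0 < Q := Nat.pos_of_neZero Q
  have hQ' : (0 : ℝ) < Q := by exact_mod_cast hQ0
  set Φ : (↥(X₀ ∪ Y) × X → Y) → ℝ := fun H => A.rightV (fun φ => nsq (L φ)) v Θ q 0 H φ with hΦ
  have hΦ0 : ∀ H, 0 ≤ Φ H := fun H => A.rightV_nonneg (fun _ => nsq_nonneg _) ..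
  set T : (↥(X₀ ∪ Y) × X → ZMod Q) → ↥(X₀ ∪ Y) × X → Y := fun f d => N.toY ((f d).val % Y.card)
  have h1 := card_mul_sum_le_sum_mod (Q := Q) hM N.ofY_lt N.toY_ofY hΦ0
  have h2 := one_sub_le_pow hM hN' hQ hQ0
  have hdeg : (fun f => (Φ (T f) : ℂ)) ∈ degSpan (↥(X₀ ∪ Y) × X) (ZMod Q) (2 * q) := by
    have := A.rightV_mem_degSpan (B := ZMod Q) L v Θ q 0 0 (φ := fun _ => φ) (H := T)
      (fun s => const_mem_degSpan 0 (φ s)) fun v f f' h => by simp only [T, h]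
    rwa [zero_add] at this
  have h3 := sum_polyHash hnum hdeg
  have h3' : (Q : ℝ) ^ d * ∑ c : Fin (2 * q) → ZMod Q, Φ (T (polyHash (fun d => (N.num d : ZMod Q)) c))
      = Q ^ (2 * q) * ∑ f, Φ (T f) := by exact_mod_cast h3
  change _ ≤ (∑ c : Fin (2 * q) → ZMod Q, Φ (T (polyHash (fun d => (N.num d : ZMod Q)) c))) / _
  have h4 : (∑ c : Fin (2 * q) → ZMod Q, Φ (T (polyHash (fun d => (N.num d : ZMod Q)) c))) /
      (Q : ℝ) ^ (2 * q) = (∑ f, Φ (T f)) / Q ^ d := by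
    rw [div_eq_div_iff (by positivity) (by positivity)]
    linarith
  rw [h4, le_div_iff₀ (by positivity)]
  refine le_trans ?_ h1
  have hS : 0 ≤ ∑ H, Φ H := Finset.sum_nonneg fun H _ => hΦ0 H
  calc (1 - 1 / (N' : ℝ)) * ((∑ H, Φ H) / (Y.card : ℝ) ^ d) * Q ^ d
      = ((1 - 1 / (N' : ℝ)) * Q ^ d) * ((∑ H, Φ H) / (Y.card : ℝ) ^ d) := by ring
    _ ≤ (((Q / Y.card : ℕ) : ℝ) * Y.card) ^ d * ((∑ H, Φ H) / (Y.card : ℝ) ^ d) := by gcongr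
    _ = _ := by
      rw [mul_pow]
      field_simp
      exact mul_comm _ _

variable {x : X₀ × (Fin n → X)}

/-- The average over the oracle and the answers of the loss from too early extractions. -/
noncomputable def wrongAvg [DecidableEq X]
    (A : OracleAlg (↥(X₀ ∪ Y) × X) Y (X₀ × (Fin n → X)) σ R Z E q) (x : X₀ × (Fin n → X)) : ℝ :=
  (∑ Θ : Fin n → Y, ∑ H : ↥(X₀ ∪ Y) × X → Y,
    A.wrongV (A.outNsq x) (chainPt x Θ) Θ q 0 H A.start) /
      ((Y.card : ℝ) ^ n * (Y.card : ℝ) ^ Fintype.card (↥(X₀ ∪ Y) × X))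

theorem wrongAvg_nonneg [DecidableEq X] (x : X₀ × (Fin n → X)) : 0 ≤ wrongAvg A x :=
  div_nonneg (Finset.sum_nonneg fun _ _ => Finset.sum_nonneg fun _ _ =>
    A.wrongV_nonneg (A.outNsq_nonneg x) ..) (by positivity)

theorem sum_wrongAvg_le [DecidableEq X] (hY : Y.Nonempty) :
    ∑ x, wrongAvg A x ≤ (2 * q + 1 : ℝ) ^ n / Y.card := by
  classical
  have hM' : (0 : ℝ) < Y.card := by exact_mod_cast hY.card_pos
  have hstart : nsq A.start = 1 := A.start_norm
  have key : ∀ H : ↥(X₀ ∪ Y) × X → Y, ∑ x, ∑ Θ : Fin n → Y,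
      A.wrongV (A.outNsq x) (chainPt x Θ) Θ q 0 H A.start ≤
        (2 * q + 1) ^ n * ((Y.card : ℝ) ^ n / Y.card) := by
    intro H
    rcases isEmpty_or_nonempty (X₀ × (Fin n → X)) with hempty | ⟨⟨x₀⟩⟩
    · rw [Finset.univ_eq_empty, Finset.sum_empty]
      positivity
    -- The label of an input is its left component, which from the second chain point on is the
    -- preceding answer. At s = 0 nothing is prescribed, so the prescribed points and answers are
    -- arbitrary.
    have h1 := A.sum_wrongV_le (lab := Prod.fst) (e := leftOfY (X₀ := X₀))
      (fun y y' h => Subtype.ext (congrArg (fun w : ↥(X₀ ∪ Y) => (w : U)) h)) chainPt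
      (fun x Θ j k hjk => by
        have h0 : (j : ℕ) ≠ 0 := by omega
        have h1 : (⟨j - 1, by omega⟩ : Fin n) = k := Fin.ext (by simp; omega)
        simp only [chainPt, if_neg h0, h1]) q 0 (chainPt x₀ 0) 0 H A.start
    simp only [Nat.not_lt_zero, false_implies, implies_true, Finset.filter_true, Nat.sub_zero,
      Fintype.card_coe, hstart, mul_one] at h1
    rwa [Fintype.sum_prod_type] at h1
  unfold wrongAvg
  rw [← Finset.sum_div, div_le_div_iff₀ (by positivity) hM']
  have h2 : ∑ x, ∑ Θ : Fin n → Y, ∑ H : ↥(X₀ ∪ Y) × X → Y,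
      A.wrongV (A.outNsq x) (chainPt x Θ) Θ q 0 H A.start ≤
        (Y.card : ℝ) ^ Fintype.card (↥(X₀ ∪ Y) × X) *
          ((2 * q + 1) ^ n * ((Y.card : ℝ) ^ n / Y.card)) := by
    rw [Finset.sum_congr rfl fun x _ => Finset.sum_comm, Finset.sum_comm]
    refine (Finset.sum_le_sum fun H _ => key H).trans (le_of_eq ?_)
    simp
  refine (mul_le_mul_of_nonneg_right h2 hM'.le).trans (le_of_eq ?_)
  field_simp

/-- Reprogramming the oracle and expanding all queries splits the probability into right and wrong
branches. The predicate is kept on the right ones and forgotten on the wrong ones. -/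
theorem chainProb_le [DecidableEq X] [Fintype Z] (hY : Y.Nonempty) (hx : Function.Injective x.2)
    {V : (Fin n → Y) → Matrix Z Z ℂ} (hV : ∀ Θ, IsStarProjection (V Θ)) :
    A.chainProb x V ≤ (2 * q + 1 : ℝ) ^ n *
      ((∑ Θ : Fin n → Y, ∑ H : ↥(X₀ ∪ Y) × X → Y, A.rightV (fun φ => nsq (A.test x (V Θ) φ))
        (chainPt x Θ) Θ q 0 H A.start) /
          ((Y.card : ℝ) ^ n * (Y.card : ℝ) ^ Fintype.card (↥(X₀ ∪ Y) × X)) + wrongAvg A x) := by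
  have hM' : (0 : ℝ) < Y.card := by exact_mod_cast hY.card_pos
  have hI : OracleAlg.idxFrom n 0 = Finset.univ := by ext j; simp [OracleAlg.idxFrom]
  have key : ∀ Θ H, nsq (A.test x (V Θ) (A.runFrom (Function.extend (chainPt x Θ) Θ H) q A.start)) ≤
      (2 * q + 1) ^ n * (A.rightV (fun φ => nsq (A.test x (V Θ) φ)) (chainPt x Θ) Θ q 0 H A.start +
        A.wrongV (A.outNsq x) (chainPt x Θ) Θ q 0 H A.start) := by
    intro Θ H
    have hinj := chainPt_injective hx Θ
    have h1 := A.leaf_runFrom_le (A.test x (V Θ)) hinj Θ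
      (Function.extend (chainPt x Θ) Θ H) q (OracleAlg.idxFrom n 0) H A.start
      (fun j _ => hinj.extend_apply _ _ j) fun d hd => Function.extend_apply' _ _ _ (by
        rintro ⟨j, rfl⟩
        exact hd j (by simp [hI]) rfl)
    rw [A.allV_eq, OracleAlg.card_idxFrom, Nat.sub_zero] at h1
    refine h1.trans ?_
    gcongr
    exact A.wrongV_mono (fun φ => A.nsq_test_le x (hV Θ) φ) ..
  have h2 := sum_extend hx fun T Θ => nsq (A.test x (V Θ) (A.runFrom T q A.start))
  have h3 : A.chainProb x V = (∑ Θ : Fin n → Y, ∑ H : ↥(X₀ ∪ Y) × X → Y,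
      nsq (A.test x (V Θ) (A.runFrom (Function.extend (chainPt x Θ) Θ H) q A.start))) /
        ((Y.card : ℝ) ^ n * (Y.card : ℝ) ^ Fintype.card (↥(X₀ ∪ Y) × X)) := by
    rw [h2, OracleAlg.chainProb, mul_div_mul_left _ _ (by positivity)]
    simp only [A.probOutput_eq, Fintype.card_fun, Fintype.card_coe, Nat.cast_pow]
  rw [h3, wrongAvg, ← add_div, mul_div_assoc']
  gcongr
  rw [← Finset.sum_add_distrib, Finset.mul_sum]
  refine Finset.sum_le_sum fun Θ _ => ?_
  rw [← Finset.sum_add_distrib, Finset.mul_sum]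
  exact Finset.sum_le_sum fun H _ => key Θ H

end Average

/-! ### Program length -/

section Size

open SimParams

/-- The literals that belong to the parameters have size at most `ℓ`. -/
structure SimParams.SizeLE (P : SimParams) (ℓ : ℕ) : Prop where
  five : 5 ≤ ℓ
  n_le : (P.n + 3).size ≤ ℓ
  n_le' : P.n.size ≤ ℓ
  p_le : P.p.size ≤ ℓ
  cL_le : P.cL.size ≤ ℓ
  cX_le : P.cX.size ≤ ℓ
  cY_le : P.cY.size ≤ ℓ

theorem size_literals : Nat.size 0 = 0 ∧ Nat.size 1 = 1 ∧ Nat.size 2 = 2 ∧ Nat.size 3 = 2 ∧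
    Nat.size 4 = 3 ∧ Nat.size 5 = 3 ∧ Nat.size 6 = 3 ∧ Nat.size 7 = 3 ∧ Nat.size 8 = 4 ∧
    Nat.size 9 = 4 ∧ Nat.size 10 = 4 ∧ Nat.size 16 = 5 ∧ Nat.size 17 = 5 ∧ Nat.size 18 = 5 := by
  refine ⟨rfl, rfl, rfl, rfl, rfl, rfl, rfl, rfl, rfl, rfl, rfl, rfl, rfl, rfl⟩

variable {P : SimParams} {ℓ : ℕ}

theorem size_stepExpr_le (h : P.SizeLE ℓ) : P.stepExpr.size ≤ 200 * ℓ := by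
  obtain ⟨h0, h1, h2, h3, h4, h5, h6, h7, h8, h9, h10, h16, h17, h18⟩ := size_literals
  have := h.five; have := h.cX_le
  simp only [QExpr.size, CExpr.size, h0, h1, h2, h3, h4, h10, h16, h17, h18]
  omega

theorem size_advance_le (h : P.SizeLE ℓ) : P.advance.size ≤ 700 * ℓ := by
  obtain ⟨h0, h1, h2, h3, h4, h5, h6, h7, h8, h9, h10, h16, h17, h18⟩ := size_literals
  have := h.five; have := h.cX_le; have := h.cL_le; have := h.cY_le
  have hs := size_stepExpr_le h
  generalize hS : P.stepExpr = S at hs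
  simp only [advance, query, forward, backward, unread, hS, Prog.size, QExpr.size, CExpr.size,
    Reg.size, h0, h1, h2, h3, h4, h5, h6, h10]
  omega

theorem size_search_le (h : P.SizeLE ℓ) : P.search.size ≤ 3000 * ℓ := by
  obtain ⟨h0, h1, h2, h3, h4, h5, h6, h7, h8, h9, h10, h16, h17, h18⟩ := size_literals
  have := h.five; have := h.cX_le; have := h.cL_le; have := h.n_le'
  have hs := size_advance_le h
  simp only [search, pending, iteration, grabInput, grab, unread, Prog.size, QExpr.size,
    CExpr.size, Reg.size, h0, h1, h2, h3, h5, h6, h7, h8, h9]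
  omega

theorem size_stage_le (h : P.SizeLE ℓ) (i : ℕ) : (P.stage i).size ≤ 4000 * ℓ := by
  obtain ⟨h0, h1, h2, h3, h4, h5, h6, h7, h8, h9, h10, h16, h17, h18⟩ := size_literals
  have := h.five; have := h.cX_le; have := h.cL_le; have := h.n_le; have := h.p_le
  have hs := size_search_le h
  unfold stage
  split_ifs
  all_goals
    simp only [firstStage, midStage, lastStage, initModulus, initCoeffs, record, finish, grab,
      unread, Prog.size, QExpr.size, CExpr.size, Reg.size, h0, h1, h2, h3, h4, h6, h8, h10, h16,
      h17, h18]
    omega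

theorem size_simulator_le (h : P.SizeLE ℓ) (n : ℕ) :
    (P.simulator n).size ≤ (n + 1) * (4000 * ℓ) := by
  calc (P.simulator n).size ≤ ∑ _i : Fin (n + 1), 4000 * ℓ :=
        Finset.sum_le_sum fun i _ => size_stage_le h (i : ℕ)
    _ = _ := by simp

end Size

/-! ### Numerical estimates -/

section Bounds

open SimParams

theorem stageTime_le (P : SimParams) {β q W : ℕ} (hβ : 1 ≤ β) (hW : 1 ≤ W) (hq : q ≤ W)
    (hn : P.n ≤ W) : P.stageTime β q ≤ 149 * W ^ 2 * tau β := by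
  have hτ : 1 ≤ tau β := by unfold tau; omega
  set τ := tau β
  have hWτ : τ ≤ W * τ := Nat.le_mul_of_pos_left _ hW
  have hWWτ : W * τ ≤ W * (W * τ) := Nat.le_mul_of_pos_left _ hW
  have h1 : P.advTime β q ≤ 40 * (W * τ) := by
    have : (2 * q + P.n) * (2 * τ + 1) ≤ (3 * W) * (3 * τ) := Nat.mul_le_mul (by omega) (by omega)
    have e : (3 * W) * (3 * τ) = 9 * (W * τ) := by ring
    change 22 * τ + 2 * ((2 * q + P.n) * (2 * τ + 1)) ≤ _
    omega
  have h2 : P.searchTime β q ≤ 106 * (W * (W * τ)) := by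
    have : q * (20 * τ + P.advTime β q + 1) ≤ W * (61 * (W * τ)) := Nat.mul_le_mul hq (by omega)
    have e : W * (61 * (W * τ)) = 61 * (W * (W * τ)) := by ring
    change 5 * τ + P.advTime β q + q * (20 * τ + P.advTime β q + 1) ≤ _
    omega
  have h3 : P.initTime β q ≤ 27 * (W * τ) := by
    have : (3 * q + P.n + 3) * (2 * τ + 1) ≤ (7 * W) * (3 * τ) :=
      Nat.mul_le_mul (by omega) (by omega)
    have e : (7 * W) * (3 * τ) = 21 * (W * τ) := by ring
    change 6 * τ + (3 * q + P.n + 3) * (2 * τ + 1) ≤ _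
    omega
  have e : 149 * W ^ 2 * τ = 149 * (W * (W * τ)) := by ring
  rw [e]
  change 16 * τ + P.searchTime β q + P.initTime β q ≤ _
  omega

theorem size_mul_le (a b : ℕ) : (a * b).size ≤ a.size + b.size := by
  rw [Nat.size_le, pow_add]
  exact Nat.mul_lt_mul'' (Nat.lt_size_self a) (Nat.lt_size_self b)

theorem size_add_le (a b : ℕ) : (a + b).size ≤ a.size + b.size + 1 := by
  rw [Nat.size_le, pow_succ, pow_add]
  have h1 := Nat.lt_size_self a
  have h2 := Nat.lt_size_self b
  have h3 : 2 ^ a.size ≤ 2 ^ a.size * 2 ^ b.size := Nat.le_mul_of_pos_right _ (by positivity)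
  have h4 : 2 ^ b.size ≤ 2 ^ a.size * 2 ^ b.size := Nat.le_mul_of_pos_left _ (by positivity)
  omega

theorem two_mul_le_two_pow (k : ℕ) : 2 * (k + 1) ≤ 2 ^ (k + 1) := by
  rw [pow_succ, mul_comm]
  exact Nat.mul_le_mul_right _ (Nat.lt_two_pow_self)

/-- The constant of the theorem. -/
theorem factorial_div_pow_le {n q : ℕ} (hn : 0 < n) :
    (n.factorial : ℝ) / (2 * q + n + 1) ^ (2 * n) ≤
      (1 - 1 / (2 * q + n + 1)) / ((2 * q + n).choose n * (2 * q + 1) ^ n) := by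
  have hC : ((2 * q + n).choose n : ℝ) ≤ (2 * q + n) ^ n / n.factorial := by
    have := Nat.choose_le_pow_div (α := ℝ) n (2 * q + n)
    exact_mod_cast this
  have hC0 : (0 : ℝ) < (2 * q + n).choose n := by exact_mod_cast Nat.choose_pos (by omega)
  have hf : (0 : ℝ) < n.factorial := by exact_mod_cast n.factorial_pos
  have hn' : (1 : ℝ) ≤ n := by exact_mod_cast hn
  have hq' : (0 : ℝ) ≤ q := Nat.cast_nonneg q
  set B : ℝ := 2 * q + n with hB
  have hB1 : 1 ≤ B := by linarith
  -- The loss from hashing is paid by B^n against (B+1)^n: one factor B is kept, and the others are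
  -- raised to B + 1.
  have h1 : (1 : ℝ) - 1 / (B + 1) = B / (B + 1) := by field_simp; ring
  rw [h1, div_div, div_le_div_iff₀ (by positivity) (by positivity)]
  have h2 : (n.factorial : ℝ) * ((2 * q + n).choose n) ≤ B ^ n := by
    rwa [le_div_iff₀' hf] at hC
  obtain ⟨k, rfl⟩ : ∃ k, n = k + 1 := ⟨n - 1, by omega⟩
  calc ((k + 1).factorial : ℝ) * ((B + 1) * (((2 * q + (k + 1)).choose (k + 1)) * (2 * q + 1) ^ (k + 1)))
      = (B + 1) * (((k + 1).factorial : ℝ) * ((2 * q + (k + 1)).choose (k + 1))) * (2 * q + 1) ^ (k + 1) := by ring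
    _ ≤ (B + 1) * B ^ (k + 1) * (B + 1) ^ (k + 1) := by
        gcongr
        rw [hB]; push_cast; linarith [Nat.cast_nonneg (α := ℝ) k]
    _ = B * (B ^ k * ((B + 1) * (B + 1) ^ (k + 1))) := by ring
    _ ≤ B * ((B + 1) ^ k * ((B + 1) * (B + 1) ^ (k + 1))) := by
        gcongr
        linarith
    _ = B * (B + 1) ^ (2 * (k + 1)) := by ring

/-- The right side is the product (2q+1)(2q+2)⋯(2q+n). It turns the bound (2q+1)^n/|Y| on the wrong
branches into n!/|Y|. -/
theorem pow_le_factorial_mul_choose (q n : ℕ) :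
    (2 * q + 1 : ℝ) ^ n ≤ n.factorial * (2 * q + n).choose n := by
  have h1 := Nat.pow_succ_le_ascFactorial (2 * q + 1) n
  rw [Nat.ascFactorial_eq_factorial_mul_choose] at h1
  exact_mod_cast h1

end Bounds

/-! ### Choice of parameters and conclusion -/

section Final

open SimParams

/-- The bit length of the numbers in the simulator. -/
def bitLen (n q p : ℕ) : ℕ := (q + n + 3) * p.size + 4 * (q + n) + 20

theorem fine_of_prime {P : SimParams} {q : ℕ} (hp : P.p.Prime) (hL : 0 < P.cL) (hX : 0 < P.cX)
    (hY : 0 < P.cY) (hYL : P.cY ≤ P.cL) (hlt : P.cL * P.cX < P.p) :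
    P.Fine (bitLen P.n q P.p) q := by
  set β := bitLen P.n q P.p with hβ
  have hp2 := hp.two_le
  have hpow : P.p ^ (q + P.n + 3) < 2 ^ ((q + P.n + 3) * P.p.size) := by
    rw [mul_comm, pow_mul]
    exact Nat.pow_lt_pow_left (Nat.lt_size_self _) (by omega)
  have hβ1 : 2 ^ ((q + P.n + 3) * P.p.size) ≤ 2 ^ β :=
    Nat.pow_le_pow_right (by omega) (by rw [hβ, bitLen]; omega)
  have hple : P.p ≤ P.p ^ (q + P.n + 3) := Nat.le_self_pow (by omega) _
  have hLX : P.cL ≤ P.cL * P.cX := Nat.le_mul_of_pos_right _ hX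
  have hXL : P.cX ≤ P.cL * P.cX := Nat.le_mul_of_pos_left _ hL
  have h20 : 2 ^ (4 * (q + P.n) + 20) ≤ 2 ^ β :=
    Nat.pow_le_pow_right (by omega) (by rw [hβ, bitLen]; omega)
  have hbig : (2 ^ (q + P.n)) ^ 4 * 2 ^ 20 ≤ 2 ^ β := by
    rw [← pow_mul, ← pow_add, mul_comm (q + P.n) 4]; exact h20
  have hw : q + P.n + 1 ≤ 2 ^ (q + P.n) := Nat.lt_two_pow_self
  set w := 2 ^ (q + P.n)
  have hw4 : w ≤ w ^ 4 := Nat.le_self_pow (by omega) _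
  have hw24 : w ^ 2 ≤ w ^ 4 := Nat.pow_le_pow_right (by omega) (by omega)
  have hsq : (2 * q + P.n) ^ 2 ≤ 4 * w ^ 2 := by
    calc _ ≤ (2 * w) ^ 2 := Nat.pow_le_pow_left (by omega) 2
      _ = _ := by ring
  norm_num at hbig
  have hlen : 2 * q + P.n + 16 < 2 ^ β := by omega
  exact ⟨by rw [hβ, bitLen]; omega, ⟨by omega, by omega, by omega, by omega, by omega, by omega⟩,
    ⟨by omega, hlen⟩, by omega, by omega, by omega, by omega, hY, hlen⟩

/-- This fixes the exponent of the modulus: two factors p cover the numbers of hash inputs and hash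
values, and p^(q+n+1) covers the accuracy 2q+n+1. -/
theorem card_mul_le_pow {n q p a b : ℕ} (hp : 2 ≤ p) (ha : a ≤ p) (hb : b ≤ p) :
    a * b * (2 * q + n + 1) ≤ p ^ (q + n + 3) := by
  have h1 : 2 * q + n + 1 ≤ p ^ (q + n + 1) := by
    refine le_trans ?_ (Nat.pow_le_pow_left hp _)
    have := two_mul_le_two_pow (q + n)
    omega
  calc a * b * (2 * q + n + 1) ≤ p * p * p ^ (q + n + 1) :=
        Nat.mul_le_mul (Nat.mul_le_mul ha hb) h1
    _ = _ := by ring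

theorem time_const_le {n q W : ℕ} (hW : 1 ≤ W) (hq : q ≤ W) (hn : n ≤ W) {P : SimParams}
    (hs : P.p.size ≤ 3 * W) (hPn : P.n = n) :
    (n + 1) * P.stageTime (bitLen n q P.p) q ≤ 3000000000 * W ^ 5 := by
  have hβ : bitLen n q P.p ≤ 43 * W ^ 2 := by
    have h1 : (q + n + 3) * P.p.size ≤ (5 * W) * (3 * W) := Nat.mul_le_mul (by omega) (by omega)
    have h2 : W ≤ W * W := Nat.le_mul_of_pos_left _ hW
    have e : (5 * W) * (3 * W) = 15 * (W * W) := by ring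
    rw [pow_two]
    unfold bitLen
    omega
  calc (n + 1) * P.stageTime (bitLen n q P.p) q
      ≤ (2 * W) * (149 * W ^ 2 * (200000 * (43 * W ^ 2))) :=
        Nat.mul_le_mul (by omega) ((stageTime_le P (by unfold bitLen; omega) hW hq (by omega)).trans
          (Nat.mul_le_mul_left _ (Nat.mul_le_mul_left _ hβ)))
    _ = 2562800000 * W ^ 5 := by ring
    _ ≤ _ := Nat.mul_le_mul_right _ (by norm_num)

section Params

variable {U X : Type*} [DecidableEq U] [Fintype X] {X₀ Y : Finset U} {n : ℕ}

/-- Bertrand's postulate supplies a prime above the number of hash inputs with only about one extra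
bit. The prime does not depend on q, so it can be a literal of the program. -/
theorem exists_simParams (n : ℕ) [Nonempty X] (h₀ : X₀.Nonempty) :
    ∃ P : SimParams, P.n = n ∧ P.p.Prime ∧ P.cL = (X₀ ∪ Y).card ∧ P.cX = Fintype.card X ∧
      P.cY = Y.card ∧ P.cL * P.cX < P.p ∧
      P.p.size ≤ X₀.card.size + (Fintype.card X).size + Y.card.size + 3 := by
  have hL : 0 < (X₀ ∪ Y).card := (h₀.mono Finset.subset_union_left).card_pos
  have hX : 0 < Fintype.card X := Fintype.card_pos
  obtain ⟨p, hp, hlt, hle⟩ := Nat.exists_prime_lt_and_le_two_mul ((X₀ ∪ Y).card * Fintype.card X)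
    (Nat.mul_pos hL hX).ne'
  refine ⟨⟨n, p, _, _, _⟩, rfl, hp, rfl, rfl, rfl, hlt, ?_⟩
  have h1 := size_mul_le 2 ((X₀ ∪ Y).card * Fintype.card X)
  have h2 := size_mul_le (X₀ ∪ Y).card (Fintype.card X)
  have h3 := Nat.size_le_size (Finset.card_union_le X₀ Y)
  have h4 := size_add_le X₀.card Y.card
  have h5 := Nat.size_le_size hle
  have h6 : Nat.size 2 = 2 := rfl
  change p.size ≤ _
  omega

theorem sizeLE_of_le {P : SimParams} {L : ℕ} (hL : 3 ≤ L) (hn : P.n ≤ L) (hp : P.p.size ≤ 3 * L)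
    (hcL : P.cL ≤ P.p) (hcX : P.cX ≤ P.p) (hcY : P.cY ≤ P.p) : P.SizeLE (5 * L) := by
  have h1 : P.n.size ≤ P.n := Nat.size_le.2 Nat.lt_two_pow_self
  have h2 := size_add_le P.n 3
  have h3 : Nat.size 3 = 2 := rfl
  have h4 := Nat.size_le_size hcL
  have h5 := Nat.size_le_size hcX
  have h6 := Nat.size_le_size hcY
  exact ⟨by omega, by omega, by omega, by omega, by omega, by omega, by omega⟩

variable {σ R Z E : Type*} [Fintype σ] [DecidableEq σ] [AddCommGroup Y]
  {q : ℕ} {N : HashNumbering X X₀ Y} {P : SimParams}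

theorem OracleAlg.chainProb_nonneg [DecidableEq X]
    (A : OracleAlg (↥(X₀ ∪ Y) × X) Y (X₀ × (Fin n → X)) σ R Z E q)
    [Fintype Z] (x : X₀ × (Fin n → X)) (V : (Fin n → Y) → Matrix Z Z ℂ) :
    0 ≤ A.chainProb x V := by
  unfold OracleAlg.chainProb OracleAlg.probOutput
  positivity

/-- The success probability of the simulator in terms of the average of `A.rightV`. -/
theorem sum_rightV_le_prob [DecidableEq X] [Fintype Z]
    (A : OracleAlg (↥(X₀ ∪ Y) × X) Y (X₀ × (Fin n → X)) σ R Z E q)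
    (hP : N.Params P) (hp : P.p.Prime) (hlt : P.cL * P.cX < P.p)
    {β : ℕ} (hF : P.Fine β q) (hn : P.n = n) (hn0 : 0 < n) (hX : 0 < Fintype.card X)
    (hY : Y.Nonempty) (x : X₀ × (Fin n → X)) (V : (Fin n → Y) → Matrix Z Z ℂ) :
    (1 - 1 / (2 * q + n + 1 : ℝ)) / (2 * q + n).choose n *
      ((∑ Θ : Fin n → Y, ∑ H : ↥(X₀ ∪ Y) × X → Y, A.rightV (fun φ => nsq (A.test x (V Θ) φ))
        (chainPt x Θ) Θ q 0 H A.start) /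
          ((Y.card : ℝ) ^ n * (Y.card : ℝ) ^ Fintype.card (↥(X₀ ∪ Y) × X))) ≤
      (P.simulator n).prob N A x V := by
  refine le_trans ?_ (sum_restVal_le_prob hn hn0 x V)
  have hM' : (0 : ℝ) < Y.card := by exact_mod_cast hY.card_pos
  have hcard : Fintype.card (↥(X₀ ∪ Y) × X) = P.cL * P.cX := by
    rw [Fintype.card_prod, Fintype.card_coe, hP.cL_eq, hP.cX_eq]
  obtain ⟨Q, hQ⟩ : ∃ Q, Q = P.p ^ (q + P.n + 3) := ⟨_, rfl⟩
  have : NeZero Q := ⟨by rw [hQ]; exact pow_ne_zero _ hp.ne_zero⟩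
  have hYp : Y.card ≤ P.p := by
    refine le_trans ?_ hlt.le
    rw [hP.cL_eq, hP.cX_eq]
    exact (Finset.card_le_card Finset.subset_union_right).trans (Nat.le_mul_of_pos_right _ hX)
  have hQle : Fintype.card (↥(X₀ ∪ Y) × X) * Y.card * (2 * q + n + 1) ≤ Q := by
    rw [hQ, hn, hcard]
    exact card_mul_le_pow hp.two_le hlt.le hYp
  have hnum : ∀ v w : ↥(X₀ ∪ Y) × X, v ≠ w → IsUnit ((N.num v : ZMod Q) - N.num w) := by
    intro v w hvw
    have hb : ∀ d, N.num d < P.p := fun d => lt_of_lt_of_le (N.num_lt d)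
      (by rw [← hP.cL_eq, ← hP.cX_eq]; exact hlt.le)
    subst hQ
    exact isUnit_natCast_sub hp (hb v) (hb w) fun h => hvw (N.num_injective h)
  have key : ∀ Θ : Fin n → Y, (1 - 1 / (2 * q + n + 1 : ℝ)) *
      ((∑ H : ↥(X₀ ∪ Y) × X → Y, A.rightV (fun φ => nsq (A.test x (V Θ) φ))
        (chainPt x Θ) Θ q 0 H A.start) / (Y.card : ℝ) ^ Fintype.card (↥(X₀ ∪ Y) × X)) /
          (2 * q + n).choose n ≤
      restVal N A P x (V Θ) (N.message Θ) n 0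
        ⟨0, Function.update 0 0 q, emb (fun _ => 0) A.start⟩ := by
    intro Θ
    refine le_trans ?_ (lb_restVal (Θ := Θ) hP hF hn hn0 hQ
      (fun s h => by simp [HashNumbering.message, h]) A.start 0)
    have h := sum_rightV_le_sum_polyHash (A := A) hnum hY (Nat.succ_pos (2 * q + n)) hQle
      (A.test x (V Θ)) (chainPt x Θ) Θ A.start
    push_cast [← hP.cY_eq] at h
    rw [← hP.cY_eq]
    gcongr
  calc _ = (∑ Θ : Fin n → Y, (1 - 1 / (2 * q + n + 1 : ℝ)) *
      ((∑ H : ↥(X₀ ∪ Y) × X → Y, A.rightV (fun φ => nsq (A.test x (V Θ) φ))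
        (chainPt x Θ) Θ q 0 H A.start) / (Y.card : ℝ) ^ Fintype.card (↥(X₀ ∪ Y) × X)) /
          (2 * q + n).choose n) / (Y.card : ℝ) ^ n := by
        rw [← Finset.sum_div, ← Finset.mul_sum, ← Finset.sum_div]
        field_simp
    _ ≤ _ := by gcongr with Θ; exact key Θ

/-- The error terms of the reduction. -/
theorem exists_error [DecidableEq X] [Fintype Z]
    (A : OracleAlg (↥(X₀ ∪ Y) × X) Y (X₀ × (Fin n → X)) σ R Z E q) [Nonempty X]
    (h₀ : X₀.Nonempty) (hY : Y.Nonempty) : ∃ ε : X₀ × (Fin n → X) → ℝ, (∀ x, 0 ≤ ε x) ∧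
      ∑ x, ε x = (n.factorial : ℝ) / Y.card ∧
      ∀ x, wrongAvg A x / (2 * q + n).choose n ≤ ε x := by
  have hM' : (0 : ℝ) < Y.card := by exact_mod_cast hY.card_pos
  have hC : (0 : ℝ) < (2 * q + n).choose n := by
    exact_mod_cast Nat.choose_pos (Nat.le_add_left n (2 * q))
  have : Nonempty X₀ := h₀.to_subtype
  have hT : (0 : ℝ) < Fintype.card (X₀ × (Fin n → X)) := by exact_mod_cast Fintype.card_pos
  have hle : ∑ x, wrongAvg A x / (2 * q + n).choose n ≤ (n.factorial : ℝ) / Y.card := by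
    rw [← Finset.sum_div, div_le_iff₀ hC, div_mul_eq_mul_div]
    refine (sum_wrongAvg_le hY).trans ?_
    gcongr
    exact_mod_cast pow_le_factorial_mul_choose q n
  -- The error terms must sum to n!/|Y| exactly; the unused budget is spread evenly over all x.
  set pad := (n.factorial : ℝ) / Y.card - ∑ x, wrongAvg A x / (2 * q + n).choose n with hpad
  have hpad0 : 0 ≤ pad / Fintype.card (X₀ × (Fin n → X)) := div_nonneg (sub_nonneg.2 hle) hT.le
  refine ⟨fun x => wrongAvg A x / (2 * q + n).choose n + pad / Fintype.card (X₀ × (Fin n → X)),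
    fun x => add_nonneg (div_nonneg (wrongAvg_nonneg x) hC.le) hpad0, ?_,
    fun x => le_add_of_nonneg_right hpad0⟩
  rw [Finset.sum_add_distrib, Finset.sum_const, Finset.card_univ, nsmul_eq_mul,
    mul_div_cancel₀ _ hT.ne', hpad]
  ring

/-- The factor (2q+1)^n of the expansion and the binomial coefficient of the sampling combine to the
constant of the theorem; on the error term the factor 1 - δ is simply dropped. -/
theorem chainProb_sub_le_prob [DecidableEq X] [Fintype Z]
    (A : OracleAlg (↥(X₀ ∪ Y) × X) Y (X₀ × (Fin n → X)) σ R Z E q)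
    (hP : N.Params P) (hp : P.p.Prime) (hlt : P.cL * P.cX < P.p)
    {β : ℕ} (hF : P.Fine β q) (hn : P.n = n) (hn0 : 0 < n) (hX : 0 < Fintype.card X)
    (hY : Y.Nonempty) {x : X₀ × (Fin n → X)} (hx : Function.Injective x.2)
    {V : (Fin n → Y) → Matrix Z Z ℂ} (hV : ∀ Θ, IsStarProjection (V Θ)) :
    (n.factorial : ℝ) / (2 * q + n + 1) ^ (2 * n) * A.chainProb x V -
      wrongAvg A x / (2 * q + n).choose n ≤ (P.simulator n).prob N A x V := by
  refine le_trans ?_ (sum_rightV_le_prob A hP hp hlt hF hn hn0 hX hY x V)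
  have hC : (0 : ℝ) < (2 * q + n).choose n := by
    exact_mod_cast Nat.choose_pos (Nat.le_add_left n (2 * q))
  have hcp := A.chainProb_nonneg x V
  have hle := chainProb_le (A := A) hY hx hV
  set T := (∑ Θ : Fin n → Y, ∑ H : ↥(X₀ ∪ Y) × X → Y, A.rightV (fun φ => nsq (A.test x (V Θ) φ))
        (chainPt x Θ) Θ q 0 H A.start) /
          ((Y.card : ℝ) ^ n * (Y.card : ℝ) ^ Fintype.card (↥(X₀ ∪ Y) × X))
  have hN1 : 1 / (2 * q + n + 1 : ℝ) ≤ 1 := by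
    rw [div_le_one (by positivity)]; linarith [(Nat.cast_nonneg q : (0 : ℝ) ≤ q),
      (Nat.cast_nonneg n : (0 : ℝ) ≤ n)]
  have hN0 : 0 ≤ 1 / (2 * q + n + 1 : ℝ) := by positivity
  set δ := 1 / (2 * q + n + 1 : ℝ)
  have hw := wrongAvg_nonneg (A := A) x
  have hd : (0 : ℝ) < (2 * q + 1) ^ n := by positivity
  have h1 : (n.factorial : ℝ) / (2 * q + n + 1) ^ (2 * n) * A.chainProb x V ≤
      (1 - δ) / (2 * q + n).choose n * (T + wrongAvg A x) := by
    calc _ ≤ (1 - δ) / ((2 * q + n).choose n * (2 * q + 1) ^ n) *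
          ((2 * q + 1) ^ n * (T + wrongAvg A x)) := by
          refine mul_le_mul (factorial_div_pow_le hn0) hle hcp
            (div_nonneg (by linarith) (by positivity))
      _ = _ := by field_simp
  have h2 : (1 - δ) / (2 * q + n).choose n * wrongAvg A x ≤ wrongAvg A x / (2 * q + n).choose n := by
    rw [div_mul_eq_mul_div]
    gcongr
    nlinarith
  rw [mul_add] at h1
  linarith

end Params

end Final

theorem theorem3 :
    ∃ C k : ℕ, ∀ (n : ℕ), 0 < n →
    ∀ (U X : Type*) [DecidableEq U] [DecidableEq X] [Fintype X] [Nonempty X]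
      (X₀ Y : Finset U) [AddCommGroup Y], X₀.Nonempty → Y.Nonempty →
    ∀ N : HashNumbering X X₀ Y,
    ∃ S : Simulator n,
      S.size ≤ C * (n + X₀.card.size + (Fintype.card X).size + Y.card.size) ^ k ∧
      ∀ (q : ℕ) (σ R Z E : Type*) [Fintype σ] [DecidableEq σ] [Fintype Z]
        (A : OracleAlg (↥(X₀ ∪ Y) × X) Y (X₀ × (Fin n → X)) σ R Z E q),
        (∀ Θ : Fin n → Y, ∀ r ∈ S.run N A Θ,
          r.2.time ≤ C * (n + q + X₀.card.size + (Fintype.card X).size + Y.card.size) ^ k) ∧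
        ∃ ε : X₀ × (Fin n → X) → ℝ,
          (∀ x, 0 ≤ ε x) ∧ ∑ x, ε x = (n.factorial : ℝ) / Y.card ∧
          ∀ x : X₀ × (Fin n → X), Function.Injective x.2 →
          ∀ V : X₀ × (Fin n → X) → (Fin n → Y) → Matrix Z Z ℂ,
            (∀ y Θ, IsStarProjection (V y Θ)) →
            (n.factorial : ℝ) / (2 * q + n + 1) ^ (2 * n) * A.chainProb x (V x) - ε x
              ≤ S.prob N A x (V x) := by
  -- The running time dictates both numbers: n + 1 stages, quadratically many commands per stage,
  -- and numbers of quadratic bit length. The program length would need only degree 2.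
  refine ⟨3000000000, 5, ?_⟩
  intro n hn0 U X _ _ _ _ X₀ Y _ h₀ hY N
  obtain ⟨P, hn, hp, hcL, hcX, hcY, hlt, hsize⟩ := exists_simParams (X := X) n h₀
  have hP : N.Params P := ⟨hcL, hcX, hcY⟩
  have hX : 0 < Fintype.card X := Fintype.card_pos
  have hYL : P.cY ≤ P.cL := by
    rw [hcL, hcY]
    exact Finset.card_le_card Finset.subset_union_right
  have hcY0 : 0 < P.cY := hcY ▸ hY.card_pos
  have hcL0 : 0 < P.cL := hcY0.trans_le hYL
  have hcX0 : 0 < P.cX := hcX ▸ hX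
  have s1 := Nat.size_pos.2 h₀.card_pos
  have s2 := Nat.size_pos.2 hX
  have s3 := Nat.size_pos.2 hY.card_pos
  refine ⟨P.simulator n, ?_, ?_⟩
  · set L := n + X₀.card.size + (Fintype.card X).size + Y.card.size
    have hLp : P.cL ≤ P.p := (Nat.le_mul_of_pos_right _ hcX0).trans hlt.le
    have hXp : P.cX ≤ P.p := (Nat.le_mul_of_pos_left _ hcL0).trans hlt.le
    have h := size_simulator_le (sizeLE_of_le (P := P) (L := L) (by omega) (by omega)
      (by omega) hLp hXp (hYL.trans hLp)) n
    calc _ ≤ (n + 1) * (4000 * (5 * L)) := h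
      _ ≤ (2 * L) * (4000 * (5 * L)) := Nat.mul_le_mul_right _ (by omega)
      _ = 40000 * L ^ 2 := by ring
      _ ≤ _ := Nat.mul_le_mul (by norm_num) (Nat.pow_le_pow_right (by omega) (by norm_num))
  · intro q σ R Z E _ _ _ A
    have hF := fine_of_prime (q := q) hp hcL0 hcX0 hcY0 hYL hlt
    refine ⟨fun Θ r hr => ?_, ?_⟩
    · refine (run_time_le A hP hF hn hn0 Θ r hr).trans ?_
      rw [hn]
      exact time_const_le (by omega) (by omega) (by omega) (by omega) hn
    -- The error terms are chosen before x and V, which is possible because the wrong branches were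
    -- bounded without the predicate.
    · obtain ⟨ε, hε0, hεs, hε⟩ := exists_error A h₀ hY
      refine ⟨ε, hε0, hεs, fun x hx V hV => ?_⟩
      exact (sub_le_sub_left (hε x) _).trans
        (chainProb_sub_le_prob A hP hp hlt hF hn hn0 hX hY hx (hV x))
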